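/- Let $n\ge 1$, $m\ge 0$, and let $A$ and $B$ be structured matrices of sizes $n\times n$ and $n\times m$: every entry is either a fixed zero or a free parameter (a "nonzero entry"), and the free parameters take arbitrary real values independently of each other. Write $[n]=\{1,\dots,n\}$ and $\mathcal C_k(A,B)=[B,AB,\dots,A^{k-1}B]$; let $\mathrm{gk}\,\mathcal C_k(A,B)$ be the generic rank of this matrix, i.e. its maximum rank over all values of the free parameters, and let $\mu(A,B)=\min\{k\in[n]:\mathrm{gk}\,\mathcal C_k(A,B)=\mathrm{gk}\,\mathcal C_{k+1}(A,B)\}$ be the structural controllability index. For $l\in[n]$ the dynamic graph $\mathcal D_l(A,B)$ has the vertices $x_i^k$ ($i\in[n]$, $k\in[l]$) and $u_j^k$ ($j\in[m]$, $k\in[l]$), the edges $(x_j^{k+1},x_i^k)$ for $A_{ij}\ne0$, $k\in[l-1]$, and the edges $(u_j^k,x_i^k)$ for $B_{ij}\ne 0$, $k\in[l]$. Put $V_B=\{u_j^k\}$ and $V_X=\{x_1^1,\dots,x_n^1\}$. Let $d(\mathcal D_l(A,B))$ be the maximum number of pairwise vertex-disjoint paths in $\mathcal D_l(A,B)$ that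 each start in $V_B$ and end in $V_X$, and let $$\mu_{\rm low}=\min\{k\in[n]: d(\mathcal D_k(A,B))=d(\mathcal D_n(A,B))\}.$$ The flow network $\mathcal F(A,B)$ is obtained from $\mathcal D_n(A,B)$ by splitting each vertex $v$ into $v^i,v^o$ joined by an edge $(v^i,v^o)$, replacing each edge $(v,w)$ by $(v^o,w^i)$, and adding a source $s$, a sink $t$, the edges $(s,v^i)$ for $v\in V_B$ and the edges $(v^o,t)$ for $v\in V_X$. All capacities are $1$; the edge $(u_j^{ki},u_j^{ko})$ has cost $k$ (its layer index), and every other edge has cost $0$. For a flow $f$ on $\mathcal F(A,B)$ let $\gamma(f)$ be the largest $k\in[n]$ such that $f(u_j^{ki},u_j^{ko})>0$ for some $j\in[m]$. Then: 1. $\mu_{\rm low}\le\mu(A,B)$. 2. If $B$ has at least one nonzero entry, then $\mu_{\rm low}=\gamma(f^*)$ for every integral minimum-cost maximum flow $f^*$ of $\mathcal F(A,B)$. 3. $\mu_{\rm low}$ can be computed from the zero/nonzero patterns of $A$ and $B$ in $\tilde O(n^5)$ time on a random access machine, where $m=O(n)$ and $\tilde O(n^5)$ means $O(n^5\log^p n)$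 for some constant $p$. -/

import Mathlib

namespace StructCtrl

/-! ## Structured pairs, generic rank, structural controllability index

A structured matrix is given by its zero/nonzero pattern: the entry `true` is a free parameter,
the entry `false` is a fixed zero.  The free parameters take arbitrary real values, independently
of each other. -/

/-- `M'` is a realization of the structured matrix with pattern `M`. -/
def IsRealization {p q : ℕ} (M : Matrix (Fin p) (Fin q) Bool) (M' : Matrix (Fin p) (Fin q) ℝ) :
    Prop :=
  ∀ i j, M i j = false → M' i j = 0

/-- The `k`-step controllability matrix `[B, A B, …, A ^ (k - 1) B]`; its columns are indexed by
the pairs (block, column of the block). -/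
def ctrbMatrix {n m : ℕ} (A : Matrix (Fin n) (Fin n) ℝ) (B : Matrix (Fin n) (Fin m) ℝ) (k : ℕ) :
    Matrix (Fin n) (Fin k × Fin m) ℝ :=
  Matrix.of fun i c => (A ^ (c.1 : ℕ) * B) i c.2

/-- The generic rank of the `k`-step controllability matrix of the structured pair `(A, B)`: the
maximum of its rank over all realizations (the ranks are bounded by `n`). -/
noncomputable def genericRank {n m : ℕ} (A : Matrix (Fin n) (Fin n) Bool)
    (B : Matrix (Fin n) (Fin m) Bool) (k : ℕ) : ℕ :=
  sSup {r : ℕ | ∃ (A' : Matrix (Fin n) (Fin n) ℝ) (B' : Matrix (Fin n) (Fin m) ℝ),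
    IsRealization A A' ∧ IsRealization B B' ∧ (ctrbMatrix A' B' k).rank = r}

/-- The structural controllability index `μ(A, B)`. -/
noncomputable def scoi {n m : ℕ} (A : Matrix (Fin n) (Fin n) Bool)
    (B : Matrix (Fin n) (Fin m) Bool) : ℕ :=
  sInf {k : ℕ | k ∈ Set.Icc 1 n ∧ genericRank A B k = genericRank A B (k + 1)}

/-! ## Linkings in the dynamic graph -/

/-- The family `p` of `r` paths of the digraph `G` is a linking of size `r` from `S` to `T`: the
paths are pairwise vertex-disjoint, each starts in `S` and ends in `T`.  A path is written as the
nonempty list of its vertices. -/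
structure IsLinking {V : Type*} (G : Digraph V) (S T : Set V) {r : ℕ} (p : Fin r → List V) :
    Prop where
  ne_nil : ∀ i, p i ≠ []
  chain : ∀ i, (p i).IsChain G.Adj
  start_mem : ∀ i, ∀ v ∈ (p i).head?, v ∈ S
  end_mem : ∀ i, ∀ v ∈ (p i).getLast?, v ∈ T
  disjoint : Pairwise fun i j => List.Disjoint (p i) (p j)

/-- The vertices of the dynamic graph with `l` layers: `Sum.inl (i, k)` is the copy of the state
node `x_i` in layer `k + 1` and `Sum.inr (j, k)` is the copy of the input node `u_j` in layer
`k + 1`, where `k = 0, …, l - 1`. -/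
abbrev DynVertex (n m l : ℕ) : Type := (Fin n × Fin l) ⊕ (Fin m × Fin l)

/-- The dynamic graph `D_l(A, B)`: an edge from `x_j` in layer `k + 1` to `x_i` in layer `k` when
`A i j ≠ 0`, and an edge from `u_j` in layer `k` to `x_i` in layer `k` when `B i j ≠ 0`. -/
def dynGraph {n m : ℕ} (A : Matrix (Fin n) (Fin n) Bool) (B : Matrix (Fin n) (Fin m) Bool)
    (l : ℕ) : Digraph (DynVertex n m l) where
  Adj v w :=
    match v, w with
    | .inl (j, k'), .inl (i, k) => (k' : ℕ) = k + 1 ∧ A i j = true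
    | .inr (j, k'), .inl (i, k) => k' = k ∧ B i j = true
    | _, .inr _ => False

/-- `V_B`: all the copies of the input nodes. -/
def inputVertices (n m l : ℕ) : Set (DynVertex n m l) := {v | ∃ j k, v = .inr (j, k)}

/-- `V_X`: the copies of the state nodes in the first layer. -/
def firstLayer (n m l : ℕ) : Set (DynVertex n m l) :=
  {v | ∃ (i : Fin n) (k : Fin l), (k : ℕ) = 0 ∧ v = .inl (i, k)}

/-- `d(D_l(A, B))`: the maximum size of a linking from `V_B` to `V_X` in `D_l(A, B)` (the sizes
are bounded by `n`). -/
noncomputable def maxLinking {n m : ℕ} (A : Matrix (Fin n) (Fin n) Bool)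
    (B : Matrix (Fin n) (Fin m) Bool) (l : ℕ) : ℕ :=
  sSup {r : ℕ | ∃ p : Fin r → List (DynVertex n m l),
    IsLinking (dynGraph A B l) (inputVertices n m l) (firstLayer n m l) p}

/-- `μ_low`: the least `k` in `{1, …, n}` with `d(D_k(A, B)) = d(D_n(A, B))`. -/
noncomputable def muLow {n m : ℕ} (A : Matrix (Fin n) (Fin n) Bool)
    (B : Matrix (Fin n) (Fin m) Bool) : ℕ :=
  sInf {k : ℕ | k ∈ Set.Icc 1 n ∧ maxLinking A B k = maxLinking A B n}

/-! ## Flow networks -/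

/-- A directed graph with a source, a sink, edge capacities and edge costs. -/
structure FlowNetwork (V : Type*) extends Digraph V where
  source : V
  sink : V
  cap : V → V → ℝ
  cost : V → V → ℝ

namespace FlowNetwork

variable {V : Type*} [Fintype V]

/-- `f` is a flow on `N`.  A function on the edges is written as a function of pairs of vertices
that vanishes at the pairs that are not edges. -/
structure IsFlow (N : FlowNetwork V) (f : V → V → ℝ) : Prop where
  nonneg : ∀ v w, 0 ≤ f v w
  off_edge : ∀ v w, ¬ N.Adj v w → f v w = 0
  le_cap : ∀ v w, N.Adj v w → f v w ≤ N.cap v w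
  conserve : ∀ v, v ≠ N.source → v ≠ N.sink → ∑ u, f u v = ∑ w, f v w

/-- The value of a flow: the net flow out of the source. -/
def flowValue (N : FlowNetwork V) (f : V → V → ℝ) : ℝ :=
  ∑ w, f N.source w - ∑ u, f u N.source

/-- The cost of a flow. -/
def flowCost (N : FlowNetwork V) (f : V → V → ℝ) : ℝ :=
  ∑ v, ∑ w, f v w * N.cost v w

/-- `f` is a maximum flow. -/
def IsMaxFlow (N : FlowNetwork V) (f : V → V → ℝ) : Prop :=
  N.IsFlow f ∧ ∀ g, N.IsFlow g → N.flowValue g ≤ N.flowValue f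

/-- `f` is a minimum cost maximum flow. -/
def IsMCMF (N : FlowNetwork V) (f : V → V → ℝ) : Prop :=
  N.IsMaxFlow f ∧ ∀ g, N.IsMaxFlow g → N.flowCost f ≤ N.flowCost g

end FlowNetwork

/-- `f` takes integer values only. -/
def IsIntegralFlow {V : Type*} (f : V → V → ℝ) : Prop := ∀ v w, ∃ z : ℤ, f v w = z

/-- The vertices of the network obtained from a graph on `V` by splitting every vertex `v` into
`v^i` and `v^o` and adding a source and a sink. -/
inductive SplitVertex (V : Type*) where
  | source : SplitVertex V
  | sink : SplitVertex V
  | inn (v : V) : SplitVertex V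
  | out (v : V) : SplitVertex V
  deriving DecidableEq, Fintype

/-- The layered flow network `F(A, B)`, built from `D_n(A, B)`.  Its edges are `(v^i, v^o)` for
each vertex `v`, `(v^o, w^i)` for each edge `(v, w)`, the edges from the source to `v^i` for `v` in
`V_B`, and the edges from `v^o` to the sink for `v` in `V_X`.  All capacities are `1`.  The edge
`(v^i, v^o)` costs `k` when `v` is a copy of an input node in layer `k`; all other edges cost
`0`. -/
def layeredNetwork {n m : ℕ} (A : Matrix (Fin n) (Fin n) Bool) (B : Matrix (Fin n) (Fin m) Bool) :
    FlowNetwork (SplitVertex (DynVertex n m n)) where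
  Adj a b :=
    match a, b with
    | .inn v, .out w => v = w
    | .out v, .inn w => (dynGraph A B n).Adj v w
    | .source, .inn v => v ∈ inputVertices n m n
    | .out v, .sink => v ∈ firstLayer n m n
    | _, _ => False
  source := .source
  sink := .sink
  cap _ _ := 1
  cost a b :=
    match a, b with
    | .inn (.inr (_, k)), .out _ => (k : ℝ) + 1
    | _, _ => 0

/-- `γ(f)`: the highest layer index `k` such that the edge `(v^i, v^o)` is occupied in `f` for some
copy `v` of an input node in layer `k`. -/
noncomputable def gamma {n m : ℕ}
    (f : SplitVertex (DynVertex n m n) → SplitVertex (DynVertex n m n) → ℝ) : ℕ :=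
  sSup {l : ℕ | ∃ (j : Fin m) (k : Fin n),
    l = (k : ℕ) + 1 ∧ 0 < f (.inn (.inr (j, k))) (.out (.inr (j, k)))}

/-! ## Random access machines with logarithmic cost

The memory has one cell for each natural number, and each cell holds a natural number.  A program
is a fixed finite text in structured form (assignments, branches, loops) with indirect addressing.
Every elementary step is charged with the bit lengths of all numbers and addresses it handles. -/

/-- The arithmetic operations of the machine (`sub` is truncated at `0`). -/
inductive ArithOp where
  | add | sub | mul | div | mod

/-- The result of an operation. -/
def ArithOp.eval : ArithOp → ℕ → ℕ → ℕ
  | .add, a, b => a + b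
  | .sub, a, b => a - b
  | .mul, a, b => a * b
  | .div, a, b => a / b
  | .mod, a, b => a % b

/-- The cost of an operation: linear in the bit lengths for addition and subtraction, their
product (the schoolbook methods) for multiplication and division. -/
def ArithOp.cost : ArithOp → ℕ → ℕ → ℕ
  | .add, a, b | .sub, a, b => 1 + a.size + b.size
  | .mul, a, b | .div, a, b | .mod, a, b => (1 + a.size) * (1 + b.size)

/-- Expressions: constants, the content of the cell with a computed address, and arithmetic. -/
inductive RamExpr where
  | lit (c : ℕ)
  | mem (addr : RamExpr)
  | bin (o : ArithOp) (e₁ e₂ : RamExpr)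

/-- The value of an expression in the memory `σ`. -/
def RamExpr.eval (σ : ℕ → ℕ) : RamExpr → ℕ
  | .lit c => c
  | .mem e => σ (e.eval σ)
  | .bin o e₁ e₂ => o.eval (e₁.eval σ) (e₂.eval σ)

/-- The cost of evaluating an expression in the memory `σ`. -/
def RamExpr.cost (σ : ℕ → ℕ) : RamExpr → ℕ
  | .lit c => 1 + c.size
  | .mem e => e.cost σ + (1 + (e.eval σ).size + (σ (e.eval σ)).size)
  | .bin o e₁ e₂ => e₁.cost σ + e₂.cost σ + o.cost (e₁.eval σ) (e₂.eval σ)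

/-- Programs.  `store a e` writes the value of `e` into the cell whose address is the value of `a`;
the tests of `ite` and `loop` succeed when the value of the expression is not `0`. -/
inductive RamProg where
  | skip
  | store (addr val : RamExpr)
  | seq (P Q : RamProg)
  | ite (test : RamExpr) (P Q : RamProg)
  | loop (test : RamExpr) (P : RamProg)

/-- `RunsIn P σ t σ'`: started with memory `σ`, the program `P` halts with memory `σ'`, and the
total cost of the run is `t`. -/
inductive RunsIn : RamProg → (ℕ → ℕ) → ℕ → (ℕ → ℕ) → Prop where
  | skip (σ : ℕ → ℕ) : RunsIn .skip σ 1 σ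
  | store (a e : RamExpr) (σ : ℕ → ℕ) :
      RunsIn (.store a e) σ
        (a.cost σ + e.cost σ + (1 + (a.eval σ).size + (e.eval σ).size))
        (Function.update σ (a.eval σ) (e.eval σ))
  | seq {P Q : RamProg} {σ σ' σ'' : ℕ → ℕ} {t t' : ℕ} :
      RunsIn P σ t σ' → RunsIn Q σ' t' σ'' → RunsIn (.seq P Q) σ (t + t') σ''
  | ite_true {b : RamExpr} {P Q : RamProg} {σ σ' : ℕ → ℕ} {t : ℕ} :
      b.eval σ ≠ 0 → RunsIn P σ t σ' → RunsIn (.ite b P Q) σ (b.cost σ + 1 + t) σ'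
  | ite_false {b : RamExpr} {P Q : RamProg} {σ σ' : ℕ → ℕ} {t : ℕ} :
      b.eval σ = 0 → RunsIn Q σ t σ' → RunsIn (.ite b P Q) σ (b.cost σ + 1 + t) σ'
  | loop_done {b : RamExpr} {P : RamProg} {σ : ℕ → ℕ} :
      b.eval σ = 0 → RunsIn (.loop b P) σ (b.cost σ + 1) σ
  | loop_step {b : RamExpr} {P : RamProg} {σ σ' σ'' : ℕ → ℕ} {t t' : ℕ} :
      b.eval σ ≠ 0 → RunsIn P σ t σ' → RunsIn (.loop b P) σ' t' σ'' →
      RunsIn (.loop b P) σ (b.cost σ + 1 + t + t') σ''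

/-- The initial memory on the input `(A, B)`: the numbers `n` and `m`, then the entries of `A` and
the entries of `B` row by row (`1` for a free parameter, `0` for a fixed zero), then zeros. -/
def initMemory {n m : ℕ} (A : Matrix (Fin n) (Fin n) Bool) (B : Matrix (Fin n) (Fin m) Bool) :
    ℕ → ℕ := fun a =>
  ([n, m] ++ List.ofFn (fun q : Fin (n * n) => (A q.divNat q.modNat).toNat)
    ++ List.ofFn (fun q : Fin (n * m) => (B q.divNat q.modNat).toNat)).getD a 0

end StructCtrl

open StructCtrl

/-!
**Linkings as matchings.**  A linking in the dynamic graph that starts in a set `I` of input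
vertices is a matching of a layered bipartite graph in which every copy of a state above the first
layer may also be matched to itself, meaning that it lies on no path (`Linkable`).  Hence the sets
of starting points are the independent sets of a matroid, a contraction of a transversal one, and a
linkable set of smaller size can always be enlarged by an element of a larger one
(`Linkable.augment`).

**The lower bound.**  In any realization, a set of linearly independent columns of the
controllability matrix gives a linearly independent family of vectors supported on the edges of the
layered graph, so Hall's condition holds and the indices of the columns are linkable
(`linkable_of_linearIndependent`).  Thus the generic rank of the `k`-step matrix is at most the
largest size of a linking in `k` layers.

Conversely the largest size `d` of a linking, in however many layers, is at most the generic rank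
of the `n`-step matrix.  The end points of linkings form backward sequences of sets of states, each
matched into the next one and the inputs, which can be kept at size at least `d` for ever
(`exists_stepsBack_sequence`).  Some set occurs twice; the average of the matchings over the period
in between, completed at the inputs and the states outside, is a doubly stochastic matrix, and by
Birkhoff's theorem one of its permutations covers at least `d` states by stems, which begin at an
input, and disjoint cycles (`exists_isCover_maxLinking_le`).  Each cycle is then reached from an
input along a shortest path, and its entry edge gets a weight of its own.  The generating
functions of the states on the cycle entered at `c` carry the factor
`1 - weight c * X ^ period c` in their denominators, besides the factors of cycles upstream;
distinct weights make these polynomials pairwise coprime, so that the rows of the covered states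
are linearly independent (`eq_zero_of_gen_relation`).

The controllability subspaces of one realization stabilize once they fail to grow, and a single
realization can attain two generic ranks at once, so the generic rank is constant from the
structural controllability index on (`genericRank_eq_of_succ_eq`).  At that index it equals `d`,
and so does the size of a largest linking, which lies between the two.

**Flows.**  An integral flow in the layered network carries one unit through each member of a
linkable set of inputs; its value is the size of this set and its cost the sum of the layers.
A starting point in a layer above `muLow` could be exchanged for one in a layer up to `muLow`,
which lowers the cost; conversely all starting points of a maximum flow lie in the layers up to
`gamma`, which therefore already carry a largest linking (`muLow_eq_gamma`).

**The running time.**  By the exchange property, the greedy choice of inputs in the order of their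
layers takes its last input, if any, in the layer `muLow` (`eq_muLow_of_greedy`).  Each of the
`O(n ^ 2)` inputs is tested by one search for an augmenting path in the bipartite graph, which has
`O(n ^ 2)` vertices and `O(n ^ 3)` edges.  The program is written in a language of bounded loops
over arrays, in which all numbers stay below a polynomial in `n`; it is compiled to the random
access machine at a cost per step quadratic in the bit length of these numbers
(`Stmt.exists_ramProg`).
-/

namespace StructCtrl

/-! ### Matchings in locally finite bipartite graphs -/

section Matchable

variable {α β : Type*}

/-- The set `S` of vertices can be matched in the bipartite graph in which the vertex `a` has the
neighbours `N a`. -/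
def Matchable (N : α → Finset β) (S : Set α) : Prop :=
  ∃ φ : α → β, S.InjOn φ ∧ ∀ a ∈ S, φ a ∈ N a

theorem Matchable.mono {N : α → Finset β} {S T : Set α} (h : Matchable N T) (hST : S ⊆ T) :
    Matchable N S := by
  obtain ⟨φ, h1, h2⟩ := h
  exact ⟨φ, h1.mono hST, fun a ha => h2 a (hST ha)⟩

variable [DecidableEq β]

theorem Matchable.card_le {N : α → Finset β} {S : Set α} (h : Matchable N S) {Z : Finset α}
    (hZ : (Z : Set α) ⊆ S) : Z.card ≤ (Z.biUnion N).card := by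
  obtain ⟨φ, h1, h2⟩ := h
  refine Finset.card_le_card_of_injOn φ (fun a ha => ?_) (h1.mono hZ)
  exact Finset.mem_coe.2 (Finset.mem_biUnion.2 ⟨a, ha, h2 a (hZ ha)⟩)

theorem matchable_of_hall [Nonempty β] {N : α → Finset β} {S : Set α}
    (h : ∀ Z : Finset α, (Z : Set α) ⊆ S → Z.card ≤ (Z.biUnion N).card) : Matchable N S := by
  classical
  obtain ⟨f, hf1, hf2⟩ := (Finset.all_card_le_biUnion_card_iff_exists_injective
    (fun a : S => N a)).1 (fun Z => by
      have := h (Z.map (Function.Embedding.subtype _)) (by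
        intro a ha
        obtain ⟨b, -, rfl⟩ := Finset.mem_map.1 (Finset.mem_coe.1 ha)
        exact b.2)
      rw [Finset.card_map, Finset.map_eq_image, Finset.image_biUnion] at this
      exact this)
  refine ⟨fun a => if ha : a ∈ S then f ⟨a, ha⟩ else Classical.arbitrary β, ?_, ?_⟩
  · intro a ha b hb hab
    simp only [ha, hb, dif_pos] at hab
    exact congrArg Subtype.val (hf1 hab)
  · intro a ha
    simp only [ha, dif_pos]
    exact hf2 ⟨a, ha⟩

/-- A vertex that cannot be added to a matchable set lies in a finite set whose neighbours are
exactly the partners of its other elements. -/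
theorem exists_tight_of_not_matchable [Nonempty β] {N : α → Finset β} {S : Set α} {φ : α → β}
    (h1 : S.InjOn φ) (h2 : ∀ a ∈ S, φ a ∈ N a) {f : α} (hf : ¬ Matchable N (insert f S)) :
    ∃ Z : Finset α, f ∈ Z ∧ (Z : Set α) ⊆ insert f S ∧
      ∀ b ∈ Z.biUnion N, ∃ a ∈ Z, a ∈ S ∧ φ a = b := by
  classical
  have : ∃ Z : Finset α, (Z : Set α) ⊆ insert f S ∧ (Z.biUnion N).card < Z.card := by
    by_contra! hc
    exact hf (matchable_of_hall hc)
  obtain ⟨Z, hZ, hlt⟩ := this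
  have hfZ : f ∈ Z := by
    by_contra hfZ
    have hZS : (Z : Set α) ⊆ S := fun a ha => by
      rcases hZ ha with rfl | h
      · exact absurd ha hfZ
      · exact h
    have := Matchable.card_le (N := N) ⟨φ, h1, h2⟩ hZS
    omega
  have hES : ((Z.erase f : Finset α) : Set α) ⊆ S := fun a ha => by
    have ha' := Finset.mem_erase.1 (Finset.mem_coe.1 ha)
    exact (hZ ha'.2).resolve_left ha'.1
  refine ⟨Z, hfZ, hZ, ?_⟩
  have hsub : (Z.erase f).image φ ⊆ Z.biUnion N := by
    intro b hb
    obtain ⟨a, ha, rfl⟩ := Finset.mem_image.1 hb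
    exact Finset.mem_biUnion.2 ⟨a, Finset.mem_of_mem_erase ha, h2 a (hES ha)⟩
  have hcard : ((Z.erase f).image φ).card = Z.card - 1 := by
    rw [Finset.card_image_of_injOn (h1.mono hES), Finset.card_erase_of_mem hfZ]
  have heq := Finset.eq_of_subset_of_card_le hsub (by omega)
  intro b hb
  rw [← heq] at hb
  obtain ⟨a, ha, rfl⟩ := Finset.mem_image.1 hb
  exact ⟨a, Finset.mem_of_mem_erase ha, hES ha, rfl⟩

/-- The exchange property of transversal matroids, contracted by a set `S` that may be infinite. -/
theorem Matchable.augment [Nonempty β] [DecidableEq α] {N : α → Finset β} {S : Set α}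
    {I J : Finset α}
    (hI : Matchable N (S ∪ I)) (hJ : Matchable N (S ∪ J)) (hIS : ∀ a ∈ I, a ∉ S)
    (hJS : ∀ a ∈ J, a ∉ S) (hlt : I.card < J.card) :
    ∃ f ∈ J, f ∉ I ∧ Matchable N (S ∪ (insert f I : Finset α)) := by
  classical
  by_contra! hc
  obtain ⟨φ, h1, h2⟩ := hI
  have hset : ∀ f, (S ∪ (insert f I : Finset α) : Set α) = insert f (S ∪ I) := fun f => by
    rw [Finset.coe_insert, Set.union_insert]
  have key : ∀ f : α, ∃ Z : Finset α, f ∈ J → f ∉ I → (f ∈ Z ∧ (Z : Set α) ⊆ insert f (S ∪ I) ∧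
      ∀ b ∈ Z.biUnion N, ∃ a ∈ Z, a ∈ (S ∪ I : Set α) ∧ φ a = b) := by
    intro f
    by_cases hf : f ∈ J ∧ f ∉ I
    · have := hc f hf.1 hf.2
      rw [hset] at this
      obtain ⟨Z, hZ⟩ := exists_tight_of_not_matchable h1 h2 this
      exact ⟨Z, fun _ _ => hZ⟩
    · exact ⟨∅, fun h h' => absurd ⟨h, h'⟩ hf⟩
  choose Z hZ using key
  -- the union of the tight sets of all the rejected elements
  set W : Finset α := (J \ I).biUnion Z with hW
  have hJW : J \ I ⊆ W := fun f hf => by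
    have hf' := Finset.mem_sdiff.1 hf
    exact Finset.mem_biUnion.2 ⟨f, hf, (hZ f hf'.1 hf'.2).1⟩
  have hNW : W.biUnion N ⊆ (W.filter (fun a => a ∈ (S ∪ I : Set α))).image φ := by
    intro b hb
    obtain ⟨a, ha, hab⟩ := Finset.mem_biUnion.1 hb
    obtain ⟨f, hf, haf⟩ := Finset.mem_biUnion.1 ha
    have hf' := Finset.mem_sdiff.1 hf
    obtain ⟨a', ha', ha'S, rfl⟩ := (hZ f hf'.1 hf'.2).2.2 b (Finset.mem_biUnion.2 ⟨a, haf, hab⟩)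
    exact Finset.mem_image_of_mem _ (Finset.mem_filter.2
      ⟨Finset.mem_biUnion.2 ⟨f, hf, ha'⟩, ha'S⟩)
  have c1 : (W.biUnion N).card ≤ (W.filter (fun a => a ∈ (S ∪ I : Set α))).card :=
    (Finset.card_le_card hNW).trans Finset.card_image_le
  have c2 : (W.filter (fun a => a ∈ (S ∪ J : Set α))).card ≤ (W.biUnion N).card := by
    refine (hJ.card_le (Z := W.filter (fun a => a ∈ (S ∪ J : Set α))) ?_).trans
      (Finset.card_le_card (Finset.biUnion_subset_biUnion_of_subset_left _
        (Finset.filter_subset _ _)))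
    intro a ha
    exact (Finset.mem_filter.1 (Finset.mem_coe.1 ha)).2
  have split : ∀ K : Finset α, (∀ a ∈ K, a ∉ S) →
      (W.filter (fun a => a ∈ (S ∪ K : Set α))).card
        = (W.filter (fun a => a ∈ S)).card + (W ∩ K).card := by
    intro K hK
    rw [← Finset.card_union_of_disjoint]
    · congr 1
      ext a
      simp only [Finset.mem_filter, Set.mem_union, Finset.mem_coe, Finset.mem_union,
        Finset.mem_inter]
      tauto
    · rw [Finset.disjoint_left]
      intro a ha ha'
      exact hK a (Finset.mem_inter.1 ha').2 (Finset.mem_filter.1 ha).2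
  rw [split J hJS] at c2
  rw [split I hIS] at c1
  have d1 : (W ∩ J).card + (J \ W).card = J.card := by
    rw [Finset.inter_comm, Finset.card_inter_add_card_sdiff]
  have d2 : (W ∩ I).card + (I \ W).card = I.card := by
    rw [Finset.inter_comm, Finset.card_inter_add_card_sdiff]
  have d3 : (J \ W).card ≤ (I \ W).card := by
    refine Finset.card_le_card fun a ha => ?_
    have ha' := Finset.mem_sdiff.1 ha
    refine Finset.mem_sdiff.2 ⟨?_, ha'.2⟩
    by_contra haI
    exact ha'.2 (hJW (Finset.mem_sdiff.2 ⟨ha'.1, haI⟩))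
  omega

end Matchable


/-! ### Linkings in the dynamic graph as matchings of a layered bipartite graph -/

section Layered

variable {n m : ℕ} (A : Matrix (Fin n) (Fin n) Bool) (B : Matrix (Fin n) (Fin m) Bool)

/-- The pattern of the block matrix `[A B]`. -/
def edge (i : Fin n) (t : Fin n ⊕ Fin m) : Bool := Sum.elim (A i) (B i) t

/-- The tails of the layered bipartite graph, with layers counted from `0`: `(inr j, k)` is the copy
of the input `u_j` in layer `k`, and `(inl t, k)` is the copy of the state `x_t` in layer `k + 1`.
In both cases the edges of the dynamic graph lead from the tail into layer `k`. -/
abbrev LNode (n m : ℕ) : Type := (Fin n ⊕ Fin m) × ℕ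

/-- The heads of the layered bipartite graph: `(i, k)` is the copy of the state `x_i` in
layer `k`, counted from `0`. There are infinitely many layers. -/
abbrev RNode (n : ℕ) : Type := Fin n × ℕ

/-- The neighbours of a tail: the successors of the vertex in the dynamic graph and, for a state,
the vertex itself. Matching a state to itself means that it is not used. -/
def heads (v : LNode n m) : Finset (RNode n) :=
  (Finset.univ.filter (fun i => edge A B i v.1 = true)).image (fun i => (i, v.2)) ∪
    (match v.1 with
      | .inl t => {(t, v.2 + 1)}
      | .inr _ => ∅)

theorem mem_heads {v : LNode n m} {w : RNode n} :
    w ∈ heads A B v ↔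
      (w.2 = v.2 ∧ edge A B w.1 v.1 = true) ∨ (w.2 = v.2 + 1 ∧ v.1 = .inl w.1) := by
  obtain ⟨i, k⟩ := w
  obtain ⟨t | j, l⟩ := v
  · simp only [heads, Finset.mem_union, Finset.mem_image, Finset.mem_filter, Finset.mem_univ,
      true_and, Finset.mem_singleton, Prod.mk.injEq, Sum.inl.injEq]
    constructor
    · rintro (⟨a, h, rfl, rfl⟩ | ⟨rfl, rfl⟩)
      · exact Or.inl ⟨rfl, h⟩
      · exact Or.inr ⟨rfl, rfl⟩
    · rintro (⟨rfl, h⟩ | ⟨rfl, rfl⟩)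
      · exact Or.inl ⟨i, h, rfl, rfl⟩
      · exact Or.inr ⟨rfl, rfl⟩
  · simp only [heads, Finset.mem_union, Finset.mem_image, Finset.mem_filter, Finset.mem_univ,
      true_and, Finset.notMem_empty, or_false, Prod.mk.injEq, reduceCtorEq, and_false]
    constructor
    · rintro ⟨a, h, rfl, rfl⟩
      exact ⟨rfl, h⟩
    · rintro ⟨rfl, h⟩
      exact ⟨i, h, rfl, rfl⟩

/-- All the states of the layers `1, 2, …`, as tails. -/
def stateTails (n m : ℕ) : Set (LNode n m) := {v | ∃ t k, v = (.inl t, k)}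

/-- The tail of an input vertex. -/
def inputTail (u : Fin m × ℕ) : LNode n m := (.inr u.1, u.2)

theorem inputTail_injective : Function.Injective (inputTail : Fin m × ℕ → LNode n m) := by
  rintro ⟨a, b⟩ ⟨c, d⟩ h
  simpa [inputTail] using h

/-- The set `I` of input vertices is the set of the starting points of a linking into the first
layer, stated as the existence of a matching. -/
def Linkable (I : Finset (Fin m × ℕ)) : Prop :=
  Matchable (heads A B) (stateTails n m ∪ (I.image inputTail : Finset (LNode n m)))

variable {A B}

theorem Linkable.mono {I J : Finset (Fin m × ℕ)} (h : Linkable A B J) (hIJ : I ⊆ J) :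
    Linkable A B I :=
  Matchable.mono h (Set.union_subset_union_right _
    (Finset.coe_subset.2 (Finset.image_subset_image hIJ)))

/-- The exchange property of the gammoid of the linkable sets of input vertices. -/
theorem Linkable.augment (hn : 0 < n) {I J : Finset (Fin m × ℕ)} (hI : Linkable A B I)
    (hJ : Linkable A B J) (hlt : I.card < J.card) :
    ∃ u ∈ J, u ∉ I ∧ Linkable A B (insert u I) := by
  have : Nonempty (RNode n) := ⟨(⟨0, hn⟩, 0)⟩
  have hdis : ∀ K : Finset (Fin m × ℕ), ∀ a ∈ K.image (inputTail (n := n)),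
      a ∉ stateTails n m := by
    intro K a ha
    obtain ⟨u, -, rfl⟩ := Finset.mem_image.1 ha
    rintro ⟨t, k, h⟩
    simp [inputTail] at h
  obtain ⟨f, hf, hfI, hM⟩ := Matchable.augment hI hJ (hdis I) (hdis J) (by
    rwa [Finset.card_image_of_injective _ inputTail_injective,
      Finset.card_image_of_injective _ inputTail_injective])
  obtain ⟨u, hu, rfl⟩ := Finset.mem_image.1 hf
  refine ⟨u, hu, fun h => hfI (Finset.mem_image_of_mem _ h), ?_⟩
  rw [Linkable, Finset.image_insert]
  exact hM

variable (A B) in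
/-- A linking from the set `I` of input vertices into the first layer: the path that starts at
`u = (j, k)` visits the state `x u s` in layer `s`, for `s = k, …, 0`. The values `x u s` with
`u ∉ I` or `s > k` are irrelevant. -/
structure IsRouting (I : Finset (Fin m × ℕ)) (x : Fin m × ℕ → ℕ → Fin n) : Prop where
  start : ∀ u ∈ I, B (x u u.2) u.1 = true
  step : ∀ u ∈ I, ∀ s < u.2, A (x u s) (x u (s + 1)) = true
  disj : ∀ u ∈ I, ∀ v ∈ I, u ≠ v → ∀ s ≤ u.2, s ≤ v.2 → x u s ≠ x v s

/-- A matching yields a linking: follow the matching from every chosen input. -/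
theorem Linkable.exists_routing {I : Finset (Fin m × ℕ)} (h : Linkable A B I) :
    ∃ x, IsRouting A B I x := by
  obtain ⟨φ, hinj, hφ⟩ := h
  have memI : ∀ u ∈ I, (Sum.inr u.1, u.2) ∈
      (stateTails n m ∪ (I.image inputTail : Finset (LNode n m)) : Set (LNode n m)) :=
    fun u hu => Or.inr (Finset.mem_coe.2 (Finset.mem_image.2 ⟨u, hu, rfl⟩))
  have memS : ∀ t k, (Sum.inl t, k) ∈
      (stateTails n m ∪ (I.image inputTail : Finset (LNode n m)) : Set (LNode n m)) :=
    fun t k => Or.inl ⟨t, k, rfl⟩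
  let y : Fin m × ℕ → ℕ → Fin n := fun u d =>
    Nat.rec (φ (.inr u.1, u.2)).1 (fun d i => (φ (.inl i, u.2 - (d + 1))).1) d
  have y0 : ∀ u, y u 0 = (φ (.inr u.1, u.2)).1 := fun u => rfl
  have ys : ∀ u d, y u (d + 1) = (φ (.inl (y u d), u.2 - (d + 1))).1 := fun u d => rfl
  have base : ∀ u ∈ I, φ (.inr u.1, u.2) = (y u 0, u.2) ∧ B (y u 0) u.1 = true := by
    intro u hu
    have := (mem_heads A B).1 (hφ _ (memI u hu))
    simp only [edge, Sum.elim_inr, reduceCtorEq, and_false, or_false] at this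
    exact ⟨Prod.ext (y0 u).symm this.1, this.2⟩
  have stp : ∀ u ∈ I, ∀ d, d + 1 ≤ u.2 →
      φ (.inl (y u d), u.2 - (d + 1)) = (y u (d + 1), u.2 - (d + 1)) ∧
      A (y u (d + 1)) (y u d) = true := by
    intro u hu d
    -- a state that is entered by a path cannot be matched to itself
    have main : ∀ d, d + 1 ≤ u.2 → (∃ v ∈ (stateTails n m ∪ (I.image inputTail :
        Finset (LNode n m)) : Set (LNode n m)), v ≠ (.inl (y u d), u.2 - (d + 1)) ∧
          φ v = (y u d, u.2 - d)) →
        φ (.inl (y u d), u.2 - (d + 1)) = (y u (d + 1), u.2 - (d + 1)) ∧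
          A (y u (d + 1)) (y u d) = true := by
      intro d hd ⟨v, hv, hne, hφv⟩
      rcases (mem_heads A B).1 (hφ _ (memS (y u d) (u.2 - (d + 1)))) with h1 | h1
      · simp only [edge, Sum.elim_inl] at h1
        exact ⟨Prod.ext (ys u d).symm h1.1, by rw [ys]; exact h1.2⟩
      · exfalso
        refine hne (hinj hv (memS _ _) ?_)
        rw [hφv]
        refine Prod.ext ?_ ?_
        · simpa using h1.2
        · rw [h1.1]; simp only; omega
    induction d with
    | zero =>
      intro hd
      exact main 0 hd ⟨_, memI u hu, by simp, (base u hu).1⟩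
    | succ d ih =>
      intro hd
      refine main (d + 1) hd ⟨_, memS (y u d) (u.2 - (d + 1)), ?_, (ih (by omega)).1⟩
      intro hh
      have := congrArg Prod.snd hh
      simp only at this
      omega
  have uniq : ∀ u ∈ I, ∀ v ∈ I, ∀ d e, d ≤ u.2 → e ≤ v.2 → u.2 - d = v.2 - e →
      y u d = y v e → u = v := by
    intro u hu v hv d
    induction d with
    | zero =>
      intro e hd he hde hy
      rcases e with _ | e
      · have : φ (.inr u.1, u.2) = φ (.inr v.1, v.2) := by
          rw [(base u hu).1, (base v hv).1, hy]
          simp only [Nat.sub_zero] at hde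
          rw [hde]
        have := hinj (memI u hu) (memI v hv) this
        simpa [Prod.ext_iff] using this
      · have : φ (.inr u.1, u.2) = φ (.inl (y v e), v.2 - (e + 1)) := by
          rw [(base u hu).1, (stp v hv e he).1, hy, ← hde, Nat.sub_zero]
        have := hinj (memI u hu) (memS _ _) this
        simp at this
    | succ d ih =>
      intro e hd he hde hy
      rcases e with _ | e
      · have : φ (.inl (y u d), u.2 - (d + 1)) = φ (.inr v.1, v.2) := by
          rw [(base v hv).1, (stp u hu d hd).1, hy, hde, Nat.sub_zero]
        have := hinj (memS _ _) (memI v hv) this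
        simp at this
      · have : φ (.inl (y u d), u.2 - (d + 1)) = φ (.inl (y v e), v.2 - (e + 1)) := by
          rw [(stp u hu d hd).1, (stp v hv e he).1, hy, hde]
        have := hinj (memS _ _) (memS _ _) this
        refine ih e (by omega) (by omega) (by omega) ?_
        simpa using (congrArg Prod.fst this)
  refine ⟨fun u s => y u (u.2 - s), ?_, ?_, ?_⟩
  · intro u hu
    simp only [Nat.sub_self]
    exact (base u hu).2
  · intro u hu s hs
    have := (stp u hu (u.2 - (s + 1)) (by omega)).2
    rwa [show u.2 - (s + 1) + 1 = u.2 - s by omega] at this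
  · intro u hu v hv huv s hs hs' h
    exact huv (uniq u hu v hv (u.2 - s) (v.2 - s) (by omega) (by omega) (by omega) h)

/-- A linking yields a matching: the used vertices are matched to their successors, and the unused
states to themselves. -/
theorem IsRouting.linkable {I : Finset (Fin m × ℕ)} {x : Fin m × ℕ → ℕ → Fin n}
    (h : IsRouting A B I x) : Linkable A B I := by
  classical
  let φ : LNode n m → RNode n := fun v =>
    match v with
    | (.inl t, k) =>
      if hu : ∃ u ∈ I, k + 1 ≤ u.2 ∧ x u (k + 1) = t then (x hu.choose k, k) else (t, k + 1)
    | (.inr j, k) => (x (j, k) k, k)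
  have φl : ∀ t k, (∃ u ∈ I, k + 1 ≤ u.2 ∧ x u (k + 1) = t ∧ φ (.inl t, k) = (x u k, k)) ∨
      ((¬ ∃ u ∈ I, k + 1 ≤ u.2 ∧ x u (k + 1) = t) ∧ φ (.inl t, k) = (t, k + 1)) := by
    intro t k
    by_cases hu : ∃ u ∈ I, k + 1 ≤ u.2 ∧ x u (k + 1) = t
    · left
      exact ⟨hu.choose, hu.choose_spec.1, hu.choose_spec.2.1, hu.choose_spec.2.2, by
        simp only [φ, hu, dif_pos]⟩
    · right
      exact ⟨hu, by simp only [φ, hu, dif_neg, not_false_eq_true]⟩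
  have same : ∀ u ∈ I, ∀ v ∈ I, ∀ s ≤ u.2, s ≤ v.2 → x u s = x v s → u = v := by
    intro u hu v hv s h1 h2 h3
    by_contra hne
    exact h.disj u hu v hv hne s h1 h2 h3
  refine ⟨φ, ?_, ?_⟩
  · have hll : ∀ t k t' k', φ (.inl t, k) = φ (.inl t', k') → (t, k) = (t', k') := by
      intro t k t' k' hh
      rcases φl t k with ⟨u, hu, hk, hx, e⟩ | ⟨hno, e⟩ <;>
      rcases φl t' k' with ⟨u', hu', hk', hx', e'⟩ | ⟨hno', e'⟩ <;>
      rw [e, e', Prod.mk.injEq] at hh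
      · obtain ⟨h1, rfl⟩ := hh
        obtain rfl := same u hu u' hu' k (by omega) (by omega) h1
        rw [← hx, ← hx']
      · obtain ⟨h1, rfl⟩ := hh
        exact absurd ⟨u, hu, by omega, h1⟩ hno'
      · obtain ⟨h1, rfl⟩ := hh
        exact absurd ⟨u', hu', by omega, h1.symm⟩ hno
      · obtain ⟨rfl, h2⟩ := hh
        simp only [Prod.mk.injEq, true_and]; omega
    have hlr : ∀ t k u, u ∈ I → φ (.inl t, k) = φ (.inr u.1, u.2) → False := by
      intro t k v hv hh
      have e' : φ (.inr v.1, v.2) = (x v v.2, v.2) := rfl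
      rcases φl t k with ⟨u, hu, hk, hx, e⟩ | ⟨hno, e⟩ <;>
      rw [e, e', Prod.mk.injEq] at hh
      · obtain ⟨h1, rfl⟩ := hh
        obtain rfl := same u hu v hv _ (by omega) le_rfl h1
        omega
      · exact hno ⟨v, hv, by omega, by rw [hh.2]; exact hh.1.symm⟩
    rintro ⟨t | j, k⟩ hv ⟨t' | j', k'⟩ hv' hh
    · have := hll t k t' k' hh
      simpa using this
    · rcases hv' with ⟨_, _, hv'⟩ | hv'
      · simp at hv'
      · obtain ⟨u, hu, hu'⟩ := Finset.mem_image.1 (Finset.mem_coe.1 hv')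
        rw [← hu'] at hh
        exact (hlr t k u hu hh).elim
    · rcases hv with ⟨_, _, hv⟩ | hv
      · simp at hv
      · obtain ⟨u, hu, hu'⟩ := Finset.mem_image.1 (Finset.mem_coe.1 hv)
        rw [← hu'] at hh
        exact (hlr t' k' u hu hh.symm).elim
    · rcases hv with ⟨_, _, hv⟩ | hv
      · simp at hv
      rcases hv' with ⟨_, _, hv'⟩ | hv'
      · simp at hv'
      obtain ⟨u, hu, hu'⟩ := Finset.mem_image.1 (Finset.mem_coe.1 hv)
      obtain ⟨v, hv, hv'⟩ := Finset.mem_image.1 (Finset.mem_coe.1 hv')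
      rw [← hu', ← hv'] at hh ⊢
      have hh' : (x u u.2, u.2) = (x v v.2, v.2) := hh
      rw [Prod.mk.injEq] at hh'
      rw [same u hu v hv u.2 le_rfl hh'.2.le (by rw [hh'.1, hh'.2])]
  · rintro ⟨t | j, k⟩ hv
    · rw [mem_heads]
      rcases φl t k with ⟨u, hu, hk, hx, e⟩ | ⟨hno, e⟩
      · left
        rw [e]
        refine ⟨rfl, ?_⟩
        rw [← hx]
        exact h.step u hu k (by omega)
      · right
        rw [e]
        exact ⟨rfl, rfl⟩
    · rcases hv with ⟨_, _, hv⟩ | hv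
      · simp at hv
      · obtain ⟨u, hu, hu'⟩ := Finset.mem_image.1 (Finset.mem_coe.1 hv)
        rw [← hu', mem_heads]
        left
        exact ⟨rfl, h.start u hu⟩

/-- A path of the dynamic graph that starts at a state and ends in the first layer visits every
layer in between once. -/
theorem exists_states_of_chain {l : ℕ} (p : List (DynVertex n m l)) :
    ∀ (i : Fin n) (k : Fin l), (Sum.inl (i, k) :: p).IsChain (dynGraph A B l).Adj →
      (∀ v ∈ (Sum.inl (i, k) :: p).getLast?, v ∈ firstLayer n m l) →
      ∃ x : ℕ → Fin n, x k = i ∧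
        (∀ s (hs : s < l), s ≤ k → Sum.inl (x s, ⟨s, hs⟩) ∈ (Sum.inl (i, k) :: p)) ∧
        ∀ s < (k : ℕ), A (x s) (x (s + 1)) = true := by
  induction p with
  | nil =>
    intro i k _ hlast
    obtain ⟨i', k', hk', h⟩ := hlast (Sum.inl (i, k)) (by simp)
    simp only [Sum.inl.injEq, Prod.mk.injEq] at h
    obtain ⟨rfl, rfl⟩ := h
    refine ⟨fun _ => i, rfl, ?_, by omega⟩
    intro s hs hsk
    have : (⟨s, hs⟩ : Fin l) = k := Fin.ext (by simp only; omega)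
    simp [this]
  | cons v p ih =>
    intro i k hchain hlast
    rw [List.isChain_cons_cons] at hchain
    obtain ⟨hadj, hchain⟩ := hchain
    rcases v with ⟨i', k'⟩ | ⟨j', k'⟩
    · obtain ⟨hk, hA⟩ : (k : ℕ) = k' + 1 ∧ A i' i = true := hadj
      obtain ⟨x, hx, hmem, hstep⟩ := ih i' k' hchain (by
        intro v hv
        exact hlast v (by rw [List.getLast?_cons_cons]; exact hv))
      refine ⟨Function.update x k i, by simp, ?_, ?_⟩
      · intro s hs hsk
        rcases eq_or_ne s k with rfl | hne
        · simp
        · rw [Function.update_of_ne hne]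
          exact List.mem_cons_of_mem _ (hmem s hs (by omega))
      · intro s hs
        rw [Function.update_of_ne (by omega)]
        rcases eq_or_ne (s + 1) (k : ℕ) with he | hne
        · rw [he, Function.update_self]
          have : s = k' := by omega
          rw [this, hx]
          exact hA
        · rw [Function.update_of_ne hne]
          exact hstep s (by omega)
    · exact (hadj : False).elim

theorem IsLinking.exists_routing (hn : 0 < n) {l r : ℕ} {p : Fin r → List (DynVertex n m l)}
    (h : IsLinking (dynGraph A B l) (inputVertices n m l) (firstLayer n m l) p) :
    ∃ (I : Finset (Fin m × ℕ)) (x : Fin m × ℕ → ℕ → Fin n),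
      IsRouting A B I x ∧ I.card = r ∧ ∀ u ∈ I, u.2 < l := by
  classical
  have key : ∀ a : Fin r, ∃ (j : Fin m) (k : Fin l) (x : ℕ → Fin n),
      Sum.inr (j, k) ∈ p a ∧ B (x k) j = true ∧
      (∀ s (hs : s < l), s ≤ k → Sum.inl (x s, ⟨s, hs⟩) ∈ p a) ∧
      ∀ s < (k : ℕ), A (x s) (x (s + 1)) = true := by
    intro a
    have hchain := h.chain a
    have hstart := h.start_mem a
    have hend := h.end_mem a
    have hne := h.ne_nil a
    generalize p a = q at *
    rcases q with _ | ⟨v, q⟩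
    · exact absurd rfl hne
    obtain ⟨j, k, rfl⟩ := hstart v (by simp)
    rcases q with _ | ⟨w, q⟩
    · obtain ⟨_, _, _, hh⟩ := hend _ (by simp : Sum.inr (j, k) ∈ [Sum.inr (j, k)].getLast?)
      simp at hh
    rw [List.isChain_cons_cons] at hchain
    obtain ⟨hadj, hchain⟩ := hchain
    rcases w with ⟨i, k'⟩ | ⟨j', k'⟩
    · obtain ⟨rfl, hB⟩ : k = k' ∧ B i j = true := hadj
      obtain ⟨x, hx, hmem, hstep⟩ := exists_states_of_chain q i k hchain (by
        intro v hv
        exact hend v (by rw [List.getLast?_cons_cons]; exact hv))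
      exact ⟨j, k, x, by simp, by rw [hx]; exact hB,
        fun s hs hsk => List.mem_cons_of_mem _ (hmem s hs hsk), hstep⟩
    · exact (hadj : False).elim
  choose j k x h1 h2 h3 h4 using key
  have hdisj : ∀ a b v, v ∈ p a → v ∈ p b → a = b := by
    intro a b v ha hb
    by_contra hab
    exact h.disjoint hab ha hb
  let e : Fin r → Fin m × ℕ := fun a => (j a, (k a : ℕ))
  have he : Function.Injective e := by
    intro a b hab
    simp only [e, Prod.mk.injEq] at hab
    refine hdisj a b _ (h1 a) ?_
    rw [hab.1, Fin.ext hab.2]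
    exact h1 b
  let y : Fin m × ℕ → ℕ → Fin n := fun u s =>
    if hu : ∃ a, e a = u then x hu.choose s else ⟨0, hn⟩
  have hy : ∀ a s, y (e a) s = x a s := by
    intro a s
    have hu : ∃ b, e b = e a := ⟨a, rfl⟩
    simp only [y, hu, dif_pos]
    rw [he hu.choose_spec]
  refine ⟨Finset.univ.image e, y, ⟨?_, ?_, ?_⟩, ?_, ?_⟩
  · intro u hu
    obtain ⟨a, -, rfl⟩ := Finset.mem_image.1 hu
    rw [hy]
    exact h2 a
  · intro u hu s hs
    obtain ⟨a, -, rfl⟩ := Finset.mem_image.1 hu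
    rw [hy, hy]
    exact h4 a s hs
  · intro u hu v hv huv s hs hs' hxy
    obtain ⟨a, -, rfl⟩ := Finset.mem_image.1 hu
    obtain ⟨b, -, rfl⟩ := Finset.mem_image.1 hv
    rw [hy, hy] at hxy
    have hsl : s < l := lt_of_le_of_lt hs (k a).2
    refine huv (congrArg e (hdisj a b _ (h3 a s hsl hs) ?_))
    rw [hxy]
    exact h3 b s hsl hs'
  · rw [Finset.card_image_of_injective _ he, Finset.card_univ, Fintype.card_fin]
  · intro u hu
    obtain ⟨a, -, rfl⟩ := Finset.mem_image.1 hu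
    exact (k a).2

/-- The list of the vertices of the path that enters layer `k` in the state `x k`. -/
def statePath {l : ℕ} (x : ℕ → Fin n) : (k : ℕ) → k < l → List (DynVertex n m l)
  | 0, h => [.inl (x 0, ⟨0, h⟩)]
  | k + 1, h => .inl (x (k + 1), ⟨k + 1, h⟩) :: statePath x k (by omega)

theorem statePath_eq_cons {l : ℕ} (x : ℕ → Fin n) (k : ℕ) (h : k < l) :
    ∃ q, statePath (m := m) x k h = .inl (x k, ⟨k, h⟩) :: q := by
  cases k <;> exact ⟨_, rfl⟩

theorem mem_statePath {l : ℕ} (x : ℕ → Fin n) (k : ℕ) (h : k < l) (v : DynVertex n m l)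
    (hv : v ∈ statePath x k h) : ∃ s, ∃ hs : s < l, s ≤ k ∧ v = .inl (x s, ⟨s, hs⟩) := by
  induction k with
  | zero =>
    simp only [statePath, List.mem_singleton] at hv
    exact ⟨0, h, le_rfl, hv⟩
  | succ k ih =>
    rcases List.mem_cons.1 hv with rfl | hv
    · exact ⟨k + 1, h, le_rfl, rfl⟩
    · obtain ⟨s, hs, hsk, rfl⟩ := ih _ hv
      exact ⟨s, hs, by omega, rfl⟩

theorem statePath_isChain {l : ℕ} (x : ℕ → Fin n) (k : ℕ) (h : k < l)
    (hA : ∀ s < k, A (x s) (x (s + 1)) = true) :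
    (statePath (m := m) x k h).IsChain (dynGraph A B l).Adj := by
  induction k with
  | zero => exact List.isChain_singleton _
  | succ k ih =>
    have ih' := ih (by omega) (fun s hs => hA s (by omega))
    obtain ⟨q, hq⟩ := statePath_eq_cons (m := m) x k (by omega : k < l)
    rw [statePath, hq, List.isChain_cons_cons, ← hq]
    exact ⟨⟨rfl, hA k (by omega)⟩, ih'⟩

theorem statePath_getLast? {l : ℕ} (x : ℕ → Fin n) (k : ℕ) (h : k < l) :
    (statePath (m := m) x k h).getLast? = some (.inl (x 0, ⟨0, by omega⟩)) := by
  induction k with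
  | zero => rfl
  | succ k ih =>
    obtain ⟨q, hq⟩ := statePath_eq_cons (m := m) x k (by omega : k < l)
    rw [statePath, hq, List.getLast?_cons_cons, ← hq]
    exact ih (by omega)

theorem IsRouting.exists_linking {l : ℕ} {I : Finset (Fin m × ℕ)}
    {x : Fin m × ℕ → ℕ → Fin n} (h : IsRouting A B I x) (hl : ∀ u ∈ I, u.2 < l) :
    ∃ p : Fin I.card → List (DynVertex n m l),
      IsLinking (dynGraph A B l) (inputVertices n m l) (firstLayer n m l) p := by
  let e := I.equivFin.symm
  refine ⟨fun a => .inr ((e a).1.1, ⟨(e a).1.2, hl _ (e a).2⟩) ::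
    statePath (x (e a).1) (e a).1.2 (hl _ (e a).2), ?_, ?_, ?_, ?_, ?_⟩
  · intro a
    exact List.cons_ne_nil _ _
  · intro a
    obtain ⟨q, hq⟩ := statePath_eq_cons (m := m) (x (e a).1) (e a).1.2 (hl _ (e a).2)
    rw [hq, List.isChain_cons_cons, ← hq]
    exact ⟨⟨rfl, h.start _ (e a).2⟩, statePath_isChain _ _ _ (h.step _ (e a).2)⟩
  · intro a v hv
    simp only [List.head?_cons, Option.mem_def, Option.some.injEq] at hv
    exact ⟨_, _, hv.symm⟩
  · intro a v hv
    obtain ⟨q, hq⟩ := statePath_eq_cons (m := m) (x (e a).1) (e a).1.2 (hl _ (e a).2)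
    rw [hq, List.getLast?_cons_cons, ← hq, statePath_getLast?] at hv
    simp only [Option.mem_def, Option.some.injEq] at hv
    exact ⟨_, _, rfl, hv.symm⟩
  · intro a b hab
    have hne : (e a).1 ≠ (e b).1 := fun hh => hab (e.injective (Subtype.ext hh))
    rw [List.disjoint_left]
    intro v hva hvb
    rcases List.mem_cons.1 hva with rfl | hva
    · rcases List.mem_cons.1 hvb with hvb | hvb
      · simp only [Sum.inr.injEq, Prod.mk.injEq, Fin.mk.injEq] at hvb
        exact hne (Prod.ext hvb.1 hvb.2)
      · obtain ⟨s, hs, -, hh⟩ := mem_statePath _ _ _ _ hvb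
        simp at hh
    · obtain ⟨s, hs, hsk, rfl⟩ := mem_statePath _ _ _ _ hva
      rcases List.mem_cons.1 hvb with hvb | hvb
      · simp at hvb
      · obtain ⟨s', hs', hsk', hh⟩ := mem_statePath _ _ _ _ hvb
        simp only [Sum.inl.injEq, Prod.mk.injEq, Fin.mk.injEq] at hh
        obtain ⟨h1, rfl⟩ := hh
        exact h.disj _ (e a).2 _ (e b).2 hne s hsk hsk' h1

theorem IsRouting.card_le {I : Finset (Fin m × ℕ)} {x : Fin m × ℕ → ℕ → Fin n}
    (h : IsRouting A B I x) : I.card ≤ n := by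
  have : Set.InjOn (fun u => x u 0) (I : Set (Fin m × ℕ)) := by
    intro u hu v hv huv
    by_contra hne
    exact h.disj u hu v hv hne 0 (Nat.zero_le _) (Nat.zero_le _) huv
  calc I.card ≤ (Finset.univ : Finset (Fin n)).card :=
        Finset.card_le_card_of_injOn _ (fun _ _ => Finset.mem_coe.2 (Finset.mem_univ _)) this
    _ = n := by simp

theorem Linkable.card_le {I : Finset (Fin m × ℕ)} (h : Linkable A B I) : I.card ≤ n := by
  obtain ⟨x, hx⟩ := h.exists_routing
  exact hx.card_le

theorem linkable_empty (hn : 0 < n) : Linkable A B ∅ :=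
  IsRouting.linkable (x := fun _ _ => ⟨0, hn⟩) ⟨by simp, by simp, by simp⟩

theorem linkable_singleton {i : Fin n} {j : Fin m} (h : B i j = true) :
    Linkable A B {(j, 0)} := by
  refine IsRouting.linkable (x := fun _ _ => i) ⟨?_, ?_, ?_⟩
  · simp [h]
  · simp
  · intro u hu v hv huv
    rw [Finset.mem_singleton] at hu hv
    exact absurd (hu.trans hv.symm) huv

theorem isGreatest_maxLinking (hn : 0 < n) (l : ℕ) :
    IsGreatest {r : ℕ | ∃ I : Finset (Fin m × ℕ),
      Linkable A B I ∧ (∀ u ∈ I, u.2 < l) ∧ I.card = r} (maxLinking A B l) := by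
  have heq : {r : ℕ | ∃ p : Fin r → List (DynVertex n m l),
      IsLinking (dynGraph A B l) (inputVertices n m l) (firstLayer n m l) p} =
      {r : ℕ | ∃ I : Finset (Fin m × ℕ), Linkable A B I ∧ (∀ u ∈ I, u.2 < l) ∧ I.card = r} := by
    ext r
    constructor
    · rintro ⟨p, hp⟩
      obtain ⟨I, x, hx, hr, hl⟩ := hp.exists_routing hn
      exact ⟨I, hx.linkable, hl, hr⟩
    · rintro ⟨I, hI, hl, rfl⟩
      obtain ⟨x, hx⟩ := hI.exists_routing
      exact hx.exists_linking hl
  have hb : BddAbove {r : ℕ | ∃ I : Finset (Fin m × ℕ),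
      Linkable A B I ∧ (∀ u ∈ I, u.2 < l) ∧ I.card = r} := by
    refine ⟨n, ?_⟩
    rintro r ⟨I, hI, -, rfl⟩
    exact hI.card_le
  rw [maxLinking, heq]
  exact ⟨Nat.sSup_mem ⟨0, ∅, linkable_empty hn, by simp, by simp⟩ hb,
    fun r hr => le_csSup hb hr⟩

theorem Linkable.card_le_maxLinking {I : Finset (Fin m × ℕ)} (h : Linkable A B I) (hn : 0 < n)
    {l : ℕ} (hl : ∀ u ∈ I, u.2 < l) : I.card ≤ maxLinking A B l :=
  (isGreatest_maxLinking hn l).2 ⟨I, h, hl, rfl⟩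

theorem exists_linkable_card_eq_maxLinking (hn : 0 < n) (l : ℕ) :
    ∃ I : Finset (Fin m × ℕ), Linkable A B I ∧ (∀ u ∈ I, u.2 < l) ∧
      I.card = maxLinking A B l :=
  (isGreatest_maxLinking hn l).1

theorem maxLinking_mono (hn : 0 < n) {k l : ℕ} (hkl : k ≤ l) :
    maxLinking A B k ≤ maxLinking A B l := by
  obtain ⟨I, hI, hl, hc⟩ := exists_linkable_card_eq_maxLinking (A := A) (B := B) hn k
  rw [← hc]
  exact hI.card_le_maxLinking hn (fun u hu => (hl u hu).trans_le hkl)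

variable (A B) in
theorem isLeast_muLow (hn : 1 ≤ n) :
    IsLeast {k : ℕ | k ∈ Set.Icc 1 n ∧ maxLinking A B k = maxLinking A B n} (muLow A B) :=
  ⟨Nat.sInf_mem ⟨n, ⟨hn, le_rfl⟩, rfl⟩, fun _ hk => Nat.sInf_le hk⟩

end Layered


/-! ### The rank of the controllability matrix is at most the size of a linking -/

section RankLinking

theorem exists_finset_linearIndependent_col {ι κ : Type*} [Finite ι] [Fintype κ]
    (M : Matrix ι κ ℝ) :
    ∃ S : Finset κ, S.card = M.rank ∧ LinearIndependent ℝ (fun u : S => M.col u) := by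
  classical
  obtain ⟨τ, a, ha, hspan, hli⟩ := exists_linearIndependent' ℝ M.col
  have : Fintype τ := Fintype.ofInjective a ha
  refine ⟨Finset.univ.image a, ?_, ?_⟩
  · rw [Finset.card_image_of_injective _ ha, Finset.card_univ, Matrix.rank_eq_finrank_span_cols,
      ← hspan, finrank_span_eq_card hli]
  · let e : (Finset.univ.image a : Finset κ) ≃ τ :=
      (Equiv.ofBijective (fun t : τ => (⟨a t, Finset.mem_image_of_mem a (Finset.mem_univ t)⟩ :
        (Finset.univ.image a : Finset κ)))
        ⟨fun x y h => ha (congrArg Subtype.val h), fun ⟨y, hy⟩ => by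
          obtain ⟨t, -, ht⟩ := Finset.mem_image.1 hy
          exact ⟨t, Subtype.ext ht⟩⟩).symm
    rw [← linearIndependent_equiv e.symm]
    exact hli

variable {n m : ℕ} {A : Matrix (Fin n) (Fin n) Bool} {B : Matrix (Fin n) (Fin m) Bool}

/-- Backward substitution in `c k = A c (k + 1) + B d (k + 1)`. -/
theorem eq_sum_pow_mulVec_of_rec {A' : Matrix (Fin n) (Fin n) ℝ} {B' : Matrix (Fin n) (Fin m) ℝ}
    {c : ℕ → Fin n → ℝ} {d : ℕ → Fin m → ℝ} {L : ℕ} (hL : c L = 0)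
    (h : ∀ k < L, c k = A'.mulVec (c (k + 1)) + B'.mulVec (d (k + 1))) (p : ℕ) :
    ∀ k, k + p = L →
      c k = ∑ s ∈ Finset.range p, (A' ^ s * B').mulVec (d (k + 1 + s)) := by
  induction p with
  | zero =>
    intro k hk
    obtain rfl : k = L := by omega
    simpa using hL
  | succ p ih =>
    intro k hk
    rw [h k (by omega), ih (k + 1) (by omega), Finset.sum_range_succ', Matrix.mulVec_sum]
    congr 1
    · refine Finset.sum_congr rfl fun s _ => ?_
      rw [Matrix.mulVec_mulVec, ← Matrix.mul_assoc, ← pow_succ',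
        show k + 1 + 1 + s = k + 1 + (s + 1) by ring]
    · simp

/-- If the columns of the controllability matrix that belong to `I` are linearly independent, then
so are the columns of the sparse matrix of the equations `x (k) = A x (k + 1) + B u (k)` that belong
to `I` and to the states. Linearly independent vectors satisfy Hall's condition for their
supports. -/
theorem linkable_of_linearIndependent (hn : 0 < n) {A' : Matrix (Fin n) (Fin n) ℝ}
    {B' : Matrix (Fin n) (Fin m) ℝ} (hA : IsRealization A A') (hB : IsRealization B B')
    {I : Finset (Fin m × ℕ)}
    (hI : LinearIndependent ℝ (fun u : I => fun i => (A' ^ u.1.2 * B') i u.1.1)) :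
    Linkable A B I := by
  classical
  have : Nonempty (RNode n) := ⟨(⟨0, hn⟩, 0)⟩
  let M : Fin n → Fin n ⊕ Fin m → ℝ := fun i t => Sum.elim (A' i) (B' i) t
  let vec : LNode n m → RNode n → ℝ := fun a w =>
    (if w.2 = a.2 then M w.1 a.1 else 0) - (if w.2 = a.2 + 1 ∧ a.1 = .inl w.1 then 1 else 0)
  have hsupp : ∀ a w, w ∉ heads A B a → vec a w = 0 := by
    intro a w hw
    rw [mem_heads] at hw
    push Not at hw
    have h1 : (if w.2 = a.2 then M w.1 a.1 else 0) = 0 := by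
      split_ifs with h
      · have := hw.1 h
        rw [ne_eq, Bool.not_eq_true] at this
        rcases ha : a.1 with t | j
        · rw [ha] at this
          exact hA _ _ this
        · rw [ha] at this
          exact hB _ _ this
      · rfl
    have h2 : (if w.2 = a.2 + 1 ∧ a.1 = .inl w.1 then (1 : ℝ) else 0) = 0 := by
      rw [if_neg]
      exact fun h => hw.2 h.1 h.2
    simp only [vec, h1, h2, sub_zero]
  refine matchable_of_hall fun Z hZ => ?_
  -- it is enough to show that the vectors of `Z` are linearly independent
  suffices hind : ∀ c : LNode n m → ℝ, (∀ a ∉ Z, c a = 0) →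
      (∀ w, ∑ a ∈ Z, c a * vec a w = 0) → ∀ a, c a = 0 by
    have hli : LinearIndependent ℝ (fun a : Z => fun w : Z.biUnion (heads A B) => vec a w) := by
      rw [Fintype.linearIndependent_iff]
      intro g hg a
      have := hind (fun a => if h : a ∈ Z then g ⟨a, h⟩ else 0)
        (fun a ha => by simp [ha]) (fun w => ?_) a
      · simpa using this
      · by_cases hw : w ∈ Z.biUnion (heads A B)
        · have := congrFun hg ⟨w, hw⟩
          simp only [Finset.sum_apply, Pi.smul_apply, smul_eq_mul, Pi.zero_apply] at this
          rw [← Finset.sum_coe_sort]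
          simpa using this
        · refine Finset.sum_eq_zero fun a ha => ?_
          rw [hsupp a w, mul_zero]
          exact fun h => hw (Finset.mem_biUnion.2 ⟨a, ha, h⟩)
    have := hli.fintype_card_le_finrank
    simpa using this
  intro c hc hsum
  obtain ⟨L, hL⟩ : ∃ L, ∀ a ∈ Z, a.2 < L :=
    ⟨Z.sup (fun a => a.2) + 1, fun a ha => Nat.lt_succ_of_le (Finset.le_sup (f := fun a => a.2) ha)⟩
  have hcL : ∀ t k, L ≤ k → c (t, k) = 0 := fun t k hk => hc _ fun h => by
    have := hL _ h
    simp only at this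
    omega
  have hZL : Z ⊆ Finset.univ ×ˢ Finset.range L := fun a ha =>
    Finset.mem_product.2 ⟨Finset.mem_univ _, Finset.mem_range.2 (hL a ha)⟩
  have ext : ∀ F : LNode n m → ℝ, ∑ a ∈ Z, c a * F a =
      ∑ t, ∑ k ∈ Finset.range L, c (t, k) * F (t, k) := by
    intro F
    rw [← Finset.sum_product (Finset.univ : Finset (Fin n ⊕ Fin m)) (Finset.range L)
      (fun a => c a * F a)]
    exact Finset.sum_subset hZL fun a _ ha => by rw [hc a ha, zero_mul]
  have hcoef : ∀ i k', ∑ a ∈ Z, c a * vec a (i, k') =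
      ∑ t, c (t, k') * M i t - (if 1 ≤ k' then c (.inl i, k' - 1) else 0) := by
    intro i k'
    simp only [vec, mul_sub, Finset.sum_sub_distrib]
    congr 1
    · rw [ext (fun a => if k' = a.2 then M i a.1 else 0)]
      refine Finset.sum_congr rfl fun t _ => ?_
      simp only [mul_ite, mul_zero, Finset.sum_ite_eq, Finset.mem_range]
      split_ifs with h
      · rfl
      · rw [hcL t k' (by omega), zero_mul]
    · rcases k' with _ | k'
      · simp
      · by_cases hmem : ((Sum.inl i, k') : LNode n m) ∈ Z
        · rw [Finset.sum_eq_single_of_mem _ hmem]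
          · simp
          · intro a _ ha
            rw [if_neg, mul_zero]
            rintro ⟨h1, h2⟩
            exact ha (Prod.ext h2 (by simp only at h1 ⊢; omega))
        · rw [Finset.sum_eq_zero]
          · simp [hc _ hmem]
          · intro a haZ
            rw [if_neg, mul_zero]
            rintro ⟨h1, h2⟩
            refine hmem ?_
            have : a = (Sum.inl i, k') := Prod.ext h2 (by simp only at h1 ⊢; omega)
            rwa [← this]
  have hM : ∀ i k, ∑ t, c (t, k) * M i t =
      (A'.mulVec (fun t => c (.inl t, k)) + B'.mulVec (fun j => c (.inr j, k))) i := by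
    intro i k
    simp only [M, Fintype.sum_sum_type, Sum.elim_inl, Sum.elim_inr, Pi.add_apply,
      Matrix.mulVec, dotProduct, mul_comm]
  have hrec : ∀ k, (fun t => c (.inl t, k)) = A'.mulVec (fun t => c (.inl t, k + 1)) +
      B'.mulVec (fun j => c (.inr j, k + 1)) := by
    intro k
    funext i
    have := hsum (i, k + 1)
    rw [hcoef, hM] at this
    simp only [le_add_iff_nonneg_left, zero_le, if_true, Nat.add_sub_cancel] at this
    linarith
  have hzero : A'.mulVec (fun t => c (.inl t, 0)) + B'.mulVec (fun j => c (.inr j, 0)) = 0 := by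
    funext i
    have := hsum (i, 0)
    rw [hcoef, hM] at this
    simpa using this
  have hsol := eq_sum_pow_mulVec_of_rec (A' := A') (B' := B') (c := fun k t => c (.inl t, k))
    (d := fun k j => c (.inr j, k)) (L := L) (by funext t; exact hcL _ _ le_rfl)
    (fun k _ => hrec k)
  have hfull : ∑ s ∈ Finset.range (L + 1), (A' ^ s * B').mulVec (fun j => c (.inr j, s)) = 0 := by
    rw [Finset.sum_range_succ', ← hzero]
    congr 1
    · have h0 := hsol L 0 (by simp)
      rw [h0, Matrix.mulVec_sum]
      refine Finset.sum_congr rfl fun s _ => ?_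
      rw [Matrix.mulVec_mulVec, ← Matrix.mul_assoc, ← pow_succ', show 0 + 1 + s = s + 1 by ring]
    · simp
  have hd : ∀ j s, c (.inr j, s) = 0 := by
    have hnot : ∀ j s, (j, s) ∉ I → c (.inr j, s) = 0 := by
      intro j s hjs
      refine hc _ fun h => ?_
      rcases hZ h with ⟨_, _, hh⟩ | hh
      · simp at hh
      · obtain ⟨u, hu, hu'⟩ := Finset.mem_image.1 (Finset.mem_coe.1 hh)
        simp only [inputTail, Prod.mk.injEq, Sum.inr.injEq] at hu'
        rw [← hu'.1, ← hu'.2] at hjs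
        exact hjs hu
    rw [Fintype.linearIndependent_iff] at hI
    have := hI (fun u => c (.inr u.1.1, u.1.2)) (by
      funext i
      have h1 := congrFun hfull i
      simp only [Finset.sum_apply, Matrix.mulVec, dotProduct, Pi.zero_apply] at h1
      simp only [Finset.sum_apply, Pi.smul_apply, smul_eq_mul, Pi.zero_apply]
      rw [← h1, Finset.sum_coe_sort I (fun u => c (.inr u.1, u.2) * (A' ^ u.2 * B') i u.1),
        Finset.sum_comm, ← Finset.sum_product (Finset.univ : Finset (Fin m)) (Finset.range (L + 1))
        (fun u => (A' ^ u.2 * B') i u.1 * c (.inr u.1, u.2))]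
      have e : ∀ u : Fin m × ℕ, c (.inr u.1, u.2) * (A' ^ u.2 * B') i u.1 =
        (A' ^ u.2 * B') i u.1 * c (.inr u.1, u.2) := fun u => mul_comm _ _
      simp only [e]
      have hz : ∀ u : Fin m × ℕ, u ∉ I ∩ (Finset.univ ×ˢ Finset.range (L + 1)) →
          (A' ^ u.2 * B') i u.1 * c (.inr u.1, u.2) = 0 := by
        intro u hu
        by_cases huI : u ∈ I
        · rw [hcL, mul_zero]
          by_contra hlt
          exact hu (Finset.mem_inter.2 ⟨huI, Finset.mem_product.2 ⟨Finset.mem_univ _,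
            Finset.mem_range.2 (by omega)⟩⟩)
        · rw [hnot _ _ huI, mul_zero]
      rw [← Finset.sum_subset Finset.inter_subset_left (fun u _ hu => hz u hu),
        ← Finset.sum_subset Finset.inter_subset_right (fun u _ hu => hz u hu)])
    intro j s
    by_cases hjs : (j, s) ∈ I
    · exact this ⟨(j, s), hjs⟩
    · exact hnot j s hjs
  rintro ⟨t | j, k⟩
  · by_cases hk : k ≤ L
    · have := congrFun (hsol (L - k) k (by omega)) t
      rw [this]
      simp only [hd]
      simp [Matrix.mulVec, dotProduct]
    · exact hcL _ _ (by omega)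
  · exact hd j k

theorem rank_ctrbMatrix_le_maxLinking (hn : 0 < n) {A' : Matrix (Fin n) (Fin n) ℝ}
    {B' : Matrix (Fin n) (Fin m) ℝ} (hA : IsRealization A A') (hB : IsRealization B B') (k : ℕ) :
    (ctrbMatrix A' B' k).rank ≤ maxLinking A B k := by
  classical
  obtain ⟨S, hS, hli⟩ := exists_finset_linearIndependent_col (ctrbMatrix A' B' k)
  let f : Fin k × Fin m → Fin m × ℕ := fun c => (c.2, c.1)
  have hf : Function.Injective f := by
    rintro ⟨a, b⟩ ⟨c, d⟩ h
    simp only [f, Prod.mk.injEq] at h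
    rw [h.1, Fin.ext h.2]
  have hL : Linkable A B (S.image f) := by
    refine linkable_of_linearIndependent hn hA hB ?_
    let e : S ≃ (S.image f : Finset (Fin m × ℕ)) :=
      Equiv.ofBijective (fun u => ⟨f u.1, Finset.mem_image_of_mem f u.2⟩)
        ⟨fun x y h => Subtype.ext (hf (congrArg Subtype.val h)), fun ⟨y, hy⟩ => by
          obtain ⟨u, hu, rfl⟩ := Finset.mem_image.1 hy
          exact ⟨⟨u, hu⟩, rfl⟩⟩
    rw [← linearIndependent_equiv e]
    exact hli
  rw [← hS, ← Finset.card_image_of_injective S hf]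
  refine hL.card_le_maxLinking hn fun u hu => ?_
  obtain ⟨c, -, rfl⟩ := Finset.mem_image.1 hu
  exact c.1.2

end RankLinking


/-! ### Stabilization of the controllability subspaces and common generic realizations -/

section Generic

variable {n m : ℕ}

/-- The span of the columns of the `k`-step controllability matrix. -/
def ctrbSpan (A : Matrix (Fin n) (Fin n) ℝ) (B : Matrix (Fin n) (Fin m) ℝ) (k : ℕ) :
    Submodule ℝ (Fin n → ℝ) :=
  Submodule.span ℝ {v | ∃ s < k, ∃ j, v = (A ^ s * B).col j}

variable {A : Matrix (Fin n) (Fin n) ℝ} {B : Matrix (Fin n) (Fin m) ℝ}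

theorem rank_ctrbMatrix_eq_finrank (k : ℕ) :
    (ctrbMatrix A B k).rank = Module.finrank ℝ (ctrbSpan A B k) := by
  rw [Matrix.rank_eq_finrank_span_cols, ctrbSpan]
  have : Set.range (ctrbMatrix A B k).col = {v | ∃ s < k, ∃ j, v = (A ^ s * B).col j} := by
    ext v
    constructor
    · rintro ⟨⟨s, j⟩, rfl⟩
      exact ⟨s, s.2, j, rfl⟩
    · rintro ⟨s, hs, j, rfl⟩
      exact ⟨(⟨s, hs⟩, j), rfl⟩
  rw [this]

theorem col_mem_ctrbSpan {s k : ℕ} (h : s < k) (j : Fin m) :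
    (A ^ s * B).col j ∈ ctrbSpan A B k :=
  Submodule.subset_span ⟨s, h, j, rfl⟩

theorem ctrbSpan_mono {k l : ℕ} (h : k ≤ l) : ctrbSpan A B k ≤ ctrbSpan A B l :=
  Submodule.span_mono fun _ ⟨s, hs, j, hv⟩ => ⟨s, hs.trans_le h, j, hv⟩

theorem mulVec_mem_ctrbSpan {k : ℕ} {v : Fin n → ℝ} (hv : v ∈ ctrbSpan A B k) :
    A.mulVec v ∈ ctrbSpan A B (k + 1) := by
  induction hv using Submodule.span_induction with
  | mem v hv =>
    obtain ⟨s, hs, j, rfl⟩ := hv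
    have : A.mulVec ((A ^ s * B).col j) = (A ^ (s + 1) * B).col j := by
      rw [pow_succ', Matrix.mul_assoc]
      rfl
    rw [this]
    exact col_mem_ctrbSpan (by omega) j
  | zero => simp
  | add u v _ _ hu hv => rw [Matrix.mulVec_add]; exact Submodule.add_mem _ hu hv
  | smul a v _ hv => rw [Matrix.mulVec_smul]; exact Submodule.smul_mem _ _ hv

theorem ctrbSpan_stable {k : ℕ} (h : ctrbSpan A B (k + 1) = ctrbSpan A B k) {l : ℕ} (hkl : k ≤ l) :
    ctrbSpan A B l = ctrbSpan A B k := by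
  induction l, hkl using Nat.le_induction with
  | base => rfl
  | succ l hkl ih =>
    refine le_antisymm (Submodule.span_le.2 ?_) (ctrbSpan_mono (by omega))
    rintro v ⟨s, hs, j, rfl⟩
    rcases Nat.lt_or_ge s l with hsl | hsl
    · rw [← ih]
      exact col_mem_ctrbSpan hsl j
    · obtain rfl : s = l := by omega
      rcases s with _ | s
      · rw [← h]
        exact col_mem_ctrbSpan (by omega) j
      · have h1 : (A ^ s * B).col j ∈ ctrbSpan A B k := by
          rw [← ih]
          exact col_mem_ctrbSpan (by omega) j
        have h2 := mulVec_mem_ctrbSpan h1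
        rw [h] at h2
        rw [pow_succ', Matrix.mul_assoc]
        exact h2

theorem ctrbSpan_stable_of_rank {k : ℕ}
    (h : (ctrbMatrix A B (k + 1)).rank ≤ (ctrbMatrix A B k).rank) {l : ℕ} (hkl : k ≤ l) :
    ctrbSpan A B l = ctrbSpan A B k := by
  rw [rank_ctrbMatrix_eq_finrank, rank_ctrbMatrix_eq_finrank] at h
  exact ctrbSpan_stable (Submodule.eq_of_le_of_finrank_le (ctrbSpan_mono (by omega)) h).symm hkl

variable (A B) in
theorem ctrbSpan_eq_of_le {l : ℕ} (hl : n ≤ l) : ctrbSpan A B l = ctrbSpan A B n := by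
  have : ∃ k ≤ n, ctrbSpan A B (k + 1) = ctrbSpan A B k := by
    by_contra! hc
    have key : ∀ k ≤ n + 1, k ≤ Module.finrank ℝ (ctrbSpan A B k) := by
      intro k
      induction k with
      | zero => simp
      | succ k ih =>
        intro hk
        have h1 := ih (by omega)
        have h2 := Submodule.finrank_lt_finrank_of_lt
          (lt_of_le_of_ne (ctrbSpan_mono (A := A) (B := B) (k.le_add_right 1))
            (hc k (by omega)).symm)
        omega
    have h1 := key (n + 1) le_rfl
    have h2 := Submodule.finrank_le (ctrbSpan A B (n + 1))
    simp only [Module.finrank_fintype_fun_eq_card, Fintype.card_fin] at h2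
    omega
  obtain ⟨k, hk, h⟩ := this
  rw [ctrbSpan_stable h (hk.trans hl), ctrbSpan_stable h hk]

section Line

open Polynomial

/-- The Gram determinant of the columns in `S` of the controllability matrix, along the line through
two realizations, is a polynomial in the parameter of the line. -/
theorem exists_gram_polynomial (A₁ A₂ : Matrix (Fin n) (Fin n) ℝ) (B₁ B₂ : Matrix (Fin n) (Fin m) ℝ)
    (k : ℕ) (S : Finset (Fin k × Fin m)) :
    ∃ p : ℝ[X], ∀ t : ℝ, p.eval t =
      (((ctrbMatrix (A₁ + t • (A₂ - A₁)) (B₁ + t • (B₂ - B₁)) k).submatrix id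
          (Subtype.val : S → _)).transpose *
        ((ctrbMatrix (A₁ + t • (A₂ - A₁)) (B₁ + t • (B₂ - B₁)) k).submatrix id
          (Subtype.val : S → _))).det := by
  classical
  let PA : Matrix (Fin n) (Fin n) ℝ[X] := A₁.map C + (X : ℝ[X]) • (A₂ - A₁).map C
  let PB : Matrix (Fin n) (Fin m) ℝ[X] := B₁.map C + (X : ℝ[X]) • (B₂ - B₁).map C
  let PM : Matrix (Fin n) S ℝ[X] := Matrix.of fun i c => (PA ^ (c.1.1 : ℕ) * PB) i c.1.2
  have hA : ∀ t : ℝ, PA.map (evalRingHom t) = A₁ + t • (A₂ - A₁) := by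
    intro t
    ext i j
    simp [PA]
  have hB : ∀ t : ℝ, PB.map (evalRingHom t) = B₁ + t • (B₂ - B₁) := by
    intro t
    ext i j
    simp [PB]
  have hM : ∀ t : ℝ, PM.map (evalRingHom t) =
      (ctrbMatrix (A₁ + t • (A₂ - A₁)) (B₁ + t • (B₂ - B₁)) k).submatrix id Subtype.val := by
    intro t
    ext i c
    have : (PA ^ (c.1.1 : ℕ) * PB).map (evalRingHom t) =
        (A₁ + t • (A₂ - A₁)) ^ (c.1.1 : ℕ) * (B₁ + t • (B₂ - B₁)) := by
      rw [Matrix.map_mul, hB, ← hA]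
      congr 1
      exact map_pow (evalRingHom t).mapMatrix PA _
    exact congrFun (congrFun this i) c.1.2
  refine ⟨(PM.transpose * PM).det, fun t => ?_⟩
  rw [← hM, ← Matrix.transpose_map, ← Matrix.map_mul, ← coe_evalRingHom, RingHom.map_det]
  rfl

theorem gram_det_ne_zero {ι κ : Type*} [Fintype ι] [Fintype κ] [DecidableEq κ]
    {M : Matrix ι κ ℝ} (h : LinearIndependent ℝ M.col) : (M.transpose * M).det ≠ 0 := by
  intro hdet
  obtain ⟨v, hv, hMv⟩ := Matrix.exists_mulVec_eq_zero_iff.2 hdet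
  have h1 : v ∈ LinearMap.ker (M.transpose * M).mulVecLin := hMv
  rw [Matrix.ker_mulVecLin_transpose_mul_self] at h1
  have h2 : M.mulVec v = 0 := h1
  exact hv (Matrix.mulVec_injective_iff.2 h (by rw [h2, Matrix.mulVec_zero]))

theorem card_le_rank_of_gram_det_ne_zero {ι κ : Type*} [Fintype ι] [Fintype κ]
    {M : Matrix ι κ ℝ} {S : Finset κ} [DecidableEq S]
    (h : ((M.submatrix id (Subtype.val : S → κ)).transpose *
      M.submatrix id (Subtype.val : S → κ)).det ≠ 0) : S.card ≤ M.rank := by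
  have h1 := Matrix.rank_of_det_ne_zero h
  rw [Matrix.rank_transpose_mul_self, Fintype.card_coe] at h1
  rw [← h1]
  exact Matrix.rank_submatrix_le _ _ _

/-- The ranks of two controllability matrices attain any two attainable values, or more, at a
common realization: a generic point of the line through the two given realizations. -/
theorem exists_common_realization {Ap : Matrix (Fin n) (Fin n) Bool}
    {Bp : Matrix (Fin n) (Fin m) Bool} {A₁ A₂ : Matrix (Fin n) (Fin n) ℝ}
    {B₁ B₂ : Matrix (Fin n) (Fin m) ℝ} (hA₁ : IsRealization Ap A₁) (hA₂ : IsRealization Ap A₂)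
    (hB₁ : IsRealization Bp B₁) (hB₂ : IsRealization Bp B₂) (k l : ℕ) :
    ∃ A' B', IsRealization Ap A' ∧ IsRealization Bp B' ∧
      (ctrbMatrix A₁ B₁ k).rank ≤ (ctrbMatrix A' B' k).rank ∧
      (ctrbMatrix A₂ B₂ l).rank ≤ (ctrbMatrix A' B' l).rank := by
  classical
  obtain ⟨S, hS, hSi⟩ := exists_finset_linearIndependent_col (ctrbMatrix A₁ B₁ k)
  obtain ⟨T, hT, hTi⟩ := exists_finset_linearIndependent_col (ctrbMatrix A₂ B₂ l)
  obtain ⟨p, hp⟩ := exists_gram_polynomial A₁ A₂ B₁ B₂ k S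
  obtain ⟨q, hq⟩ := exists_gram_polynomial A₁ A₂ B₁ B₂ l T
  have hp0 : p ≠ 0 := by
    rintro rfl
    have := hp 0
    simp only [eval_zero, zero_smul, add_zero] at this
    exact gram_det_ne_zero (M := (ctrbMatrix A₁ B₁ k).submatrix id (Subtype.val : S → _))
      hSi this.symm
  have hq0 : q ≠ 0 := by
    rintro rfl
    have := hq 1
    simp only [eval_zero, one_smul, add_sub_cancel] at this
    exact gram_det_ne_zero (M := (ctrbMatrix A₂ B₂ l).submatrix id (Subtype.val : T → _))
      hTi this.symm
  obtain ⟨t, ht⟩ : ∃ t : ℝ, (p * q).eval t ≠ 0 := by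
    by_contra! hc
    exact mul_ne_zero hp0 hq0 (Polynomial.funext fun t => by rw [hc t, eval_zero])
  rw [eval_mul] at ht
  refine ⟨A₁ + t • (A₂ - A₁), B₁ + t • (B₂ - B₁), ?_, ?_, ?_, ?_⟩
  · intro i j hij
    simp [hA₁ i j hij, hA₂ i j hij]
  · intro i j hij
    simp [hB₁ i j hij, hB₂ i j hij]
  · rw [← hS]
    exact card_le_rank_of_gram_det_ne_zero (by rw [← hp]; exact left_ne_zero_of_mul ht)
  · rw [← hT]
    exact card_le_rank_of_gram_det_ne_zero (by rw [← hq]; exact right_ne_zero_of_mul ht)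

end Line

theorem isGreatest_genericRank (A : Matrix (Fin n) (Fin n) Bool) (B : Matrix (Fin n) (Fin m) Bool)
    (k : ℕ) :
    IsGreatest {r : ℕ | ∃ (A' : Matrix (Fin n) (Fin n) ℝ) (B' : Matrix (Fin n) (Fin m) ℝ),
      IsRealization A A' ∧ IsRealization B B' ∧ (ctrbMatrix A' B' k).rank = r}
      (genericRank A B k) := by
  have hb : BddAbove {r : ℕ | ∃ (A' : Matrix (Fin n) (Fin n) ℝ) (B' : Matrix (Fin n) (Fin m) ℝ),
      IsRealization A A' ∧ IsRealization B B' ∧ (ctrbMatrix A' B' k).rank = r} := by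
    refine ⟨n, ?_⟩
    rintro r ⟨A', B', -, -, rfl⟩
    simpa using (ctrbMatrix A' B' k).rank_le_card_height
  rw [genericRank]
  exact ⟨Nat.sSup_mem ⟨(ctrbMatrix 0 0 k).rank, 0, 0, fun _ _ _ => rfl, fun _ _ _ => rfl, rfl⟩ hb,
    fun r hr => le_csSup hb hr⟩

theorem genericRank_eq_of_le (A : Matrix (Fin n) (Fin n) Bool) (B : Matrix (Fin n) (Fin m) Bool)
    {l : ℕ} (hl : n ≤ l) : genericRank A B l = genericRank A B n := by
  have : ∀ (A' : Matrix (Fin n) (Fin n) ℝ) (B' : Matrix (Fin n) (Fin m) ℝ),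
      (ctrbMatrix A' B' l).rank = (ctrbMatrix A' B' n).rank := fun A' B' => by
    rw [rank_ctrbMatrix_eq_finrank, rank_ctrbMatrix_eq_finrank, ctrbSpan_eq_of_le _ _ hl]
  simp only [genericRank, this]

/-- Once two consecutive generic ranks agree, all the following ones do. -/
theorem genericRank_eq_of_succ_eq {A : Matrix (Fin n) (Fin n) Bool}
    {B : Matrix (Fin n) (Fin m) Bool} {k l : ℕ}
    (h : genericRank A B k = genericRank A B (k + 1)) (hkl : k ≤ l) :
    genericRank A B l ≤ genericRank A B k := by
  obtain ⟨A₁, B₁, hA₁, hB₁, h1⟩ := (isGreatest_genericRank A B k).1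
  obtain ⟨A₂, B₂, hA₂, hB₂, h2⟩ := (isGreatest_genericRank A B l).1
  obtain ⟨A', B', hA', hB', h3, h4⟩ := exists_common_realization hA₁ hA₂ hB₁ hB₂ k l
  have h5 := (isGreatest_genericRank A B (k + 1)).2 ⟨A', B', hA', hB', rfl⟩
  have h6 := ctrbSpan_stable_of_rank (A := A') (B := B') (k := k) (by omega) hkl
  rw [← h2]
  refine h4.trans ?_
  rw [rank_ctrbMatrix_eq_finrank, h6, ← rank_ctrbMatrix_eq_finrank]
  exact (isGreatest_genericRank A B k).2 ⟨A', B', hA', hB', rfl⟩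

theorem scoi_mem (A : Matrix (Fin n) (Fin n) Bool) (B : Matrix (Fin n) (Fin m) Bool)
    (hn : 1 ≤ n) :
    scoi A B ∈ Set.Icc 1 n ∧ genericRank A B (scoi A B) = genericRank A B (scoi A B + 1) := by
  have : ({k : ℕ | k ∈ Set.Icc 1 n ∧ genericRank A B k = genericRank A B (k + 1)}).Nonempty :=
    ⟨n, ⟨hn, le_rfl⟩, (genericRank_eq_of_le A B (Nat.le_succ n)).symm⟩
  exact Nat.sInf_mem this

end Generic


/-! ### From linkings to covers by stems and cycles -/

section StationaryCover

variable {n m : ℕ} (A : Matrix (Fin n) (Fin n) Bool) (B : Matrix (Fin n) (Fin m) Bool)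

/-- The neighbours of a head in the layered graph with the layers `0, …, l - 1`: its predecessors in
the dynamic graph and, for a head outside layer `0`, the vertex itself. -/
def tails (l : ℕ) (w : RNode n) : Finset (LNode n m) :=
  (Finset.univ.filter (fun t => edge A B w.1 t = true ∧ (t.isLeft = true → w.2 + 1 < l))).image
      (fun t => (t, w.2)) ∪
    (if 1 ≤ w.2 then {(.inl w.1, w.2 - 1)} else ∅)

theorem mem_tails {l : ℕ} {v : LNode n m} {w : RNode n} :
    v ∈ tails A B l w ↔
      (v.2 = w.2 ∧ edge A B w.1 v.1 = true ∧ (v.1.isLeft = true → w.2 + 1 < l)) ∨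
        (w.2 = v.2 + 1 ∧ v.1 = .inl w.1) := by
  obtain ⟨i, k⟩ := w
  obtain ⟨t, s⟩ := v
  simp only [tails, Finset.mem_union, Finset.mem_image, Finset.mem_filter, Finset.mem_univ,
    true_and, Prod.mk.injEq]
  refine or_congr ?_ ?_
  · constructor
    · rintro ⟨t, h, rfl, rfl⟩
      exact ⟨rfl, h⟩
    · rintro ⟨rfl, h⟩
      exact ⟨t, h, rfl, rfl⟩
  · split_ifs with hk
    · simp only [Finset.mem_singleton, Prod.mk.injEq]
      constructor
      · rintro ⟨rfl, rfl⟩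
        exact ⟨by omega, rfl⟩
      · rintro ⟨h1, rfl⟩
        exact ⟨rfl, by omega⟩
    · simp only [Finset.notMem_empty, false_iff]
      omega

/-- The set `Y` of states of the first layer is the set of the end points of a linking in the dynamic
graph with `l` layers, stated as the existence of a matching of the heads. -/
def Reached (l : ℕ) (Y : Finset (Fin n)) : Prop :=
  Matchable (tails A B l) ({w | 1 ≤ w.2 ∧ w.2 < l} ∪ (Y.image (fun i => (i, 0)) : Finset (RNode n)))

/-- The states that can be reached from an input. -/
inductive InputReachable : Fin n → Prop
  | base {i : Fin n} {j : Fin m} : B i j = true → InputReachable i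
  | step {i t : Fin n} : InputReachable t → A i t = true → InputReachable i

/-- The set `Y` can be matched backwards, along the edges, into the set `Y'` and the inputs. -/
def StepsBack (c : Fin n → Fin n ⊕ Fin m) (Y Y' : Finset (Fin n)) : Prop :=
  Set.InjOn c Y ∧ ∀ y ∈ Y, edge A B y (c y) = true ∧ ∀ t, c y = .inl t → t ∈ Y'

variable {A B}

theorem mem_heads_zero {Y : Finset (Fin n)} {y : Fin n} (hy : y ∈ Y) {l : ℕ} :
    (y, 0) ∈ ({w | 1 ≤ w.2 ∧ w.2 < l} ∪ (Y.image (fun i => (i, 0)) : Finset (RNode n)) :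
      Set (RNode n)) :=
  Or.inr (Finset.mem_coe.2 (Finset.mem_image_of_mem _ hy))

theorem IsRouting.reached {I : Finset (Fin m × ℕ)} {x : Fin m × ℕ → ℕ → Fin n}
    (h : IsRouting A B I x) {l : ℕ} (hl : ∀ u ∈ I, u.2 < l) :
    Reached A B l (I.image (fun u => x u 0)) := by
  classical
  have same : ∀ u ∈ I, ∀ v ∈ I, ∀ s ≤ u.2, s ≤ v.2 → x u s = x v s → u = v := by
    intro u hu v hv s h1 h2 h3
    by_contra hne
    exact h.disj u hu v hv hne s h1 h2 h3
  let ψ : RNode n → LNode n m := fun w =>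
    if hu : ∃ u ∈ I, w.2 ≤ u.2 ∧ x u w.2 = w.1 then
      (if w.2 = hu.choose.2 then (.inr hu.choose.1, w.2) else (.inl (x hu.choose (w.2 + 1)), w.2))
    else (.inl w.1, w.2 - 1)
  have hψ : ∀ i k, (∃ u ∈ I, k = u.2 ∧ x u k = i ∧ ψ (i, k) = (.inr u.1, k)) ∨
      (∃ u ∈ I, k < u.2 ∧ x u k = i ∧ ψ (i, k) = (.inl (x u (k + 1)), k)) ∨
      ((¬ ∃ u ∈ I, k ≤ u.2 ∧ x u k = i) ∧ ψ (i, k) = (.inl i, k - 1)) := by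
    intro i k
    by_cases hu : ∃ u ∈ I, k ≤ u.2 ∧ x u k = i
    · obtain ⟨h1, h2, h3⟩ := hu.choose_spec
      by_cases hk : k = hu.choose.2
      · left
        exact ⟨hu.choose, h1, hk, h3, by simp only [ψ, hu, dif_pos]; rw [if_pos hk]⟩
      · right; left
        exact ⟨hu.choose, h1, by omega, h3, by simp only [ψ, hu, dif_pos]; rw [if_neg hk]⟩
    · right; right
      exact ⟨hu, by simp only [ψ, hu, dif_neg, not_false_eq_true]⟩
  refine ⟨ψ, ?_, ?_⟩
  · rintro ⟨i, k⟩ hw ⟨i', k'⟩ hw' hh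
    -- heads of layer `0` are end points of paths
    have pos : ∀ i k, (i, k) ∈ ({w | 1 ≤ w.2 ∧ w.2 < l} ∪ ((I.image (fun u => x u 0)).image
        (fun i => (i, 0)) : Finset (RNode n)) : Set (RNode n)) →
        (¬ ∃ u ∈ I, k ≤ u.2 ∧ x u k = i) → 1 ≤ k := by
      intro i k hw hno
      rcases hw with hw | hw
      · exact hw.1
      · obtain ⟨i₀, hi₀, he⟩ := Finset.mem_image.1 (Finset.mem_coe.1 hw)
        obtain ⟨u, hu, rfl⟩ := Finset.mem_image.1 hi₀
        rw [Prod.mk.injEq] at he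
        obtain ⟨h1, rfl⟩ := he
        exact absurd ⟨u, hu, Nat.zero_le _, h1⟩ hno
    rcases hψ i k with ⟨u, hu, hk, hx, e⟩ | ⟨u, hu, hk, hx, e⟩ | ⟨hno, e⟩ <;>
    rcases hψ i' k' with ⟨u', hu', hk', hx', e'⟩ | ⟨u', hu', hk', hx', e'⟩ | ⟨hno', e'⟩ <;>
    rw [e, e', Prod.mk.injEq] at hh <;>
    simp only [reduceCtorEq, false_and, Sum.inr.injEq, Sum.inl.injEq] at hh
    · obtain ⟨h1, rfl⟩ := hh
      have : u = u' := Prod.ext h1 (by omega)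
      rw [← hx, ← hx', this]
    · obtain ⟨h1, rfl⟩ := hh
      have := same u hu u' hu' (k + 1) (by omega) (by omega) h1
      rw [← hx, ← hx', this]
    · have := pos i' k' hw' hno'
      exact absurd ⟨u, hu, by omega, by rw [← hh.1]; congr 1; omega⟩ hno'
    · have := pos i k hw hno
      exact absurd ⟨u', hu', by omega, by rw [hh.1]; congr 1; omega⟩ hno
    · have h1 := pos i k hw hno
      have h2 := pos i' k' hw' hno'
      rw [Prod.mk.injEq]
      exact ⟨hh.1, by omega⟩
  · rintro ⟨i, k⟩ hw
    rw [mem_tails]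
    rcases hψ i k with ⟨u, hu, hk, hx, e⟩ | ⟨u, hu, hk, hx, e⟩ | ⟨hno, e⟩
    · left
      rw [e]
      refine ⟨rfl, ?_, by simp⟩
      have := h.start u hu
      rw [← hk, hx] at this
      exact this
    · left
      rw [e]
      have := h.step u hu k hk
      rw [hx] at this
      exact ⟨rfl, this, fun _ => lt_of_le_of_lt hk (hl u hu)⟩
    · right
      rw [e]
      rcases hw with hw | hw
      · have : 1 ≤ k := hw.1
        exact ⟨by simp only; omega, rfl⟩
      · obtain ⟨i₀, hi₀, he⟩ := Finset.mem_image.1 (Finset.mem_coe.1 hw)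
        obtain ⟨u, hu, rfl⟩ := Finset.mem_image.1 hi₀
        rw [Prod.mk.injEq] at he
        obtain ⟨h1, rfl⟩ := he
        exact absurd ⟨u, hu, Nat.zero_le _, h1⟩ hno

theorem Reached.succ {l : ℕ} {Y : Finset (Fin n)} (h : Reached A B l Y) :
    Reached A B (l + 1) Y := by
  obtain ⟨ψ, h1, h2⟩ := h
  have key : ∀ w ∈ ({w | 1 ≤ w.2 ∧ w.2 < l} ∪ (Y.image (fun i => (i, 0)) : Finset (RNode n)) :
      Set (RNode n)), w.2 ≠ l ∨ l = 0 := by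
    rintro w (hw | hw)
    · left; exact hw.2.ne
    · obtain ⟨i₀, hi₀, he⟩ := Finset.mem_image.1 (Finset.mem_coe.1 hw)
      rw [← he]
      simp only
      omega
  have mem : ∀ w ∈ ({w | 1 ≤ w.2 ∧ w.2 < l + 1} ∪ (Y.image (fun i => (i, 0)) :
      Finset (RNode n)) : Set (RNode n)), ¬ (w.2 = l ∧ 1 ≤ l) →
      w ∈ ({w | 1 ≤ w.2 ∧ w.2 < l} ∪ (Y.image (fun i => (i, 0)) : Finset (RNode n)) :
        Set (RNode n)) := by
    rintro w (hw | hw) hne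
    · left
      obtain ⟨h3, h4⟩ := hw
      exact ⟨h3, by omega⟩
    · exact Or.inr hw
  refine ⟨fun w : RNode n => if w.2 = l ∧ 1 ≤ l then (.inl w.1, l - 1) else ψ w, ?_, ?_⟩
  · have hcross : ∀ w w' : RNode n, (w.2 = l ∧ 1 ≤ l) → w' ∈ ({w | 1 ≤ w.2 ∧ w.2 < l} ∪
        (Y.image (fun i => (i, 0)) : Finset (RNode n)) : Set (RNode n)) →
        ((.inl w.1, l - 1) : LNode n m) = ψ w' → False := by
      intro w w' hw hw' hh
      have h3 := key w' hw'
      rcases (mem_tails A B).1 (h2 w' hw') with ⟨h4, -, h5⟩ | ⟨h4, -⟩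
      · rw [← hh] at h4 h5
        have := h5 rfl
        simp only at h4
        omega
      · rw [← hh] at h4
        simp only at h4
        omega
    intro w hw w' hw' hh
    dsimp only at hh
    by_cases c : w.2 = l ∧ 1 ≤ l <;> by_cases c' : w'.2 = l ∧ 1 ≤ l
    · rw [if_pos c, if_pos c'] at hh
      simp only [Prod.mk.injEq, Sum.inl.injEq, and_true] at hh
      exact Prod.ext hh (by omega)
    · rw [if_pos c, if_neg c'] at hh
      exact (hcross w w' c (mem w' hw' c') hh).elim
    · rw [if_neg c, if_pos c'] at hh
      exact (hcross w' w c' (mem w hw c) hh.symm).elim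
    · rw [if_neg c, if_neg c'] at hh
      exact h1 (mem w hw c) (mem w' hw' c') hh
  · intro w hw
    rw [mem_tails]
    by_cases c : w.2 = l ∧ 1 ≤ l
    · right
      simp only [c, and_self, if_true]
      exact ⟨by omega, trivial⟩
    · simp only [c, if_false]
      rcases (mem_tails A B).1 (h2 w (mem w hw c)) with ⟨h4, h6, h5⟩ | h4
      · exact Or.inl ⟨h4, h6, fun h7 => (h5 h7).trans (Nat.lt_succ_self l)⟩
      · exact Or.inr h4

theorem Reached.mono {l l' : ℕ} (hl : l ≤ l') {Y : Finset (Fin n)} (h : Reached A B l Y) :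
    Reached A B l' Y := by
  induction l', hl using Nat.le_induction with
  | base => exact h
  | succ l' _ ih => exact ih.succ

/-- Removing the first layer from a linking. -/
theorem Reached.exists_stepsBack {l : ℕ} {Y : Finset (Fin n)} (h : Reached A B (l + 1) Y) :
    ∃ c Y', StepsBack A B c Y Y' ∧ Reached A B l Y' := by
  classical
  obtain ⟨ψ, h1, h2⟩ := h
  have h0 : ∀ y ∈ Y, ψ (y, 0) = ((ψ (y, 0)).1, 0) ∧ edge A B y (ψ (y, 0)).1 = true ∧
      ((ψ (y, 0)).1.isLeft = true → 1 ≤ l) := by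
    intro y hy
    rcases (mem_tails A B).1 (h2 _ (mem_heads_zero hy)) with ⟨h3, h4, h5⟩ | ⟨h3, -⟩
    · exact ⟨Prod.ext rfl h3, h4, fun h => by have := h5 h; simp only at this; omega⟩
    · simp at h3
  refine ⟨fun y => (ψ (y, 0)).1,
    Finset.univ.filter (fun t => ∃ y ∈ Y, (ψ (y, 0)).1 = .inl t), ⟨?_, ?_⟩, ?_⟩
  · intro y hy y' hy' hh
    have := h1 (mem_heads_zero hy) (mem_heads_zero hy') (by
      rw [(h0 y hy).1, (h0 y' hy').1]
      exact congrArg (fun z => (z, 0)) hh)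
    simpa using this
  · intro y hy
    exact ⟨(h0 y hy).2.1, fun t ht => Finset.mem_filter.2 ⟨Finset.mem_univ _, y, hy, ht⟩⟩
  · have mem : ∀ w ∈ ({w | 1 ≤ w.2 ∧ w.2 < l} ∪ ((Finset.univ.filter
        (fun t => ∃ y ∈ Y, (ψ (y, 0)).1 = .inl t)).image (fun i => (i, 0)) : Finset (RNode n)) :
        Set (RNode n)), ((w.1, w.2 + 1) : RNode n) ∈ ({w | 1 ≤ w.2 ∧ w.2 < l + 1} ∪
          (Y.image (fun i => (i, 0)) : Finset (RNode n)) : Set (RNode n)) ∧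
        1 ≤ (ψ (w.1, w.2 + 1)).2 ∧
          ((ψ (w.1, w.2 + 1)).1, (ψ (w.1, w.2 + 1)).2 - 1) ∈ tails A B l w := by
      intro w hw
      have hin : ((w.1, w.2 + 1) : RNode n) ∈ ({w | 1 ≤ w.2 ∧ w.2 < l + 1} ∪
          (Y.image (fun i => (i, 0)) : Finset (RNode n)) : Set (RNode n)) := by
        rcases hw with hw | hw
        · left
          obtain ⟨h3, h4⟩ := hw
          exact ⟨by simp only; omega, by simp only; omega⟩
        · left
          obtain ⟨i₀, hi₀, he⟩ := Finset.mem_image.1 (Finset.mem_coe.1 hw)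
          obtain ⟨-, y, hy, hy'⟩ := Finset.mem_filter.1 hi₀
          have := (h0 y hy).2.2 (by rw [hy']; rfl)
          rw [← he]
          exact ⟨by simp only; omega, by simp only; omega⟩
      refine ⟨hin, ?_⟩
      rcases (mem_tails A B).1 (h2 _ hin) with ⟨h3, h4, h5⟩ | ⟨h3, h4⟩
      · simp only at h3 h4 h5
        refine ⟨by omega, ?_⟩
        rw [mem_tails]
        exact Or.inl ⟨by simp only; omega, h4, fun h => by have := h5 h; omega⟩
      · simp only at h3 h4
        -- a state of layer `1` that enters a path is not matched to itself
        have hpos : 1 ≤ w.2 := by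
          by_contra hlt
          rcases hw with hw | hw
          · exact hlt hw.1
          · obtain ⟨i₀, hi₀, he⟩ := Finset.mem_image.1 (Finset.mem_coe.1 hw)
            obtain ⟨-, y, hy, hy'⟩ := Finset.mem_filter.1 hi₀
            have : ψ (y, 0) = ψ (w.1, w.2 + 1) := by
              rw [(h0 y hy).1, hy']
              refine Prod.ext ?_ ?_
              · rw [h4, ← he]
              · simp only; omega
            have := congrArg Prod.snd (h1 (mem_heads_zero hy) hin this)
            simp at this
        refine ⟨by omega, ?_⟩
        rw [mem_tails]
        exact Or.inr ⟨by simp only; omega, h4⟩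
    refine ⟨fun w => ((ψ (w.1, w.2 + 1)).1, (ψ (w.1, w.2 + 1)).2 - 1), ?_,
      fun w hw => (mem w hw).2.2⟩
    intro w hw w' hw' hh
    obtain ⟨h3, h4, -⟩ := mem w hw
    obtain ⟨h3', h4', -⟩ := mem w' hw'
    simp only [Prod.mk.injEq] at hh
    have := h1 h3 h3' (Prod.ext hh.1 (by omega))
    simp only [Prod.mk.injEq, Nat.add_right_cancel_iff] at this
    exact Prod.ext this.1 this.2

theorem Reached.inputReachable {l : ℕ} : ∀ {Y : Finset (Fin n)}, Reached A B l Y →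
    ∀ y ∈ Y, InputReachable A B y := by
  induction l with
  | zero =>
    rintro Y ⟨ψ, -, h2⟩ y hy
    rcases (mem_tails A B).1 (h2 _ (mem_heads_zero hy)) with ⟨h3, h4, h5⟩ | ⟨h3, -⟩
    · rcases hv : (ψ (y, 0)).1 with t | j
      · rw [hv] at h5
        simp at h5
      · rw [hv] at h4
        exact .base h4
    · simp at h3
  | succ l ih =>
    intro Y hY y hy
    obtain ⟨c, Y', hc, hY'⟩ := hY.exists_stepsBack
    obtain ⟨h3, h4⟩ := hc.2 y hy
    rcases hv : c y with t | j
    · rw [hv] at h3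
      exact .step (ih hY' t (h4 t hv)) h3
    · rw [hv] at h3
      exact .base h3

/-- The exchange property: a reached set extends to one as large as any other reached set. -/
theorem Reached.extend {l : ℕ} (hn : 0 < n) {Y Z : Finset (Fin n)} (hY : Reached A B l Y)
    (hZ : Reached A B l Z) (hle : Y.card ≤ Z.card) :
    ∃ Y', Y ⊆ Y' ∧ Reached A B l Y' ∧ Y'.card = Z.card := by
  classical
  obtain ⟨d, hd⟩ : ∃ d, Y.card + d = Z.card := ⟨Z.card - Y.card, by omega⟩
  induction d generalizing Y with
  | zero => exact ⟨Y, subset_rfl, hY, hd⟩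
  | succ d ih =>
    have : Nonempty (LNode n m) := ⟨(.inl ⟨0, hn⟩, 0)⟩
    have inj : Function.Injective (fun i : Fin n => ((i, 0) : RNode n)) := fun i j h => by
      simpa using h
    have dis : ∀ W : Finset (Fin n), ∀ a ∈ W.image (fun i => ((i, 0) : RNode n)),
        a ∉ {w : RNode n | 1 ≤ w.2 ∧ w.2 < l} := by
      intro W a ha h
      obtain ⟨i, -, rfl⟩ := Finset.mem_image.1 ha
      exact absurd h.1 (by simp)
    obtain ⟨f, hf, hfY, hM⟩ := Matchable.augment hY hZ (dis Y) (dis Z) (by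
      rw [Finset.card_image_of_injective _ inj, Finset.card_image_of_injective _ inj]
      omega)
    obtain ⟨i, hi, rfl⟩ := Finset.mem_image.1 hf
    have hiY : i ∉ Y := fun h => hfY (Finset.mem_image_of_mem _ h)
    have hcard := Finset.card_insert_of_notMem hiY
    have hR : Reached A B l (insert i Y) := by
      rw [Reached, Finset.image_insert]
      exact hM
    obtain ⟨Y', h1, h2, h3⟩ := ih hR (by omega) (by omega)
    exact ⟨Y', (Finset.subset_insert i Y).trans h1, h2, h3⟩

/-- Arbitrarily long backward sequences of reached sets that all have the maximum size. -/
theorem exists_stepsBack_sequence (hn : 0 < n) {l₀ D : ℕ} {Y₀ : Finset (Fin n)}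
    (h₀ : Reached A B l₀ Y₀) (hD : Y₀.card = D)
    (hmax : ∀ l Y, Reached A B l Y → Y.card ≤ D) (T : ℕ) :
    ∀ Y, Reached A B (l₀ + T) Y → Y.card = D →
      ∃ (X : ℕ → Finset (Fin n)) (c : ℕ → Fin n → Fin n ⊕ Fin m), X 0 = Y ∧
        (∀ s ≤ T, (X s).card = D ∧ ∀ x ∈ X s, InputReachable A B x) ∧
        ∀ s < T, StepsBack A B (c s) (X s) (X (s + 1)) := by
  induction T with
  | zero =>
    intro Y hY hYD
    exact ⟨fun _ => Y, fun _ i => .inl i, rfl, fun s _ => ⟨hYD, hY.inputReachable⟩,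
      fun s hs => by omega⟩
  | succ T ih =>
    intro Y hY hYD
    obtain ⟨c, Y', hc, hY'⟩ := Reached.exists_stepsBack (l := l₀ + T) hY
    obtain ⟨Y'', hsub, hY'', hcard⟩ := hY'.extend hn (h₀.mono (Nat.le_add_right l₀ T))
      (by rw [hD]; exact hmax _ _ hY')
    obtain ⟨X, c', hX0, hX, hstep⟩ := ih Y'' hY'' (by rw [hcard, hD])
    refine ⟨fun s => Nat.casesOn s Y X, fun s => Nat.casesOn s c c', rfl, ?_, ?_⟩
    · rintro (_ | s) hs
      · exact ⟨hYD, hY.inputReachable⟩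
      · exact hX s (by omega)
    · rintro (_ | s) hs
      · refine ⟨hc.1, fun y hy => ⟨(hc.2 y hy).1, fun t ht => ?_⟩⟩
        change t ∈ X 0
        rw [hX0]
        exact hsub ((hc.2 y hy).2 t ht)
      · exact hstep s (by omega)

end StationaryCover


section StationaryCover

variable {n m : ℕ} {A : Matrix (Fin n) (Fin n) Bool} {B : Matrix (Fin n) (Fin m) Bool}

variable (A B) in
/-- The permutation `σ` sends the states of `X` to predecessors that are inputs or lie in `X`, so that
it covers `X` by disjoint stems, which start at inputs, and cycles; all of `X` is input-reachable. -/
def IsCover (σ : Equiv.Perm (Fin n ⊕ Fin m)) (X : Finset (Fin n)) : Prop :=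
  ∀ x ∈ X, InputReachable A B x ∧ edge A B x (σ (.inl x)) = true ∧
    ∀ t, σ (.inl x) = .inl t → t ∈ X

/-- Averaging a periodic backward sequence over its period gives a doubly stochastic matrix, in
which the uncovered states carry loops and the rows of the inputs are filled up. One of the
permutation matrices in its Birkhoff decomposition is at least as good as the average. -/
theorem exists_isCover_of_periodic {X : ℕ → Finset (Fin n)} {c : ℕ → Fin n → Fin n ⊕ Fin m}
    {a b D : ℕ} (hab : a < b) (hper : X a = X b)
    (hX : ∀ s, a ≤ s → s < b → (X s).card = D ∧ ∀ x ∈ X s, InputReachable A B x)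
    (hc : ∀ s, a ≤ s → s < b → StepsBack A B (c s) (X s) (X (s + 1))) :
    ∃ σ Y, IsCover A B σ Y ∧ D ≤ Y.card := by
  classical
  set p : ℝ := ((b - a : ℕ) : ℝ) with hp
  have hp0 : 0 < p := by
    rw [hp]
    exact_mod_cast Nat.sub_pos_of_lt hab
  let cnt : Fin n → Fin n ⊕ Fin m → ℝ := fun x t =>
    ∑ s ∈ Finset.Ico a b, if x ∈ X s ∧ c s x = t then 1 else 0
  let r : Fin n → ℝ := fun x => ∑ s ∈ Finset.Ico a b, if x ∈ X s then 1 else 0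
  have hcnt0 : ∀ x t, 0 ≤ cnt x t := fun x t =>
    Finset.sum_nonneg fun s _ => by split_ifs <;> norm_num
  have hrow : ∀ x, ∑ t, cnt x t = r x := by
    intro x
    rw [Finset.sum_comm]
    refine Finset.sum_congr rfl fun s _ => ?_
    by_cases h : x ∈ X s <;> simp [h]
  have hrp : ∀ x, r x ≤ p := by
    intro x
    calc r x ≤ ∑ s ∈ Finset.Ico a b, (1 : ℝ) :=
          Finset.sum_le_sum fun s _ => by split_ifs <;> norm_num
      _ = p := by simp [hp]
  have hcol1 : ∀ s ∈ Finset.Ico a b, ∀ t,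
      ∑ x, (if x ∈ X s ∧ c s x = t then (1 : ℝ) else 0) ≤ 1 := by
    intro s hs t
    rw [Finset.mem_Ico] at hs
    rw [Finset.sum_boole]
    norm_cast
    refine Finset.card_le_one.2 fun x hx y hy => ?_
    simp only [Finset.mem_filter, Finset.mem_univ, true_and] at hx hy
    exact (hc s hs.1 hs.2).1 hx.1 hy.1 (hx.2.trans hy.2.symm)
  have hcol : ∀ t, ∑ x, cnt x t ≤ p := by
    intro t
    rw [Finset.sum_comm]
    calc _ ≤ ∑ s ∈ Finset.Ico a b, (1 : ℝ) := Finset.sum_le_sum fun s hs => hcol1 s hs t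
      _ = p := by simp [hp]
  -- by periodicity, a state is used as a predecessor at most as often as it is covered
  have hcolS : ∀ y, ∑ x, cnt x (.inl y) ≤ r y := by
    intro y
    rw [Finset.sum_comm]
    have h1 : ∑ s ∈ Finset.Ico a b, (if y ∈ X (s + 1) then (1 : ℝ) else 0) = r y := by
      have h2 := Finset.sum_Ico_add' (fun s => if y ∈ X s then (1 : ℝ) else 0) a b 1
      rw [h2]
      have h3 := Finset.sum_eq_sum_Ico_succ_bot hab (fun s => if y ∈ X s then (1 : ℝ) else 0)
      have h4 := Finset.sum_Ico_succ_top (show a + 1 ≤ b by omega)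
        (fun s => if y ∈ X s then (1 : ℝ) else 0)
      simp only [r]
      rw [h3, h4, hper, add_comm]
    rw [← h1]
    refine Finset.sum_le_sum fun s hs => ?_
    split_ifs with h
    · exact hcol1 s hs _
    · refine (Finset.sum_eq_zero fun x _ => ?_).le
      rw [if_neg]
      rintro ⟨hx, hx'⟩
      rw [Finset.mem_Ico] at hs
      exact h (((hc s hs.1 hs.2).2 x hx).2 y hx')
  let top : Fin n → Fin n ⊕ Fin m → ℝ := fun x t =>
    (cnt x t + if t = .inl x then p - r x else 0) / p
  let defect : Fin n ⊕ Fin m → ℝ := fun t => 1 - ∑ x, top x t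
  have htop0 : ∀ x t, 0 ≤ top x t := by
    intro x t
    refine div_nonneg (add_nonneg (hcnt0 x t) ?_) hp0.le
    split_ifs
    · linarith [hrp x]
    · exact le_rfl
  have htop1 : ∀ x, ∑ t, top x t = 1 := by
    intro x
    simp only [top]
    rw [← Finset.sum_div, Finset.sum_add_distrib, hrow]
    simp only [Finset.sum_ite_eq', Finset.mem_univ, if_true, add_sub_cancel]
    exact div_self hp0.ne'
  have hdef0 : ∀ t, 0 ≤ defect t := by
    intro t
    simp only [defect, top, sub_nonneg]
    rw [← Finset.sum_div, div_le_one hp0, Finset.sum_add_distrib]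
    rcases t with y | j
    · have : ∑ x, (if (Sum.inl y : Fin n ⊕ Fin m) = .inl x then p - r x else 0) = p - r y := by
        simp
      rw [this]
      linarith [hcolS y]
    · simpa using hcol (.inr j)
  have hdefsum : ∑ t, defect t = m := by
    simp only [defect, Finset.sum_sub_distrib]
    rw [Finset.sum_comm]
    simp [htop1]
  let M : Matrix (Fin n ⊕ Fin m) (Fin n ⊕ Fin m) ℝ := fun i t =>
    Sum.elim (fun x => top x t) (fun _ => defect t / m) i
  have hM : M ∈ doublyStochastic ℝ (Fin n ⊕ Fin m) := by
    rw [mem_doublyStochastic_iff_sum]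
    refine ⟨?_, ?_, ?_⟩
    · rintro (x | u) t
      · exact htop0 x t
      · exact div_nonneg (hdef0 t) (Nat.cast_nonneg m)
    · rintro (x | u)
      · exact htop1 x
      · have hm : (m : ℝ) ≠ 0 := by
          have := u.pos
          exact_mod_cast this.ne'
        simp only [M, Sum.elim_inr]
        rw [← Finset.sum_div, hdefsum, div_self hm]
    · intro t
      simp only [M, Fintype.sum_sum_type, Sum.elim_inl, Sum.elim_inr, Finset.sum_const,
        Finset.card_univ, Fintype.card_fin, nsmul_eq_mul]
      rcases Nat.eq_zero_or_pos m with hm | hm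
      · have h0 : ∑ t, defect t = 0 := by rw [hdefsum, hm]; simp
        have := (Finset.sum_eq_zero_iff_of_nonneg fun t _ => hdef0 t).1 h0 t (Finset.mem_univ t)
        simp only [defect] at this
        simp only [hm, CharP.cast_eq_zero, zero_mul, add_zero]
        linarith
      · have hm : (m : ℝ) ≠ 0 := by exact_mod_cast hm.ne'
        rw [mul_div_cancel₀ _ hm]
        simp [defect]
  obtain ⟨w, hw0, hw1, hwM⟩ := exists_eq_sum_perm_of_mem_doublyStochastic hM
  have hentry : ∀ i t, M i t = ∑ σ, if σ i = t then w σ else 0 := by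
    intro i t
    rw [← hwM, Matrix.sum_apply]
    refine Finset.sum_congr rfl fun σ _ => ?_
    simp [Equiv.toPEquiv_apply, PEquiv.toMatrix_apply, eq_comm]
  let good : Fin n → Fin n ⊕ Fin m → Prop := fun x t =>
    InputReachable A B x ∧ edge A B x t = true
  let wt : Equiv.Perm (Fin n ⊕ Fin m) → Finset (Fin n) := fun σ =>
    Finset.univ.filter fun x => good x (σ (.inl x))
  have hcntgood : ∀ x t, ¬ good x t → cnt x t = 0 := by
    intro x t hg
    refine Finset.sum_eq_zero fun s hs => ?_
    rw [Finset.mem_Ico] at hs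
    rw [if_neg]
    rintro ⟨hx, rfl⟩
    exact hg ⟨(hX s hs.1 hs.2).2 x hx, ((hc s hs.1 hs.2).2 x hx).1⟩
  have havg : (D : ℝ) ≤ ∑ σ, w σ * (wt σ).card := by
    have h1 : ∑ σ, w σ * (wt σ).card = ∑ x, ∑ t, if good x t then M (.inl x) t else 0 := by
      have : ∀ σ : Equiv.Perm (Fin n ⊕ Fin m), w σ * ((wt σ).card : ℝ) =
          ∑ x, ∑ t, if good x t then (if σ (.inl x) = t then w σ else 0) else 0 := by
        intro σ
        simp only [wt]
        rw [Finset.card_filter, Nat.cast_sum, Finset.mul_sum]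
        refine Finset.sum_congr rfl fun x _ => ?_
        rw [Finset.sum_eq_single (σ (.inl x))]
        · by_cases h : good x (σ (.inl x)) <;> simp [h]
        · intro t _ ht
          simp [ht.symm]
        · simp
      simp only [this]
      rw [Finset.sum_comm]
      refine Finset.sum_congr rfl fun x _ => ?_
      rw [Finset.sum_comm]
      refine Finset.sum_congr rfl fun t _ => ?_
      by_cases h : good x t
      · simp only [h, if_true]
        exact (hentry _ _).symm
      · simp [h]
    have h2 : (D : ℝ) = ∑ x, ∑ t, cnt x t / p := by
      have : ∑ x, r x = D * p := by
        simp only [r]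
        rw [Finset.sum_comm]
        have : ∀ s ∈ Finset.Ico a b, ∑ x, (if x ∈ X s then (1 : ℝ) else 0) = D := by
          intro s hs
          rw [Finset.mem_Ico] at hs
          rw [Finset.sum_boole, ← (hX s hs.1 hs.2).1]
          simp
        rw [Finset.sum_congr rfl this]
        simp [hp, mul_comm]
      simp only [← Finset.sum_div, hrow, this]
      rw [mul_div_cancel_right₀ _ hp0.ne']
    rw [h1, h2]
    refine Finset.sum_le_sum fun x _ => Finset.sum_le_sum fun t _ => ?_
    split_ifs with h
    · refine div_le_div_of_nonneg_right ?_ hp0.le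
      have : 0 ≤ (if t = Sum.inl x then p - r x else 0) := by
        split_ifs
        · linarith [hrp x]
        · exact le_rfl
      linarith
    · rw [hcntgood x t h, zero_div]
  obtain ⟨σ, hσ, hσD⟩ : ∃ σ, 0 < w σ ∧ D ≤ (wt σ).card := by
    by_contra! hno
    have hlt : ∑ σ, w σ * (wt σ).card < ∑ σ, w σ * D := by
      refine Finset.sum_lt_sum (fun σ _ => ?_) ?_
      · rcases (hw0 σ).lt_or_eq with h | h
        · exact mul_le_mul_of_nonneg_left (by exact_mod_cast (hno σ h).le) h.le
        · simp [← h]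
      · obtain ⟨σ, -, h⟩ := Finset.exists_ne_zero_of_sum_ne_zero (hw1.trans_ne one_ne_zero)
        have h' := lt_of_le_of_ne (hw0 σ) h.symm
        exact ⟨σ, Finset.mem_univ _, mul_lt_mul_of_pos_left (by exact_mod_cast hno σ h') h'⟩
    rw [← Finset.sum_mul, hw1, one_mul] at hlt
    linarith
  refine ⟨σ, wt σ, ?_, hσD⟩
  intro x hx
  have hgx := (Finset.mem_filter.1 hx).2
  refine ⟨hgx.1, hgx.2, fun t ht => Finset.mem_filter.2 ⟨Finset.mem_univ _, ?_⟩⟩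
  by_contra hgt
  -- an uncovered state carries a loop of `σ`
  have hpos : 0 < M (.inl t) (σ (.inl t)) := by
    rw [hentry]
    refine lt_of_lt_of_le hσ ?_
    have := Finset.single_le_sum (f := fun τ : Equiv.Perm (Fin n ⊕ Fin m) =>
      if τ (.inl t) = σ (.inl t) then w τ else 0) (fun τ _ => by
        split_ifs
        · exact hw0 τ
        · exact le_rfl) (Finset.mem_univ σ)
    simpa using this
  have hloop : σ (.inl t) = .inl t := by
    by_contra hne
    simp only [M, Sum.elim_inl, top, hcntgood t _ hgt, if_neg hne] at hpos
    simp at hpos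
  have : (Sum.inl x : Fin n ⊕ Fin m) = .inl t := σ.injective (by rw [ht, hloop])
  rw [Sum.inl.injEq] at this
  rw [← this] at hgt
  exact hgt hgx

variable (A B) in
theorem exists_isCover_maxLinking_le (hn : 0 < n) (l : ℕ) :
    ∃ σ X, IsCover A B σ X ∧ maxLinking A B l ≤ X.card := by
  classical
  let sizes : Set ℕ := {d | ∃ l Y, Reached A B l Y ∧ Y.card = d}
  have hbdd : BddAbove sizes := ⟨n, by
    rintro d ⟨l, Y, -, rfl⟩
    simpa using Finset.card_le_univ Y⟩
  have hle : maxLinking A B l ∈ sizes := by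
    obtain ⟨I, hI, hl, hc⟩ := exists_linkable_card_eq_maxLinking (A := A) (B := B) hn l
    obtain ⟨x, hx⟩ := hI.exists_routing
    refine ⟨l, _, hx.reached hl, ?_⟩
    rw [Finset.card_image_of_injOn, hc]
    intro u hu v hv huv
    by_contra hne
    exact hx.disj u hu v hv hne 0 (Nat.zero_le _) (Nat.zero_le _) huv
  obtain ⟨l₀, Y₀, hY₀, hD⟩ := Nat.sSup_mem ⟨_, hle⟩ hbdd
  have hmax : ∀ l Y, Reached A B l Y → Y.card ≤ sSup sizes :=
    fun l Y hY => le_csSup hbdd ⟨l, Y, hY, rfl⟩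
  -- long enough for a repetition
  set T := Fintype.card (Finset (Fin n)) with hT
  obtain ⟨X, c, -, hX, hc⟩ := exists_stepsBack_sequence hn hY₀ hD hmax T Y₀
    (hY₀.mono (Nat.le_add_right _ _)) hD
  obtain ⟨a, b, hab, hper⟩ := Fintype.exists_ne_map_eq_of_card_lt
    (fun s : Fin (T + 1) => X s) (by simp [← hT])
  have main : ∀ a b : Fin (T + 1), a < b → X a = X b →
      ∃ σ Y, IsCover A B σ Y ∧ sSup sizes ≤ Y.card := by
    intro a b hab hper
    refine exists_isCover_of_periodic (X := X) (c := c) (a := a) (b := b) hab hper ?_ ?_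
    · intro s _ hs
      exact hX s (by omega)
    · intro s _ hs
      exact hc s (by omega)
  obtain ⟨σ, Y, hσ, hY⟩ : ∃ σ Y, IsCover A B σ Y ∧ sSup sizes ≤ Y.card := by
    rcases lt_or_gt_of_ne hab with h | h
    · exact main a b h hper
    · exact main b a h hper.symm
  exact ⟨σ, Y, hσ, (le_csSup hbdd hle).trans hY⟩

end StationaryCover


/-! ### A realization with large controllability matrix from a cover by stems and cycles -/

section Realization

variable {n m : ℕ} {A : Matrix (Fin n) (Fin n) Bool} {B : Matrix (Fin n) (Fin m) Bool}

variable (A B) in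
/-- The state is at distance `k + 1` from an input, along some walk. -/
def ReachIn : ℕ → Fin n → Prop
  | 0, x => ∃ j, B x j = true
  | k + 1, x => ∃ t, ReachIn k t ∧ A x t = true

theorem ReachIn.inputReachable {k : ℕ} : ∀ {x : Fin n}, ReachIn A B k x → InputReachable A B x := by
  induction k with
  | zero => rintro x ⟨j, h⟩; exact .base h
  | succ k ih => rintro x ⟨t, ht, h⟩; exact .step (ih ht) h

theorem InputReachable.exists_reachIn {x : Fin n} (h : InputReachable A B x) :
    ∃ k, ReachIn A B k x := by
  induction h with
  | base h => exact ⟨0, _, h⟩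
  | step _ h ih => obtain ⟨k, hk⟩ := ih; exact ⟨k + 1, _, hk, h⟩

variable (A B) in
/-- A cover by stems and cycles, together with an injective ranking of the states and a parent of
each input-reachable state: an input, or an input-reachable state of lower rank. -/
structure RankedCover where
  σ : Equiv.Perm (Fin n ⊕ Fin m)
  states : Finset (Fin n)
  cover : IsCover A B σ states
  key : Fin n → ℕ
  key_injective : Function.Injective key
  parent : Fin n → Fin n ⊕ Fin m
  edge_parent : ∀ x, InputReachable A B x → edge A B x (parent x) = true
  reachable_parent : ∀ x, InputReachable A B x → ∀ t, parent x = .inl t →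
    InputReachable A B t ∧ key t < key x

theorem IsCover.exists_rankedCover {σ : Equiv.Perm (Fin n ⊕ Fin m)} {X : Finset (Fin n)}
    (h : IsCover A B σ X) : ∃ R : RankedCover A B, R.states = X := by
  classical
  -- the rank is the distance from the inputs, with ties broken by the index
  let dist : Fin n → ℕ := fun x => if h : ∃ k, ReachIn A B k x then Nat.find h else 0
  have hpar : ∀ x, ∃ t, InputReachable A B x → edge A B x t = true ∧
      ∀ y, t = .inl y → InputReachable A B y ∧ dist y < dist x := by
    intro x
    by_cases hx : InputReachable A B x
    · have hk := hx.exists_reachIn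
      have hd : dist x = Nat.find hk := dif_pos hk
      have hspec := Nat.find_spec hk
      rcases hm : Nat.find hk with _ | k
      · rw [hm] at hspec
        obtain ⟨j, hj⟩ := hspec
        exact ⟨.inr j, fun _ => ⟨hj, by simp⟩⟩
      · rw [hm] at hspec
        obtain ⟨t, ht, hA⟩ := hspec
        refine ⟨.inl t, fun _ => ⟨hA, ?_⟩⟩
        intro y hy
        rw [Sum.inl.injEq] at hy
        subst hy
        refine ⟨ht.inputReachable, ?_⟩
        have h1 : dist t = Nat.find ⟨k, ht⟩ := dif_pos ⟨k, ht⟩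
        have h2 : Nat.find (⟨k, ht⟩ : ∃ k, ReachIn A B k t) ≤ k := Nat.find_min' _ ht
        omega
    · exact ⟨.inl x, fun h => absurd h hx⟩
  choose par hpar using hpar
  refine ⟨⟨σ, X, h, fun x => dist x * n + x, ?_, par, fun x hx => (hpar x hx).1,
    fun x hx t ht => ⟨((hpar x hx).2 t ht).1, ?_⟩⟩, rfl⟩
  · intro x y hxy
    simp only at hxy
    have h1 : (dist x * n + x) % n = x := by
      rw [Nat.add_comm, Nat.add_mul_mod_self_right, Nat.mod_eq_of_lt x.2]
    have h2 : (dist y * n + y) % n = y := by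
      rw [Nat.add_comm, Nat.add_mul_mod_self_right, Nat.mod_eq_of_lt y.2]
    rw [hxy, h2] at h1
    exact Fin.ext h1.symm
  · have h1 := ((hpar x hx).2 t ht).2
    have h2 : (dist t + 1) * n ≤ dist x * n := Nat.mul_le_mul_right n h1
    have h3 := t.2
    rw [Nat.add_mul, one_mul] at h2
    omega

namespace RankedCover

variable (R : RankedCover A B)

/-- The state lies on a cycle of the cover. -/
def IsCyclic (x : Fin n) : Prop := ∀ k : ℕ, ∃ y, R.σ^[k] (.inl x) = .inl y

/-- The state `c` is the element of lowest rank on a cycle of the cover. -/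
def IsEntry (c : Fin n) : Prop :=
  c ∈ R.states ∧ R.IsCyclic c ∧ ∀ k y, R.σ^[k] (.inl c) = .inl y → R.key c ≤ R.key y

/-- The length of the cycle of the cover through a state. -/
noncomputable def period (c : Fin n) : ℕ :=
  Function.minimalPeriod R.σ (.inl c : Fin n ⊕ Fin m)

/-- The weight of the edge of the cycle that ends in the entry `c`. With this choice the factors
`1 - weight c * X ^ period c` that belong to different entries are coprime. -/
noncomputable def weight (c : Fin n) : ℝ := ((c : ℝ) + 1) ^ R.period c

open Classical in
/-- The realization of `[A B]`: the edges of the cover, and the parent edges of the uncovered states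
and of the entries. All weights are `1`, except for one edge of each cycle. -/
noncomputable def row (x : Fin n) (t : Fin n ⊕ Fin m) : ℝ :=
  if x ∈ R.states then
    (if R.σ (.inl x) = t then (if R.IsEntry x then R.weight x else 1) else 0) +
      (if R.IsEntry x ∧ R.parent x = t then 1 else 0)
  else if InputReachable A B x ∧ R.parent x = t then 1 else 0

/-- The state matrix of the realization. -/
noncomputable def stateMatrix : Matrix (Fin n) (Fin n) ℝ := fun x t => R.row x (.inl t)

/-- The input matrix of the realization. -/
noncomputable def inputMatrix : Matrix (Fin n) (Fin m) ℝ := fun x j => R.row x (.inr j)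

theorem row_eq_zero {x : Fin n} {t : Fin n ⊕ Fin m} (h : edge A B x t = false) :
    R.row x t = 0 := by
  have h1 : x ∈ R.states → R.σ (.inl x) ≠ t := by
    rintro hx rfl
    rw [(R.cover x hx).2.1] at h
    simp at h
  have h2 : InputReachable A B x → R.parent x ≠ t := by
    rintro hx rfl
    rw [R.edge_parent x hx] at h
    simp at h
  unfold row
  split_ifs with h3 h4 h5 h6 h7
  · exact absurd h4 (h1 h3)
  all_goals simp_all
  all_goals exact h2 (R.cover x h3).1

theorem isRealization_stateMatrix : IsRealization A R.stateMatrix := fun _ _ h => R.row_eq_zero h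

theorem isRealization_inputMatrix : IsRealization B R.inputMatrix := fun _ _ h => R.row_eq_zero h

open PowerSeries

/-- The generating functions of the rows of the controllability matrices. -/
noncomputable def gen (x : Fin n) (j : Fin m) : ℝ⟦X⟧ :=
  PowerSeries.mk fun k => (R.stateMatrix ^ k * R.inputMatrix) x j

/-- The contribution of a predecessor to the generating function of a state. -/
noncomputable def genPred (t : Fin n ⊕ Fin m) (j : Fin m) : ℝ⟦X⟧ :=
  Sum.elim (fun y => X * R.gen y j) (fun u => if u = j then 1 else 0) t

theorem gen_eq_sum (x : Fin n) (j : Fin m) :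
    R.gen x j = ∑ t, PowerSeries.C (R.row x t) * R.genPred t j := by
  ext k
  rw [map_sum, Fintype.sum_sum_type]
  simp only [genPred, Sum.elim_inl, Sum.elim_inr, PowerSeries.coeff_C_mul]
  rcases k with _ | k
  · simp [gen, PowerSeries.coeff_mk, inputMatrix]
  · have h : ∀ u : Fin m, PowerSeries.coeff (k + 1) (if u = j then (1 : ℝ⟦X⟧) else 0) = 0 := by
      intro u
      split_ifs <;> simp [PowerSeries.coeff_one]
    simp only [h, mul_zero, Finset.sum_const_zero, add_zero, PowerSeries.coeff_succ_X_mul]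
    simp only [gen, PowerSeries.coeff_mk]
    rw [pow_succ', Matrix.mul_assoc, Matrix.mul_apply]
    rfl

theorem gen_of_not_isEntry {x : Fin n} (hx : x ∈ R.states) (he : ¬ R.IsEntry x) (j : Fin m) :
    R.gen x j = R.genPred (R.σ (.inl x)) j := by
  rw [gen_eq_sum, Finset.sum_eq_single (R.σ (.inl x))]
  · simp [row, hx, he]
  · intro t _ ht
    simp [row, hx, he, ht.symm]
  · simp

theorem gen_of_isEntry {x : Fin n} (he : R.IsEntry x) (j : Fin m) :
    R.gen x j = PowerSeries.C (R.weight x) * R.genPred (R.σ (.inl x)) j +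
      R.genPred (R.parent x) j := by
  rw [gen_eq_sum]
  have : ∀ t, R.row x t = (if R.σ (.inl x) = t then R.weight x else 0) +
      (if R.parent x = t then 1 else 0) := by
    intro t
    simp [row, he.1, he]
  simp only [this, map_add, add_mul, Finset.sum_add_distrib]
  congr 1
  · rw [Finset.sum_eq_single (R.σ (.inl x))]
    · simp
    · intro t _ ht
      simp [ht.symm]
    · simp
  · rw [Finset.sum_eq_single (R.parent x)]
    · simp
    · intro t _ ht
      simp [ht.symm]
    · simp

theorem gen_of_notMem {x : Fin n} (hx : x ∉ R.states) (hr : InputReachable A B x) (j : Fin m) :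
    R.gen x j = R.genPred (R.parent x) j := by
  rw [gen_eq_sum, Finset.sum_eq_single (R.parent x)]
  · simp [row, hx, hr]
  · intro t _ ht
    simp [row, hx, ht.symm]
  · simp

theorem iterate_mem {x : Fin n} (hx : x ∈ R.states) (k : ℕ) :
    ∀ y, (∀ i ≤ k, ∃ z, R.σ^[i] (.inl x) = .inl z) → R.σ^[k] (.inl x) = .inl y → y ∈ R.states := by
  induction k with
  | zero =>
    intro y _ hy
    simp only [Function.iterate_zero, id_eq, Sum.inl.injEq] at hy
    rwa [← hy]
  | succ k ih =>
    intro y hk hy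
    obtain ⟨z, hz⟩ := hk k (by omega)
    rw [Function.iterate_succ_apply', hz] at hy
    exact (R.cover z (ih z (fun i hi => hk i (by omega)) hz)).2.2 y hy

theorem IsCyclic.iterate {x : Fin n} (hx : R.IsCyclic x) {k : ℕ} {y : Fin n}
    (hy : R.σ^[k] (.inl x) = .inl y) : R.IsCyclic y := by
  intro i
  rw [← hy, ← Function.iterate_add_apply]
  exact hx _

/-- Along a stem, the generating functions are monomials. -/
theorem gen_of_stem (k : ℕ) : ∀ {x : Fin n} {u : Fin m}, x ∈ R.states →
    R.σ^[k + 1] (.inl x) = .inr u → (∀ i ≤ k, ∃ y, R.σ^[i] (.inl x) = .inl y) →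
    ∀ j, R.gen x j = X ^ k * (if u = j then 1 else 0) := by
  induction k with
  | zero =>
    intro x u hx hu _ j
    simp only [zero_add, Function.iterate_one] at hu
    rw [R.gen_of_not_isEntry hx, hu]
    · simp [genPred]
    · intro he
      obtain ⟨y, hy⟩ := he.2.1 1
      simp [hu] at hy
  | succ k ih =>
    intro x u hx hu hk j
    obtain ⟨y, hy⟩ := hk 1 (by omega)
    rw [R.gen_of_not_isEntry hx]
    · simp only [Function.iterate_one] at hy
      rw [hy, genPred, Sum.elim_inl, ih ((R.cover x hx).2.2 y hy), pow_succ', mul_assoc]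
      · rw [← hy, ← Function.iterate_succ_apply]
        exact hu
      · intro i hi
        rw [← hy, ← Function.iterate_succ_apply]
        exact hk _ (by omega)
    · intro he
      obtain ⟨y, hy⟩ := he.2.1 (k + 1 + 1)
      rw [hu] at hy
      simp at hy

theorem exists_stem {x : Fin n} (hc : ¬ R.IsCyclic x) :
    ∃ k u, R.σ^[k + 1] (.inl x) = .inr u ∧ ∀ i ≤ k, ∃ y, R.σ^[i] (.inl x) = .inl y := by
  classical
  unfold IsCyclic at hc
  push Not at hc
  have hspec := Nat.find_spec hc
  have hmin : ∀ i < Nat.find hc, ∃ y, R.σ^[i] (.inl x) = .inl y := by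
    intro i hi
    have := Nat.find_min hc hi
    push Not at this
    exact this
  rcases hk : Nat.find hc with _ | k
  · rw [hk] at hspec
    exact absurd rfl (hspec x)
  · rw [hk] at hspec hmin
    rcases hu : R.σ^[k + 1] (.inl x) with y | u
    · exact absurd hu (hspec y)
    · exact ⟨k, u, hu, fun i hi => hmin i (by omega)⟩

theorem period_pos (x : Fin n) : 0 < R.period x :=
  Function.minimalPeriod_pos_of_mem_periodicPts
    (Function.Injective.mem_periodicPts R.σ.injective _)

theorem iterate_period (x : Fin n) : R.σ^[R.period x] (.inl x) = .inl x :=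
  Function.iterate_minimalPeriod

/-- The entry of the cycle through a state, and the number of steps to it. -/
theorem IsCyclic.exists_entry {x : Fin n} (hx : x ∈ R.states) (hc : R.IsCyclic x) :
    ∃ c i, R.IsEntry c ∧ i < R.period c ∧ R.σ^[i] (.inl x) = .inl c ∧
      (∀ i' < i, R.σ^[i'] (.inl x) ≠ .inl c) ∧ R.key c ≤ R.key x := by
  classical
  have hne : ∃ d k y, R.σ^[k] (.inl x) = .inl y ∧ R.key y = d := ⟨_, 0, x, rfl, rfl⟩
  obtain ⟨k, c, hk, hd⟩ := Nat.find_spec hne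
  have hmin : ∀ k y, R.σ^[k] (.inl x) = .inl y → R.key c ≤ R.key y := by
    intro k y hy
    rw [hd]
    exact Nat.find_min' hne ⟨k, y, hy, rfl⟩
  have hent : R.IsEntry c := by
    refine ⟨R.iterate_mem hx k c (fun i _ => hc i) hk, IsCyclic.iterate R hc hk, ?_⟩
    intro k' y hy
    rw [← hk, ← Function.iterate_add_apply] at hy
    exact hmin _ y hy
  have hex : ∃ i, R.σ^[i] (.inl x) = .inl c := ⟨k, hk⟩
  refine ⟨c, Nat.find hex, hent, ?_, Nat.find_spec hex, fun i' hi' => Nat.find_min hex hi',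
    hmin 0 x rfl⟩
  have hper : Function.IsPeriodicPt R.σ (R.period c) (.inl x : Fin n ⊕ Fin m) := by
    refine (R.σ.injective.iterate k) ?_
    rw [← Function.iterate_add_apply, Nat.add_comm, Function.iterate_add_apply, hk,
      R.iterate_period]
  refine lt_of_le_of_lt (Nat.find_min' hex (m := k % R.period c) ?_)
    (Nat.mod_lt _ (R.period_pos c))
  rw [hper.iterate_mod_apply, hk]

theorem IsEntry.eq_of_iterate {c d : Fin n} (hc : R.IsEntry c) (hd : R.IsEntry d) {k : ℕ}
    (h : R.σ^[k] (.inl c) = .inl d) : c = d := by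
  refine R.key_injective (le_antisymm (hc.2.2 k d h) ?_)
  -- going on along the cycle leads back to `c`
  have hp : R.σ^[k * R.period c] (.inl c) = .inl c := by
    rw [Nat.mul_comm]
    exact (Function.isPeriodicPt_minimalPeriod R.σ (.inl c : Fin n ⊕ Fin m)).mul_const k
  have hle : k ≤ k * R.period c := Nat.le_mul_of_pos_right k (R.period_pos c)
  refine hd.2.2 (k * R.period c - k) c ?_
  rw [← h, ← Function.iterate_add_apply, Nat.sub_add_cancel hle, hp]

theorem gen_of_iterate_entry {c : Fin n} (hc : R.IsEntry c) (i : ℕ) :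
    ∀ {x : Fin n}, x ∈ R.states → R.IsCyclic x → R.σ^[i] (.inl x) = .inl c →
      (∀ i' < i, R.σ^[i'] (.inl x) ≠ .inl c) → ∀ j, R.gen x j = X ^ i * R.gen c j := by
  induction i with
  | zero =>
    intro x _ _ h _ j
    simp only [Function.iterate_zero, id_eq, Sum.inl.injEq] at h
    rw [h, pow_zero, one_mul]
  | succ i ih =>
    intro x hx hcyc h hmin j
    obtain ⟨y, hy⟩ := hcyc 1
    simp only [Function.iterate_one] at hy
    rw [R.gen_of_not_isEntry hx, hy, genPred, Sum.elim_inl,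
      ih ((R.cover x hx).2.2 y hy) (IsCyclic.iterate R hcyc (k := 1) hy), pow_succ', mul_assoc]
    · rw [← hy, ← Function.iterate_succ_apply]
      exact h
    · intro i' hi'
      rw [← hy, ← Function.iterate_succ_apply]
      exact hmin _ (by omega)
    · intro he
      have := he.eq_of_iterate R hc h
      subst this
      exact hmin 0 (by omega) rfl

/-- The denominator contributed by the cycle with entry `c`. -/
noncomputable def denom (c : Fin n) : Polynomial ℝ :=
  1 - Polynomial.C (R.weight c) * Polynomial.X ^ R.period c

/-- Going once around the cycle. -/
theorem denom_mul_gen {c : Fin n} (hc : R.IsEntry c) (j : Fin m) :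
    (R.denom c : ℝ⟦X⟧) * R.gen c j = R.genPred (R.parent c) j := by
  have h := R.gen_of_isEntry hc j
  obtain ⟨y, hy⟩ := hc.2.1 1
  simp only [Function.iterate_one] at hy
  obtain ⟨p, hp⟩ : ∃ p, R.period c = p + 1 := ⟨R.period c - 1, by have := R.period_pos c; omega⟩
  have hgen : R.gen y j = X ^ p * R.gen c j := by
    refine R.gen_of_iterate_entry hc p ((R.cover c hc.1).2.2 y hy)
      (IsCyclic.iterate R hc.2.1 (k := 1) hy) ?_ ?_ j
    · rw [← hy, ← Function.iterate_succ_apply, Nat.succ_eq_add_one, ← hp]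
      exact R.iterate_period c
    · intro i hi h'
      rw [← hy, ← Function.iterate_succ_apply] at h'
      have := Function.IsPeriodicPt.minimalPeriod_le (Nat.succ_pos i) h'
      change R.period c ≤ _ at this
      omega
  rw [hy, genPred, Sum.elim_inl, hgen] at h
  have hd : (R.denom c : ℝ⟦X⟧) = 1 - PowerSeries.C (R.weight c) * X ^ (p + 1) := by
    rw [denom, hp]
    simp
  rw [hd, sub_mul, one_mul]
  nth_rewrite 1 [h]
  ring

theorem exists_gen_of_genPred {t : Fin n ⊕ Fin m} {P : Fin n → Prop}
    (h : ∀ y, t = .inl y → ∃ (e : ℕ) (u : Fin m) (Q : Finset (Fin n)), (∀ c ∈ Q, P c) ∧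
      ∀ j, R.gen y j * ((∏ c ∈ Q, R.denom c : Polynomial ℝ) : ℝ⟦X⟧) =
        X ^ e * (if u = j then 1 else 0)) :
    ∃ (e : ℕ) (u : Fin m) (Q : Finset (Fin n)), (∀ c ∈ Q, P c) ∧
      ∀ j, R.genPred t j * ((∏ c ∈ Q, R.denom c : Polynomial ℝ) : ℝ⟦X⟧) =
        X ^ e * (if u = j then 1 else 0) := by
  rcases t with y | u
  · obtain ⟨e, u, Q, hQ, hj⟩ := h y rfl
    refine ⟨e + 1, u, Q, hQ, fun j => ?_⟩
    rw [genPred, Sum.elim_inl, mul_assoc, hj, pow_succ', mul_assoc]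
  · exact ⟨0, u, ∅, by simp, fun j => by simp [genPred]⟩

/-- The generating functions are monomials divided by the denominators of cycles of lower rank. -/
theorem exists_gen_mul_prod (d : ℕ) : ∀ x, R.key x = d → InputReachable A B x →
    ∃ (e : ℕ) (u : Fin m) (Q : Finset (Fin n)), (∀ c ∈ Q, R.IsEntry c ∧ R.key c ≤ d) ∧
      ∀ j, R.gen x j * ((∏ c ∈ Q, R.denom c : Polynomial ℝ) : ℝ⟦X⟧) =
        X ^ e * (if u = j then 1 else 0) := by
  classical
  induction d using Nat.strong_induction_on with
  | _ d ih =>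
  intro x hxd hr
  have hpar : ∃ (e : ℕ) (u : Fin m) (Q : Finset (Fin n)),
      (∀ c ∈ Q, R.IsEntry c ∧ R.key c < d) ∧
      ∀ j, R.genPred (R.parent x) j * ((∏ c ∈ Q, R.denom c : Polynomial ℝ) : ℝ⟦X⟧) =
        X ^ e * (if u = j then 1 else 0) := by
    refine R.exists_gen_of_genPred (P := fun c => R.IsEntry c ∧ R.key c < d) ?_
    intro y hy
    obtain ⟨h1, h2⟩ := R.reachable_parent x hr y hy
    rw [hxd] at h2
    obtain ⟨e, u, Q, hQ, hj⟩ := ih _ h2 y rfl h1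
    exact ⟨e, u, Q, fun c hc => ⟨(hQ c hc).1, (hQ c hc).2.trans_lt h2⟩, hj⟩
  by_cases hx : x ∈ R.states
  · by_cases hc : R.IsCyclic x
    · by_cases he : R.IsEntry x
      · obtain ⟨e, u, Q, hQ, hj⟩ := hpar
        have hxQ : x ∉ Q := fun h => by have := (hQ x h).2; omega
        refine ⟨e, u, insert x Q, ?_, fun j => ?_⟩
        · intro c hc'
          rcases Finset.mem_insert.1 hc' with rfl | hc'
          · exact ⟨he, hxd.le⟩
          · exact ⟨(hQ c hc').1, (hQ c hc').2.le⟩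
        · rw [Finset.prod_insert hxQ, Polynomial.coe_mul, ← mul_assoc, mul_comm (R.gen x j),
            R.denom_mul_gen he, hj]
      · obtain ⟨c, i, hent, -, hi, hmin, hle⟩ := IsCyclic.exists_entry R hx hc
        have hne : c ≠ x := fun h => he (h ▸ hent)
        have hlt : R.key c < d := by
          rw [← hxd]
          exact lt_of_le_of_ne hle fun h => hne (R.key_injective h)
        obtain ⟨e, u, Q, hQ, hj⟩ := ih _ hlt c rfl (R.cover c hent.1).1
        refine ⟨i + e, u, Q, fun c' hc' => ⟨(hQ c' hc').1, (hQ c' hc').2.trans hlt.le⟩,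
          fun j => ?_⟩
        rw [R.gen_of_iterate_entry hent i hx hc hi hmin, mul_assoc, hj, pow_add, mul_assoc]
    · obtain ⟨k, u, hu, hk⟩ := R.exists_stem hc
      exact ⟨k, u, ∅, by simp, fun j => by simp [R.gen_of_stem k hx hu hk]⟩
  · obtain ⟨e, u, Q, hQ, hj⟩ := hpar
    exact ⟨e, u, Q, fun c hc => ⟨(hQ c hc).1, (hQ c hc).2.le⟩, fun j => by
      rw [R.gen_of_notMem hx hr, hj]⟩

end RankedCover

end Realization


/-! ### Independence of the generating functions and the lower bound -/

section Realization

variable {n m : ℕ} {A : Matrix (Fin n) (Fin n) Bool} {B : Matrix (Fin n) (Fin m) Bool}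

namespace RankedCover

variable (R : RankedCover A B)

theorem weight_pos (c : Fin n) : 0 < R.weight c := by
  unfold weight
  positivity

theorem natDegree_denom (c : Fin n) : (R.denom c).natDegree = R.period c := by
  have h : (Polynomial.C (R.weight c) * Polynomial.X ^ R.period c).natDegree = R.period c :=
    Polynomial.natDegree_C_mul_X_pow _ _ (R.weight_pos c).ne'
  rw [denom, Polynomial.natDegree_sub_eq_right_of_natDegree_lt, h]
  rw [h, Polynomial.natDegree_one]
  exact R.period_pos c

theorem isCoprime_denom_X (c : Fin n) : IsCoprime (R.denom c) (Polynomial.X : Polynomial ℝ) := by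
  refine ⟨1, Polynomial.C (R.weight c) * Polynomial.X ^ (R.period c - 1), ?_⟩
  rw [denom, mul_assoc, ← pow_succ, Nat.sub_add_cancel (R.period_pos c)]
  ring

theorem isCoprime_one_sub_mul {s t : ℝ} (hst : s ≠ t) (Y : Polynomial ℝ) :
    IsCoprime (1 - Polynomial.C s * Y) (1 - Polynomial.C t * Y) := by
  have h : t - s ≠ 0 := sub_ne_zero.2 hst.symm
  refine ⟨Polynomial.C (t / (t - s)), Polynomial.C (-s / (t - s)), ?_⟩
  have h1 : Polynomial.C (t / (t - s)) * (1 - Polynomial.C s * Y) +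
      Polynomial.C (-s / (t - s)) * (1 - Polynomial.C t * Y) =
      Polynomial.C (t / (t - s) + -s / (t - s)) -
        Polynomial.C (t / (t - s) * s + -s / (t - s) * t) * Y := by
    simp only [map_add, map_mul]
    ring
  have h2 : t / (t - s) + -s / (t - s) = 1 := by field_simp; ring
  have h3 : t / (t - s) * s + -s / (t - s) * t = 0 := by field_simp; ring
  rw [h1, h2, h3]
  simp

theorem isCoprime_denom {c d : Fin n} (hcd : c ≠ d) : IsCoprime (R.denom c) (R.denom d) := by
  -- both divide polynomials in `X ^ (period c * period d)`
  have key : ∀ (a p q : ℕ), (1 - Polynomial.C (((a : ℝ) + 1) ^ p) * Polynomial.X ^ p :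
      Polynomial ℝ) ∣ 1 - Polynomial.C (((a : ℝ) + 1) ^ (p * q)) * Polynomial.X ^ (p * q) := by
    intro a p q
    have := sub_dvd_pow_sub_pow (1 : Polynomial ℝ)
      (Polynomial.C (((a : ℝ) + 1) ^ p) * Polynomial.X ^ p) q
    rwa [one_pow, mul_pow, ← map_pow, ← pow_mul, ← pow_mul] at this
  have hne : R.period c * R.period d ≠ 0 := (Nat.mul_pos (R.period_pos c) (R.period_pos d)).ne'
  have hst : ((c : ℝ) + 1) ^ (R.period c * R.period d) ≠
      ((d : ℝ) + 1) ^ (R.period c * R.period d) := by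
    intro h
    have := (pow_left_inj₀ (by positivity) (by positivity) hne).1 h
    have h2 : (c : ℝ) = d := by linarith
    exact hcd (Fin.ext (by exact_mod_cast h2))
  have h2 := key d (R.period d) (R.period c)
  rw [Nat.mul_comm] at h2
  exact ((isCoprime_one_sub_mul hst (Polynomial.X ^ (R.period c * R.period d))
    ).of_isCoprime_of_dvd_left (key c _ _)).of_isCoprime_of_dvd_right h2

theorem prod_dvd_of_subset {c : Fin n} {Q : Finset (Fin n)} (hQ : c ∉ Q) (e : ℕ) :
    IsCoprime (R.denom c) (Polynomial.X ^ e * ∏ d ∈ Q, R.denom d) := by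
  refine IsCoprime.mul_right (R.isCoprime_denom_X c).pow_right (IsCoprime.prod_right fun d hd => ?_)
  exact R.isCoprime_denom fun h => hQ (h ▸ hd)

open PowerSeries

theorem exists_gen_entry {c : Fin n} (hc : R.IsEntry c) :
    ∃ (e : ℕ) (u : Fin m) (Q : Finset (Fin n)), (∀ d ∈ Q, R.IsEntry d ∧ R.key d < R.key c) ∧
      ∀ j, (R.denom c : ℝ⟦X⟧) * R.gen c j * ((∏ d ∈ Q, R.denom d : Polynomial ℝ) : ℝ⟦X⟧) =
        X ^ e * (if u = j then 1 else 0) := by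
  have hr := (R.cover c hc.1).1
  obtain ⟨e, u, Q, hQ, hj⟩ := R.exists_gen_of_genPred (t := R.parent c)
    (P := fun d => R.IsEntry d ∧ R.key d < R.key c) (fun y hy => by
      obtain ⟨h1, h2⟩ := R.reachable_parent c hr y hy
      obtain ⟨e, u, Q, hQ, hj⟩ := R.exists_gen_mul_prod _ y rfl h1
      exact ⟨e, u, Q, fun d hd => ⟨(hQ d hd).1, (hQ d hd).2.trans_lt h2⟩, hj⟩)
  exact ⟨e, u, Q, hQ, fun j => by rw [R.denom_mul_gen hc, hj]⟩

/-- A product of the denominators of all entries in a larger set clears a denominator. -/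
theorem exists_polynomial_of_subset {f : ℝ⟦X⟧} {p : Polynomial ℝ} {Q P : Finset (Fin n)}
    (hQP : Q ⊆ P) (h : f * ((∏ d ∈ Q, R.denom d : Polynomial ℝ) : ℝ⟦X⟧) = p) :
    f * ((∏ d ∈ P, R.denom d : Polynomial ℝ) : ℝ⟦X⟧) =
      ((p * ∏ d ∈ P \ Q, R.denom d : Polynomial ℝ) : ℝ⟦X⟧) := by
  rw [← Finset.prod_sdiff hQP, Polynomial.coe_mul, Polynomial.coe_mul, ← h]
  ring

theorem coe_X_pow_mul_ite (e : ℕ) (p : Prop) [Decidable p] :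
    (X ^ e * (if p then 1 else 0) : ℝ⟦X⟧) =
      ((Polynomial.X ^ e * (if p then 1 else 0) : Polynomial ℝ) : ℝ⟦X⟧) := by
  split_ifs <;> simp

/-- The coefficients of a linear relation vanish on the cycles: otherwise take the entry `c` of the
cycle of highest rank on which one does not. Only the generating functions of this cycle have the
denominator of `c`, so this denominator divides a nonzero polynomial of smaller degree. -/
theorem eq_zero_of_isCyclic {w : Fin n → ℝ}
    (h : ∀ j, ∑ x ∈ R.states, PowerSeries.C (w x) * R.gen x j = 0) :
    ∀ x ∈ R.states, R.IsCyclic x → w x = 0 := by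
  classical
  by_contra! hno
  obtain ⟨x₀, hx₀, hc₀, hw₀⟩ := hno
  have hent : ∀ x, ∃ c i, x ∈ R.states → R.IsCyclic x → R.IsEntry c ∧ i < R.period c ∧
      R.σ^[i] (.inl x) = .inl c ∧ ∀ j, R.gen x j = X ^ i * R.gen c j := by
    intro x
    by_cases hx : x ∈ R.states ∧ R.IsCyclic x
    · obtain ⟨c, i, h1, h2, h3, h4, -⟩ := IsCyclic.exists_entry R hx.1 hx.2
      exact ⟨c, i, fun _ _ => ⟨h1, h2, h3, R.gen_of_iterate_entry h1 i hx.1 hx.2 h3 h4⟩⟩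
    · exact ⟨x, 0, fun h h' => absurd ⟨h, h'⟩ hx⟩
  choose ent steps hent using hent
  obtain ⟨x₁, hx₁, hmax⟩ := Finset.exists_max_image
    (R.states.filter fun x => R.IsCyclic x ∧ w x ≠ 0) (fun x => R.key (ent x))
    ⟨x₀, Finset.mem_filter.2 ⟨hx₀, hc₀, hw₀⟩⟩
  obtain ⟨hx₁, hc₁, hw₁⟩ := Finset.mem_filter.1 hx₁
  obtain ⟨hE, -, -, -⟩ := hent x₁ hx₁ hc₁
  set c := ent x₁ with hcdef
  set P : Finset (Fin n) := Finset.univ.filter fun d => R.key d < R.key c with hP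
  set Δ : Polynomial ℝ := ∏ d ∈ P, R.denom d with hΔ
  obtain ⟨e, u, Q, hQ, hj⟩ := R.exists_gen_entry hE
  have hQP : Q ⊆ P := fun d hd => Finset.mem_filter.2 ⟨Finset.mem_univ _, (hQ d hd).2⟩
  have hgc : (R.denom c : ℝ⟦X⟧) * R.gen c u * (Δ : ℝ⟦X⟧) =
      ((Polynomial.X ^ e * ∏ d ∈ P \ Q, R.denom d : Polynomial ℝ) : ℝ⟦X⟧) := by
    have := R.exists_polynomial_of_subset hQP ((hj u).trans (coe_X_pow_mul_ite _ _))
    rw [this]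
    simp
  set S : Finset (Fin n) := R.states.filter fun x => R.IsCyclic x ∧ ent x = c with hS
  have hout : ∀ x ∈ R.states \ S, ∃ q : Polynomial ℝ,
      PowerSeries.C (w x) * R.gen x u * (Δ : ℝ⟦X⟧) = q := by
    intro x hx
    obtain ⟨hx, hxS⟩ := Finset.mem_sdiff.1 hx
    by_cases hwx : w x = 0
    · exact ⟨0, by simp [hwx]⟩
    by_cases hcx : R.IsCyclic x
    · obtain ⟨h1, h2, h3, h4⟩ := hent x hx hcx
      have hne : ent x ≠ c := fun h => hxS (Finset.mem_filter.2 ⟨hx, hcx, h⟩)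
      have hlt : R.key (ent x) < R.key c := lt_of_le_of_ne
        (hmax x (Finset.mem_filter.2 ⟨hx, hcx, hwx⟩)) fun h => hne (R.key_injective h)
      obtain ⟨e', u', Q', hQ', hj'⟩ := R.exists_gen_mul_prod _ (ent x) rfl (R.cover _ h1.1).1
      have hQP' : Q' ⊆ P := fun d hd => Finset.mem_filter.2 ⟨Finset.mem_univ _,
        (hQ' d hd).2.trans_lt hlt⟩
      have := R.exists_polynomial_of_subset hQP' ((hj' u).trans (coe_X_pow_mul_ite _ _))
      refine ⟨Polynomial.C (w x) * Polynomial.X ^ steps x * (Polynomial.X ^ e' *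
        (if u' = u then 1 else 0) * ∏ d ∈ P \ Q', R.denom d), ?_⟩
      rw [Polynomial.coe_mul, ← this, h4]
      simp only [Polynomial.coe_mul, Polynomial.coe_C, Polynomial.coe_pow, Polynomial.coe_X]
      ring
    · obtain ⟨k, u', hu, hk⟩ := R.exists_stem hcx
      refine ⟨Polynomial.C (w x) * (Polynomial.X ^ k * (if u' = u then 1 else 0)) * Δ, ?_⟩
      rw [R.gen_of_stem k hx hu hk, coe_X_pow_mul_ite]
      simp only [Polynomial.coe_mul, Polynomial.coe_C]
  choose! q hq using hout
  set f : Polynomial ℝ := ∑ x ∈ S, Polynomial.C (w x) * Polynomial.X ^ steps x with hf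
  have hSsub : S ⊆ R.states := Finset.filter_subset _ _
  have hinS : ∀ x ∈ S, R.IsCyclic x ∧ ent x = c ∧ steps x < R.period c ∧
      R.σ^[steps x] (.inl x) = .inl c ∧ ∀ j, R.gen x j = X ^ steps x * R.gen c j := by
    intro x hx
    obtain ⟨h1, h2, h3⟩ := Finset.mem_filter.1 hx
    obtain ⟨h4, h5, h6, h7⟩ := hent x h1 h2
    rw [h3] at h4 h5 h6
    exact ⟨h2, h3, h5, h6, fun j => by rw [h7, h3]⟩
  have hrel : (f : ℝ⟦X⟧) * (R.gen c u * (Δ : ℝ⟦X⟧)) +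
      ((∑ x ∈ R.states \ S, q x : Polynomial ℝ) : ℝ⟦X⟧) = 0 := by
    have h1 := congrArg (· * (Δ : ℝ⟦X⟧)) (h u)
    simp only [zero_mul, Finset.sum_mul] at h1
    rw [← Finset.sum_sdiff hSsub, Finset.sum_congr rfl hq] at h1
    rw [← h1, add_comm]
    congr 1
    · exact map_sum (Polynomial.coeToPowerSeries.ringHom (R := ℝ)) q _
    · have : (f : ℝ⟦X⟧) = ∑ x ∈ S, PowerSeries.C (w x) * X ^ steps x := by
        have h2 := map_sum (Polynomial.coeToPowerSeries.ringHom (R := ℝ))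
          (fun x => Polynomial.C (w x) * Polynomial.X ^ steps x) S
        simp only [Polynomial.coeToPowerSeries.ringHom_apply, Polynomial.coe_mul,
          Polynomial.coe_C, Polynomial.coe_pow, Polynomial.coe_X] at h2
        exact h2
      rw [this, Finset.sum_mul]
      refine Finset.sum_congr rfl fun x hx => ?_
      rw [(hinS x hx).2.2.2.2]
      ring
  have hpoly : f * (Polynomial.X ^ e * ∏ d ∈ P \ Q, R.denom d) +
      R.denom c * ∑ x ∈ R.states \ S, q x = 0 := by
    apply Polynomial.coe_injective ℝ
    rw [Polynomial.coe_add, Polynomial.coe_mul f, ← hgc, Polynomial.coe_mul (R.denom c),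
      Polynomial.coe_zero]
    have := congrArg ((R.denom c : ℝ⟦X⟧) * ·) hrel
    simp only [mul_zero, mul_add] at this
    rw [← this]
    ring
  have hdvd : R.denom c ∣ f := by
    have hcP : c ∉ P \ Q := fun h => by
      have := (Finset.mem_filter.1 (Finset.mem_sdiff.1 h).1).2
      omega
    refine (R.prod_dvd_of_subset hcP e).dvd_of_dvd_mul_right ?_
    rw [eq_neg_of_add_eq_zero_left hpoly]
    exact (Dvd.intro _ rfl).neg_right
  have hdeg : f.degree < (R.denom c).degree := by
    have hne : R.denom c ≠ 0 := fun h0 => by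
      have := R.natDegree_denom c
      rw [h0, Polynomial.natDegree_zero] at this
      have := R.period_pos c
      omega
    rw [Polynomial.degree_eq_natDegree hne, R.natDegree_denom]
    refine lt_of_le_of_lt (Polynomial.degree_sum_le _ _) ?_
    rw [Finset.sup_lt_iff (WithBot.bot_lt_coe _)]
    intro x hx
    refine lt_of_le_of_lt (Polynomial.degree_C_mul_X_pow_le _ _) ?_
    exact_mod_cast (hinS x hx).2.2.1
  have hf0 : f = 0 := Polynomial.eq_zero_of_dvd_of_degree_lt hdvd hdeg
  have hx₁S : x₁ ∈ S := Finset.mem_filter.2 ⟨hx₁, hc₁, rfl⟩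
  have hcoeff := congrArg (fun p => Polynomial.coeff p (steps x₁)) hf0
  simp only [hf, Polynomial.finsetSum_coeff, Polynomial.coeff_C_mul_X_pow,
    Polynomial.coeff_zero] at hcoeff
  rw [Finset.sum_eq_single x₁] at hcoeff
  · simp only [if_true] at hcoeff
    exact hw₁ hcoeff
  · intro x hx hne
    rw [if_neg]
    intro hsteps
    have h1 := (hinS x hx).2.2.2.1
    rw [← hsteps, ← (hinS x₁ hx₁S).2.2.2.1] at h1
    exact hne (Sum.inl_injective ((R.σ.injective.iterate _) h1))
  · intro h'
    exact absurd hx₁S h'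

/-- The generating functions of the covered states are linearly independent. -/
theorem eq_zero_of_gen_relation {w : Fin n → ℝ}
    (h : ∀ j, ∑ x ∈ R.states, PowerSeries.C (w x) * R.gen x j = 0) :
    ∀ x ∈ R.states, w x = 0 := by
  classical
  have hcyc := R.eq_zero_of_isCyclic h
  intro x₀ hx₀
  by_cases hc₀ : R.IsCyclic x₀
  · exact hcyc x₀ hx₀ hc₀
  obtain ⟨k, u, hu, hk⟩ := R.exists_stem hc₀
  have h1 := congrArg (PowerSeries.coeff k) (h u)
  rw [map_sum, map_zero, Finset.sum_eq_single x₀] at h1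
  · rw [R.gen_of_stem k hx₀ hu hk] at h1
    simpa [PowerSeries.coeff_X_pow] using h1
  · intro x hx hne
    rw [PowerSeries.coeff_C_mul]
    by_cases hc : R.IsCyclic x
    · rw [hcyc x hx hc, zero_mul]
    · obtain ⟨k', u', hu', hk'⟩ := R.exists_stem hc
      rw [R.gen_of_stem k' hx hu' hk']
      by_cases huu : u' = u
      · subst huu
        have hkk : k ≠ k' := by
          rintro rfl
          exact hne (Sum.inl_injective ((R.σ.injective.iterate _) (hu'.trans hu.symm)))
        simp [PowerSeries.coeff_X_pow, hkk]
      · simp [huu]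
  · exact fun h' => absurd hx₀ h'

theorem card_le_rank : R.states.card ≤ (ctrbMatrix R.stateMatrix R.inputMatrix n).rank := by
  classical
  have hli : LinearIndependent ℝ ((ctrbMatrix R.stateMatrix R.inputMatrix n).submatrix
      (Subtype.val : R.states → Fin n) id).row := by
    rw [Fintype.linearIndependent_iff]
    intro g hg x
    let w : Fin n → ℝ := fun y => if hy : y ∈ R.states then g ⟨y, hy⟩ else 0
    have hwg : ∀ y : R.states, w y = g y := fun y => by simp [w]
    -- a relation between the rows of the `n`-step matrix extends to all the steps
    let φ : (Fin n → ℝ) →ₗ[ℝ] ℝ := ∑ y ∈ R.states, w y • LinearMap.proj y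
    have hφ : ∀ v, φ v = ∑ y ∈ R.states, w y * v y := fun v => by
      simp [φ, LinearMap.sum_apply]
    have hker : ctrbSpan R.stateMatrix R.inputMatrix n ≤ LinearMap.ker φ := by
      refine Submodule.span_le.2 ?_
      rintro v ⟨s, hs, j, rfl⟩
      change φ _ = 0
      rw [hφ]
      have := congrFun hg (⟨s, hs⟩, j)
      simp only [Finset.sum_apply, Pi.smul_apply, smul_eq_mul, Pi.zero_apply] at this
      rw [← this, ← Finset.sum_coe_sort R.states]
      refine Finset.sum_congr rfl fun y _ => ?_
      rw [hwg]
      rfl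
    have hall : ∀ (k : ℕ) (j : Fin m), ∑ y ∈ R.states, w y * (R.stateMatrix ^ k * R.inputMatrix) y j = 0 := by
      intro k j
      have h1 : (R.stateMatrix ^ k * R.inputMatrix).col j ∈
          ctrbSpan R.stateMatrix R.inputMatrix (max n (k + 1)) :=
        col_mem_ctrbSpan (by omega) j
      rw [ctrbSpan_eq_of_le _ _ (le_max_left _ _)] at h1
      have h2 : φ _ = 0 := hker h1
      rw [hφ] at h2
      exact h2
    have := R.eq_zero_of_gen_relation (w := w) (fun j => by
      ext k
      rw [map_sum, map_zero, ← hall k j]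
      refine Finset.sum_congr rfl fun y _ => ?_
      rw [PowerSeries.coeff_C_mul, gen, PowerSeries.coeff_mk]) x x.2
    rw [← hwg]
    exact this
  have h1 := hli.rank_matrix
  rw [Fintype.card_coe] at h1
  rw [← h1]
  exact Matrix.rank_submatrix_le _ _ _

end RankedCover

theorem maxLinking_le_genericRank (hn : 0 < n) (l : ℕ) :
    maxLinking A B l ≤ genericRank A B n := by
  obtain ⟨σ, X, hX, hle⟩ := exists_isCover_maxLinking_le A B hn l
  obtain ⟨R, rfl⟩ := hX.exists_rankedCover
  exact hle.trans (R.card_le_rank.trans ((isGreatest_genericRank A B n).2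
    ⟨_, _, R.isRealization_stateMatrix, R.isRealization_inputMatrix, rfl⟩))

theorem genericRank_le_maxLinking (hn : 0 < n) (k : ℕ) :
    genericRank A B k ≤ maxLinking A B k := by
  obtain ⟨A', B', hA, hB, h⟩ := (isGreatest_genericRank A B k).1
  rw [← h]
  exact rank_ctrbMatrix_le_maxLinking hn hA hB k

variable (A B) in
theorem muLow_le_scoi (hn : 1 ≤ n) : muLow A B ≤ scoi A B := by
  obtain ⟨hk, heq⟩ := scoi_mem A B hn
  refine (isLeast_muLow A B hn).2 ⟨hk, le_antisymm (maxLinking_mono hn hk.2) ?_⟩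
  calc maxLinking A B n ≤ genericRank A B n := maxLinking_le_genericRank hn n
    _ ≤ genericRank A B (scoi A B) := genericRank_eq_of_succ_eq heq hk.2
    _ ≤ maxLinking A B (scoi A B) := genericRank_le_maxLinking hn _

end Realization


/-! ### Integral flows of the layered network -/

section Flow

theorem sum_splitVertex {V M : Type*} [Fintype V] [AddCommMonoid M] (g : SplitVertex V → M) :
    ∑ a, g a = g .source + g .sink + ∑ v, g (.inn v) + ∑ v, g (.out v) := by
  let e : (Bool ⊕ (V ⊕ V)) ≃ SplitVertex V :=
    { toFun := Sum.elim (fun b => if b then .source else .sink) (Sum.elim .inn .out)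
      invFun := fun a => match a with
        | .source => .inl true
        | .sink => .inl false
        | .inn v => .inr (.inl v)
        | .out v => .inr (.inr v)
      left_inv := by rintro ((_ | _) | (_ | _)) <;> rfl
      right_inv := by rintro (_ | _ | _ | _) <;> rfl }
  rw [← Equiv.sum_comp e, Fintype.sum_sum_type, Fintype.sum_sum_type, Fintype.sum_bool,
    add_assoc, add_assoc, add_assoc]
  rfl

variable {n m : ℕ} {A : Matrix (Fin n) (Fin n) Bool} {B : Matrix (Fin n) (Fin m) Bool}
  {f : SplitVertex (DynVertex n m n) → SplitVertex (DynVertex n m n) → ℝ}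

theorem flow_sum_inn (hf : (layeredNetwork A B).IsFlow f) (v : DynVertex n m n) :
    f .source (.inn v) + ∑ w, f (.out w) (.inn v) = f (.inn v) (.out v) := by
  have h := hf.conserve (.inn v) (by simp [layeredNetwork]) (by simp [layeredNetwork])
  rw [sum_splitVertex, sum_splitVertex, hf.off_edge .sink (.inn v) (fun h => h),
    hf.off_edge (.inn v) .source (fun h => h), hf.off_edge (.inn v) .sink (fun h => h),
    Finset.sum_eq_zero (fun w _ => hf.off_edge (.inn w) (.inn v) (fun h => h)),
    Finset.sum_eq_zero (fun w _ => hf.off_edge (.inn v) (.inn w) (fun h => h)),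
    Finset.sum_eq_single (f := fun w => f (.inn v) (.out w)) v] at h
  · simpa only [add_zero, zero_add] using h
  · intro w _ hw
    exact hf.off_edge _ _ fun h => hw (h : v = w).symm
  · simp

theorem flow_sum_out (hf : (layeredNetwork A B).IsFlow f) (v : DynVertex n m n) :
    f (.out v) .sink + ∑ w, f (.out v) (.inn w) = f (.inn v) (.out v) := by
  have h := hf.conserve (.out v) (by simp [layeredNetwork]) (by simp [layeredNetwork])
  rw [sum_splitVertex, sum_splitVertex, hf.off_edge .sink (.out v) (fun h => h),
    hf.off_edge .source (.out v) (fun h => h),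
    hf.off_edge (.out v) .source (fun h => h),
    Finset.sum_eq_zero (fun w _ => hf.off_edge (.out w) (.out v) (fun h => h)),
    Finset.sum_eq_zero (fun w _ => hf.off_edge (.out v) (.out w) (fun h => h)),
    Finset.sum_eq_single (f := fun w => f (.inn w) (.out v)) v] at h
  · simpa only [add_zero, zero_add] using h.symm
  · intro w _ hw
    exact hf.off_edge _ _ hw
  · simp

theorem flow_source_inr (hf : (layeredNetwork A B).IsFlow f) (u : Fin m × Fin n) :
    f .source (.inn (.inr u)) = f (.inn (.inr u)) (.out (.inr u)) := by
  rw [← flow_sum_inn hf (.inr u), Finset.sum_eq_zero, add_zero]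
  rintro (w | w) _ <;> exact hf.off_edge _ _ fun h => h

theorem flow_source_inl (hf : (layeredNetwork A B).IsFlow f) (v : Fin n × Fin n) :
    f .source (.inn (.inl v)) = 0 := by
  refine hf.off_edge _ _ ?_
  rintro ⟨j, k, h⟩
  simp at h

theorem flowValue_eq (hf : (layeredNetwork A B).IsFlow f) :
    (layeredNetwork A B).flowValue f =
      ∑ u : Fin m × Fin n, f (.inn (.inr u)) (.out (.inr u)) := by
  have h1 : ∑ a, f a .source = 0 := Finset.sum_eq_zero fun a _ => by
    refine hf.off_edge _ _ ?_
    rintro h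
    cases a <;> exact h
  change ∑ w, f .source w - ∑ a, f a .source = _
  rw [h1, sub_zero, sum_splitVertex, hf.off_edge .source .source (fun h => h),
    hf.off_edge .source .sink (fun h => h),
    Finset.sum_eq_zero (fun w _ => hf.off_edge .source (.out w) (fun h => h)),
    Fintype.sum_sum_type, Finset.sum_eq_zero (fun v _ => flow_source_inl hf v)]
  simp [flow_source_inr hf]

theorem flowCost_eq (hf : (layeredNetwork A B).IsFlow f) :
    (layeredNetwork A B).flowCost f =
      ∑ u : Fin m × Fin n, f (.inn (.inr u)) (.out (.inr u)) * ((u.2 : ℕ) + 1) := by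
  have hzero : ∀ a, (∀ u, a ≠ .inn (.inr u)) → ∀ b, (layeredNetwork A B).cost a b = 0 := by
    intro a ha b
    rcases a with _ | _ | (v | v) | v
    · rfl
    · rfl
    · rfl
    · exact absurd rfl (ha v)
    · rfl
  have hz : ∀ a, (∀ u, a ≠ .inn (.inr u)) → ∑ b, f a b * (layeredNetwork A B).cost a b = 0 :=
    fun a ha => Finset.sum_eq_zero fun b _ => by rw [hzero a ha, mul_zero]
  rw [FlowNetwork.flowCost, sum_splitVertex, hz _ (by simp), hz _ (by simp),
    Finset.sum_eq_zero (fun v _ => hz (.out v) (by simp)), Fintype.sum_sum_type,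
    Finset.sum_eq_zero (fun v _ => hz (.inn (.inl v)) (by simp))]
  simp only [zero_add, add_zero]
  refine Finset.sum_congr rfl fun u _ => ?_
  rw [Finset.sum_eq_single (.out (.inr u))]
  · rfl
  · intro b _ hb
    rw [hf.off_edge, zero_mul]
    intro h
    rcases b with _ | _ | v | v
    · exact h
    · exact h
    · exact h
    · exact hb (congrArg _ (h : Sum.inr u = v).symm)
  · simp

theorem flow_le_one (hf : (layeredNetwork A B).IsFlow f) (a b) : f a b ≤ 1 := by
  by_cases h : (layeredNetwork A B).Adj a b
  · exact hf.le_cap a b h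
  · rw [hf.off_edge a b h]
    exact zero_le_one

theorem flow_eq_one (hf : (layeredNetwork A B).IsFlow f) (hi : IsIntegralFlow f) {a b}
    (h : f a b ≠ 0) : f a b = 1 := by
  obtain ⟨z, hz⟩ := hi a b
  have h0 := hf.nonneg a b
  have h1 := flow_le_one hf a b
  rw [hz] at h h0 h1 ⊢
  have h2 : z ≠ 0 := by exact_mod_cast h
  have h3 : 0 ≤ z := by exact_mod_cast h0
  have h4 : z ≤ 1 := by exact_mod_cast h1
  have : z = 1 := by omega
  rw [this, Int.cast_one]

/-- The copies of the inputs that carry flow. -/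
noncomputable def flowInputs (f : SplitVertex (DynVertex n m n) → SplitVertex (DynVertex n m n) → ℝ) :
    Finset (Fin m × Fin n) :=
  open Classical in Finset.univ.filter fun u => f (.inn (.inr u)) (.out (.inr u)) ≠ 0

/-- Forget that the layer is smaller than `n`. -/
def inputVertex : Fin m × Fin n ↪ Fin m × ℕ :=
  ⟨fun u => (u.1, u.2), fun u v h => by simpa [Prod.ext_iff, Fin.ext_iff] using h⟩

theorem eq_of_flow_into (hf : (layeredNetwork A B).IsFlow f) (hi : IsIntegralFlow f)
    {v w y : DynVertex n m n} (hv : f (.out v) (.inn y) ≠ 0) (hw : f (.out w) (.inn y) ≠ 0) :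
    v = w := by
  by_contra hne
  have h1 := flow_sum_inn hf y
  have h2 := flow_le_one hf (.inn y) (.out y)
  have h3 := hf.nonneg .source (.inn y)
  have h4 : ∑ x ∈ {v, w}, f (.out x) (.inn y) ≤ ∑ x, f (.out x) (.inn y) :=
    Finset.sum_le_sum_of_subset_of_nonneg (Finset.subset_univ _) fun x _ _ => hf.nonneg _ _
  rw [Finset.sum_pair hne, flow_eq_one hf hi hv, flow_eq_one hf hi hw] at h4
  linarith

theorem flow_through_ne_zero (hf : (layeredNetwork A B).IsFlow f)
    {v y : DynVertex n m n} (hv : f (.out v) (.inn y) ≠ 0) : f (.inn y) (.out y) ≠ 0 := by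
  have h1 := flow_sum_inn hf y
  have h3 := hf.nonneg .source (.inn y)
  have h4 : f (.out v) (.inn y) ≤ ∑ x, f (.out x) (.inn y) :=
    Finset.single_le_sum (f := fun x => f (.out x) (.inn y)) (fun x _ => hf.nonneg _ _)
      (Finset.mem_univ v)
  have := lt_of_le_of_ne (hf.nonneg _ _) hv.symm
  linarith

theorem exists_flow_out (hf : (layeredNetwork A B).IsFlow f) {v : DynVertex n m n}
    (hv : v ∉ firstLayer n m n) (h : f (.inn v) (.out v) ≠ 0) :
    ∃ y, f (.out v) (.inn y) ≠ 0 := by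
  by_contra! hno
  rw [← flow_sum_out hf, Finset.sum_eq_zero fun y _ => hno y, hf.off_edge (.out v) .sink hv] at h
  simp at h

theorem flow_adj (hf : (layeredNetwork A B).IsFlow f) {v y : DynVertex n m n}
    (h : f (.out v) (.inn y) ≠ 0) : (dynGraph A B n).Adj v y := by
  by_contra hno
  exact h (hf.off_edge _ _ hno)

/-- `v` is the vertex of the dynamic graph that belongs to the tail `a`. -/
def IsTailVertex (a : LNode n m) (v : DynVertex n m n) : Prop :=
  match a, v with
  | (.inl t, k), .inl (i, l) => t = i ∧ (l : ℕ) = k + 1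
  | (.inr j, k), .inr (i, l) => j = i ∧ (l : ℕ) = k
  | _, _ => False

theorem IsTailVertex.unique {a b : LNode n m} {v : DynVertex n m n} (h : IsTailVertex a v)
    (h' : IsTailVertex b v) : a = b := by
  obtain ⟨t | t, k⟩ := a <;> obtain ⟨t' | t', k'⟩ := b <;> obtain ⟨i, l⟩ | ⟨i, l⟩ := v
  · obtain ⟨rfl, h⟩ := h
    obtain ⟨rfl, h'⟩ := h'
    have : k = k' := by omega
    rw [this]
  · exact h.elim
  · exact h'.elim
  · exact h.elim
  · exact h.elim
  · exact h'.elim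
  · exact h.elim
  · obtain ⟨rfl, h⟩ := h
    obtain ⟨rfl, h'⟩ := h'
    have : k = k' := by omega
    rw [this]

/-- The inputs that carry an integral flow are linked to the first layer: a state that carries flow
is matched to its successor, and the other states to themselves. -/
theorem linkable_flowInputs (hn : 0 < n) (hf : (layeredNetwork A B).IsFlow f)
    (hi : IsIntegralFlow f) : Linkable A B ((flowInputs f).map inputVertex) := by
  classical
  have : Nonempty (RNode n) := ⟨(⟨0, hn⟩, 0)⟩
  -- the tail `a` carries flow to the head `w`
  let car : LNode n m → RNode n → Prop := fun a w =>
    ∃ v y, IsTailVertex a v ∧ w = (y.1, (y.2 : ℕ)) ∧ f (.out v) (.inn (.inl y)) ≠ 0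
  have hex : ∀ a ∈ stateTails n m ∪
      (((flowInputs f).map inputVertex).image inputTail : Finset (LNode n m)),
      ∃ w, car a w ∨ ((¬ ∃ w, car a w) ∧ a.1 = .inl w.1 ∧ w.2 = a.2 + 1) := by
    intro a ha
    by_cases hc : ∃ w, car a w
    · obtain ⟨w, hw⟩ := hc
      exact ⟨w, Or.inl hw⟩
    rcases ha with ⟨t, k, rfl⟩ | ha
    · exact ⟨(t, k + 1), Or.inr ⟨hc, rfl, rfl⟩⟩
    · obtain ⟨u, hu, rfl⟩ := Finset.mem_image.1 (Finset.mem_coe.1 ha)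
      obtain ⟨u, hu', rfl⟩ := Finset.mem_map.1 hu
      have h1 := (Finset.mem_filter.1 hu').2
      obtain ⟨y, hy⟩ := exists_flow_out hf (by rintro ⟨i, k, -, h⟩; simp at h) h1
      rcases y with y | y
      · exact absurd ⟨_, .inr u, y, ⟨rfl, rfl⟩, rfl, hy⟩ hc
      · exact (flow_adj hf hy : False).elim
  choose! φ hφ using hex
  refine ⟨φ, ?_, ?_⟩
  · have hmix : ∀ a b w, car a w → ((¬ ∃ w, car b w) ∧ b.1 = .inl w.1 ∧ w.2 = b.2 + 1) →
        False := by
      rintro ⟨a, ka⟩ ⟨b, kb⟩ w ⟨v, y, hv, rfl, hy⟩ ⟨hno, hb, hk⟩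
      simp only at hb hk
      subst hb
      obtain ⟨z, hz⟩ := exists_flow_out hf (by
        rintro ⟨i, k, hk0, h⟩
        rw [Sum.inl.injEq] at h
        subst h
        simp only at hk
        omega) (flow_through_ne_zero hf hy)
      rcases z with z | z
      · exact hno ⟨_, .inl y, z, ⟨rfl, hk⟩, rfl, hz⟩
      · exact (flow_adj hf hz : False).elim
    intro a ha b hb hab
    rcases hφ a ha with h | h <;> rcases hφ b hb with h' | h'
    · obtain ⟨v, y, hv, hy, h⟩ := h
      obtain ⟨v', y', hv', hy', h'⟩ := h'
      have : y = y' := by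
        rw [hab, hy'] at hy
        simpa [Prod.ext_iff, Fin.ext_iff, eq_comm] using hy
      subst this
      obtain rfl := eq_of_flow_into hf hi h h'
      exact hv.unique hv'
    · exact (hmix a b _ h (hab ▸ h')).elim
    · exact (hmix b a _ h' (hab ▸ h)).elim
    · rw [hab] at h
      refine Prod.ext (h.2.1.trans h'.2.1.symm) ?_
      have := h.2.2
      have := h'.2.2
      omega
  · intro a ha
    rw [mem_heads]
    rcases hφ a ha with ⟨v, y, hv, hy, h⟩ | h
    · left
      rw [hy]
      have hadj := flow_adj hf h
      obtain ⟨t | t, k⟩ := a <;> obtain ⟨i, l⟩ | ⟨i, l⟩ := v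
      · obtain ⟨rfl, hl⟩ := hv
        obtain ⟨h1, h2⟩ : (l : ℕ) = y.2 + 1 ∧ A y.1 t = true := hadj
        exact ⟨by simp only; omega, h2⟩
      · exact hv.elim
      · exact hv.elim
      · obtain ⟨rfl, hl⟩ := hv
        obtain ⟨h1, h2⟩ : l = y.2 ∧ B y.1 t = true := hadj
        exact ⟨by simp only; rw [← h1]; exact hl, h2⟩
    · exact Or.inr ⟨h.2.2, h.2.1⟩

/-! ### The flow along a linking -/

/-- The sequence of the vertices on the path of a linking that starts at `u`, from the source to the
sink; `x s` is the state that the path visits in layer `s`. The sink is repeated for ever. -/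
def pathVertex (u : Fin m × Fin n) (x : ℕ → Fin n) : ℕ → SplitVertex (DynVertex n m n)
  | 0 => .source
  | 1 => .inn (.inr u)
  | 2 => .out (.inr u)
  | t + 3 =>
    if t / 2 ≤ u.2 then
      if t % 2 = 0 then .inn (.inl (x (u.2 - t / 2), ⟨u.2 - t / 2, by omega⟩))
      else .out (.inl (x (u.2 - t / 2), ⟨u.2 - t / 2, by omega⟩))
    else .sink

theorem pathVertex_adj {I : Finset (Fin m × ℕ)} {x : Fin m × ℕ → ℕ → Fin n}
    (hx : IsRouting A B I x) {u : Fin m × Fin n} (hu : inputVertex u ∈ I) {t : ℕ}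
    (ht : t < 2 * (u.2 : ℕ) + 5) :
    (layeredNetwork A B).Adj (pathVertex u (x (inputVertex u)) t)
      (pathVertex u (x (inputVertex u)) (t + 1)) := by
  rcases t with _ | _ | _ | t
  · exact ⟨u.1, u.2, rfl⟩
  · exact (rfl : (Sum.inr u : DynVertex n m n) = _)
  · simp only [pathVertex, Nat.zero_div, Nat.zero_le, if_true, Nat.zero_mod, Nat.sub_zero]
    exact ⟨rfl, hx.start _ hu⟩
  · have h1 : t / 2 ≤ u.2 := by omega
    simp only [pathVertex, h1, if_true]
    rcases Nat.mod_two_eq_zero_or_one t with h | h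
    · have h2 : (t + 1) / 2 = t / 2 := by omega
      have h3 : (t + 1) % 2 = 1 := by omega
      simp only [h, h2, h3, h1, if_true, one_ne_zero, if_false]
      exact (rfl : (Sum.inl _ : DynVertex n m n) = _)
    · have h2 : (t + 1) / 2 = t / 2 + 1 := by omega
      have h3 : (t + 1) % 2 = 0 := by omega
      simp only [h, h2, h3, if_true, one_ne_zero, if_false]
      split_ifs with h4
      · have h5 : (u.2 : ℕ) - t / 2 = u.2 - (t / 2 + 1) + 1 := by omega
        refine ⟨h5, ?_⟩
        have := hx.step _ hu (u.2 - (t / 2 + 1)) (by change _ < (u.2 : ℕ); omega)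
        rwa [← h5] at this
      · exact ⟨_, _, by simp only; omega, rfl⟩

theorem pathVertex_inj {I : Finset (Fin m × ℕ)} {x : Fin m × ℕ → ℕ → Fin n}
    (hx : IsRouting A B I x) {u v : Fin m × Fin n} (hu : inputVertex u ∈ I)
    (hv : inputVertex v ∈ I) {t s : ℕ} (ht : t < 2 * (u.2 : ℕ) + 5)
    (hs : s < 2 * (v.2 : ℕ) + 5) (ht0 : t ≠ 0)
    (h : pathVertex u (x (inputVertex u)) t = pathVertex v (x (inputVertex v)) s) :
    u = v ∧ t = s := by
  rcases t with _ | _ | _ | t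
  · exact absurd rfl ht0
  · rcases s with _ | _ | _ | s
    · simp [pathVertex] at h
    · simpa [pathVertex] using h
    · simp [pathVertex] at h
    · simp only [pathVertex] at h
      split_ifs at h
      simp at h
  · rcases s with _ | _ | _ | s
    · simp [pathVertex] at h
    · simp [pathVertex] at h
    · simpa [pathVertex] using h
    · simp only [pathVertex] at h
      split_ifs at h
      simp at h
  · have h1 : t / 2 ≤ u.2 := by omega
    rcases s with _ | _ | _ | s
    · simp only [pathVertex] at h
      split_ifs at h
    · simp only [pathVertex] at h
      split_ifs at h
      simp at h
    · simp only [pathVertex] at h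
      split_ifs at h
      simp at h
    · have h2 : s / 2 ≤ v.2 := by omega
      simp only [pathVertex, h1, h2, if_true] at h
      have key : x (inputVertex u) (u.2 - t / 2) = x (inputVertex v) (v.2 - s / 2) ∧
          (u.2 : ℕ) - t / 2 = v.2 - s / 2 ∧ t % 2 = s % 2 := by
        split_ifs at h with h3 h4 h4
        · simp only [SplitVertex.inn.injEq, Sum.inl.injEq, Prod.mk.injEq, Fin.mk.injEq] at h
          exact ⟨h.1, h.2, by omega⟩
        · simp only [SplitVertex.out.injEq, Sum.inl.injEq, Prod.mk.injEq, Fin.mk.injEq] at h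
          exact ⟨h.1, h.2, by omega⟩
      obtain ⟨k1, k2, k3⟩ := key
      have huv : u = v := by
        by_contra hne
        refine hx.disj _ hu _ hv (fun h => hne (inputVertex.injective h)) (u.2 - t / 2)
          (Nat.sub_le _ _) (k2 ▸ Nat.sub_le _ _) ?_
        rw [k1, k2]
      subst huv
      exact ⟨rfl, by omega⟩

/-- The sum of the unit flows along the paths of a linking: it counts the steps of the paths. -/
noncomputable def pathFlow (K : Finset (Fin m × Fin n)) (x : Fin m × ℕ → ℕ → Fin n)
    (a b : SplitVertex (DynVertex n m n)) : ℝ :=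
  ∑ u ∈ K, ∑ t ∈ Finset.range (2 * (u.2 : ℕ) + 5),
    if pathVertex u (x (inputVertex u)) t = a ∧ pathVertex u (x (inputVertex u)) (t + 1) = b
    then 1 else 0

theorem pathFlow_eq_card (K : Finset (Fin m × Fin n)) (x : Fin m × ℕ → ℕ → Fin n)
    (a b : SplitVertex (DynVertex n m n)) :
    pathFlow K x a b = (((K.sigma fun u => Finset.range (2 * (u.2 : ℕ) + 5)).filter fun p =>
      pathVertex p.1 (x (inputVertex p.1)) p.2 = a ∧
        pathVertex p.1 (x (inputVertex p.1)) (p.2 + 1) = b).card : ℝ) := by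
  rw [pathFlow, Finset.card_filter, Finset.sum_sigma]
  push_cast
  rfl

theorem isFlow_pathFlow {K : Finset (Fin m × Fin n)} {x : Fin m × ℕ → ℕ → Fin n}
    (hx : IsRouting A B (K.map inputVertex) x) : (layeredNetwork A B).IsFlow (pathFlow K x) := by
  have hmem : ∀ u ∈ K, inputVertex u ∈ K.map inputVertex := fun u hu =>
    Finset.mem_map_of_mem _ hu
  refine ⟨?_, ?_, ?_, ?_⟩
  · intro a b
    rw [pathFlow_eq_card]
    exact Nat.cast_nonneg _
  · intro a b hab
    refine Finset.sum_eq_zero fun u hu => Finset.sum_eq_zero fun t ht => ?_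
    rw [if_neg]
    rintro ⟨rfl, rfl⟩
    exact hab (pathVertex_adj hx (hmem u hu) (Finset.mem_range.1 ht))
  · intro a b _
    rw [pathFlow_eq_card]
    change _ ≤ (1 : ℝ)
    rw [Nat.cast_le_one, Finset.card_le_one]
    rintro ⟨u, t⟩ hu ⟨v, s⟩ hv
    simp only [Finset.mem_filter, Finset.mem_sigma, Finset.mem_range] at hu hv
    obtain ⟨⟨hu, ht⟩, hua, hub⟩ := hu
    obtain ⟨⟨hv, hs⟩, hva, hvb⟩ := hv
    have : u = v ∧ t = s := by
      rcases Nat.eq_zero_or_pos t with rfl | ht0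
      · rcases Nat.eq_zero_or_pos s with rfl | hs0
        · rw [← hvb] at hub
          exact ⟨(pathVertex_inj hx (hmem u hu) (hmem v hv) (t := 0 + 1) (s := 0 + 1) (by omega)
            (by omega) one_ne_zero hub).1, rfl⟩
        · rw [← hua] at hva
          have := pathVertex_inj hx (hmem v hv) (hmem u hu) hs ht hs0.ne' hva
          exact ⟨this.1.symm, this.2.symm⟩
      · rw [← hva] at hua
        exact pathVertex_inj hx (hmem u hu) (hmem v hv) ht hs ht0.ne' hua
    obtain ⟨rfl, rfl⟩ := this
    rfl
  · intro v hvs hvt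
    -- both sides count the visits of the paths at `v`
    have hin : ∀ a, ∑ b, pathFlow K x a b = ∑ u ∈ K, ∑ t ∈ Finset.range (2 * (u.2 : ℕ) + 5),
        if pathVertex u (x (inputVertex u)) t = a then (1 : ℝ) else 0 := by
      intro a
      simp only [pathFlow]
      rw [Finset.sum_comm]
      refine Finset.sum_congr rfl fun u _ => ?_
      rw [Finset.sum_comm]
      refine Finset.sum_congr rfl fun t _ => ?_
      simp only [ite_and]
      split_ifs <;> simp
    have hout : ∀ b, ∑ a, pathFlow K x a b = ∑ u ∈ K, ∑ t ∈ Finset.range (2 * (u.2 : ℕ) + 5),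
        if pathVertex u (x (inputVertex u)) (t + 1) = b then (1 : ℝ) else 0 := by
      intro b
      simp only [pathFlow]
      rw [Finset.sum_comm]
      refine Finset.sum_congr rfl fun u _ => ?_
      rw [Finset.sum_comm]
      refine Finset.sum_congr rfl fun t _ => ?_
      simp only [and_comm (b := _ = b), ite_and]
      split_ifs <;> simp
    rw [hin, hout]
    refine Finset.sum_congr rfl fun u _ => ?_
    have h1 := Finset.sum_range_succ (fun t =>
      if pathVertex u (x (inputVertex u)) t = v then (1 : ℝ) else 0) (2 * (u.2 : ℕ) + 5)
    rw [Finset.sum_range_succ'] at h1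
    have h2 : pathVertex u (x (inputVertex u)) 0 ≠ v := fun h => hvs h.symm
    have h3 : pathVertex u (x (inputVertex u)) (2 * (u.2 : ℕ) + 5) ≠ v := by
      intro h
      refine hvt (h.symm.trans ?_)
      have : ¬ (2 * (u.2 : ℕ) + 2) / 2 ≤ u.2 := by omega
      simp only [pathVertex, this, if_false]
      rfl
    rw [if_neg h2, if_neg h3, add_zero, add_zero] at h1
    exact h1

theorem pathFlow_input {K : Finset (Fin m × Fin n)} {x : Fin m × ℕ → ℕ → Fin n}
    (u : Fin m × Fin n) :
    pathFlow K x (.inn (.inr u)) (.out (.inr u)) = if u ∈ K then 1 else 0 := by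
  have hval : ∀ (v : Fin m × Fin n) (t : ℕ),
      (pathVertex v (x (inputVertex v)) t = .inn (.inr u) ∧
        pathVertex v (x (inputVertex v)) (t + 1) = .out (.inr u)) ↔ v = u ∧ t = 1 := by
    intro v t
    constructor
    · rintro ⟨h, -⟩
      rcases t with _ | _ | _ | t
      · simp [pathVertex] at h
      · simpa [pathVertex] using h
      · simp [pathVertex] at h
      · simp only [pathVertex] at h
        split_ifs at h
        simp at h
    · rintro ⟨rfl, rfl⟩
      exact ⟨rfl, rfl⟩
  simp only [pathFlow, hval, ite_and]
  have : ∀ v : Fin m × Fin n, ∑ t ∈ Finset.range (2 * (v.2 : ℕ) + 5),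
      (if v = u then if t = 1 then (1 : ℝ) else 0 else 0) = if v = u then 1 else 0 := by
    intro v
    split_ifs <;> simp
  simp only [this, Finset.sum_ite_eq']

theorem exists_flow_of_linkable {K : Finset (Fin m × Fin n)}
    (h : Linkable A B (K.map inputVertex)) :
    ∃ g, (layeredNetwork A B).IsFlow g ∧ (layeredNetwork A B).flowValue g = K.card ∧
      (layeredNetwork A B).flowCost g = ∑ u ∈ K, (((u.2 : ℕ) + 1 : ℕ) : ℝ) := by
  obtain ⟨x, hx⟩ := h.exists_routing
  refine ⟨_, isFlow_pathFlow hx, ?_, ?_⟩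
  · rw [flowValue_eq (isFlow_pathFlow hx)]
    simp [pathFlow_input]
  · rw [flowCost_eq (isFlow_pathFlow hx)]
    simp [pathFlow_input]

theorem exists_map_inputVertex {I : Finset (Fin m × ℕ)} (h : ∀ u ∈ I, u.2 < n) :
    ∃ K : Finset (Fin m × Fin n), K.map inputVertex = I := by
  classical
  refine ⟨Finset.univ.filter fun u => inputVertex u ∈ I, ?_⟩
  ext u
  simp only [Finset.mem_map, Finset.mem_filter, Finset.mem_univ, true_and]
  constructor
  · rintro ⟨v, hv, rfl⟩
    exact hv
  · intro hu
    exact ⟨(u.1, ⟨u.2, h u hu⟩), hu, rfl⟩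

/-- An integral minimum cost maximum flow starts in layers that are as low as possible: a starting
point above `muLow` could be exchanged for a cheaper one, because the starting points of linkings
have the exchange property. -/
theorem muLow_eq_gamma (hn : 1 ≤ n) (hB : ∃ i j, B i j = true)
    (hf : (layeredNetwork A B).IsMCMF f) (hi : IsIntegralFlow f) : muLow A B = gamma f := by
  classical
  obtain ⟨⟨hflow, hmax⟩, hmin⟩ := hf
  have hlink := linkable_flowInputs hn hflow hi
  have hval1 : ∀ u, f (.inn (.inr u)) (.out (.inr u)) = if u ∈ flowInputs f then 1 else 0 := by
    intro u
    simp only [flowInputs, Finset.mem_filter, Finset.mem_univ, true_and]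
    split_ifs with h
    · exact flow_eq_one hflow hi h
    · exact not_not.1 h
  have hvalue : (layeredNetwork A B).flowValue f = (flowInputs f).card := by
    rw [flowValue_eq hflow]
    simp [hval1]
  have hcost : (layeredNetwork A B).flowCost f =
      ∑ u ∈ flowInputs f, (((u.2 : ℕ) + 1 : ℕ) : ℝ) := by
    rw [flowCost_eq hflow]
    simp [hval1]
  have hlt : ∀ u ∈ (flowInputs f).map inputVertex, u.2 < n := by
    intro u hu
    obtain ⟨v, -, rfl⟩ := Finset.mem_map.1 hu
    exact v.2.2
  obtain ⟨⟨hmu, hmueq⟩, hleast⟩ := isLeast_muLow A B hn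
  obtain ⟨J, hJ, hJlt, hJc⟩ := exists_linkable_card_eq_maxLinking (A := A) (B := B) hn
    (muLow A B)
  rw [hmueq] at hJc
  have hJn : ∀ u ∈ J, u.2 < n := fun u hu => (hJlt u hu).trans_le hmu.2
  have hcard : (flowInputs f).card = maxLinking A B n := by
    refine le_antisymm ?_ ?_
    · rw [← Finset.card_map inputVertex]
      exact hlink.card_le_maxLinking hn hlt
    · obtain ⟨K, rfl⟩ := exists_map_inputVertex hJn
      obtain ⟨g, hg, hgv, -⟩ := exists_flow_of_linkable hJ
      have := hmax g hg
      rw [hgv, hvalue, Nat.cast_le] at this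
      rwa [← hJc, Finset.card_map]
  have hlow : ∀ u ∈ flowInputs f, (u.2 : ℕ) < muLow A B := by
    intro u hu
    by_contra! hge
    have hcu : ((flowInputs f).erase u).card + 1 = maxLinking A B n := by
      rw [Finset.card_erase_add_one hu, hcard]
    obtain ⟨v, hv, hvn, hins⟩ := (hlink.mono (I := ((flowInputs f).erase u).map inputVertex)
      (Finset.map_subset_map.2 (Finset.erase_subset _ _))).augment hn hJ (by
        rw [Finset.card_map]; omega)
    obtain ⟨v, rfl⟩ : ∃ w, inputVertex w = v := ⟨(v.1, ⟨v.2, hJn v hv⟩), rfl⟩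
    rw [← Finset.map_insert] at hins
    have hvn' : v ∉ (flowInputs f).erase u := fun h => hvn (Finset.mem_map_of_mem _ h)
    obtain ⟨g, hg, hgv, hgc⟩ := exists_flow_of_linkable hins
    rw [Finset.card_insert_of_notMem hvn', hcu, ← hcard, ← hvalue] at hgv
    have hle := hmin g ⟨hg, fun g' hg' => hgv ▸ hmax g' hg'⟩
    rw [hgc, hcost, Finset.sum_insert hvn', ← Finset.add_sum_erase _ _ hu,
      add_le_add_iff_right, Nat.cast_le] at hle
    have : (v.2 : ℕ) < muLow A B := hJlt _ hv
    omega
  have hpos : 0 < maxLinking A B n := by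
    obtain ⟨i, j, hij⟩ := hB
    have := (linkable_singleton (A := A) hij).card_le_maxLinking hn (l := n) (by simp; omega)
    rw [Finset.card_singleton] at this
    exact this
  have hset : {l : ℕ | ∃ (j : Fin m) (k : Fin n),
      l = (k : ℕ) + 1 ∧ 0 < f (.inn (.inr (j, k))) (.out (.inr (j, k)))} =
      {l : ℕ | ∃ u ∈ flowInputs f, l = (u.2 : ℕ) + 1} := by
    ext l
    constructor
    · rintro ⟨j, k, rfl, h⟩
      refine ⟨(j, k), ?_, rfl⟩
      by_contra hno
      rw [hval1, if_neg hno] at h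
      exact lt_irrefl _ h
    · rintro ⟨u, hu, rfl⟩
      exact ⟨u.1, u.2, rfl, by rw [hval1, if_pos hu]; exact one_pos⟩
  obtain ⟨u₀, hu₀⟩ : (flowInputs f).Nonempty := Finset.card_pos.1 (by omega)
  rw [gamma, hset]
  have hbdd : BddAbove {l : ℕ | ∃ u ∈ flowInputs f, l = (u.2 : ℕ) + 1} := by
    refine ⟨muLow A B, ?_⟩
    rintro l ⟨u, hu, rfl⟩
    exact hlow u hu
  have hle : sSup {l : ℕ | ∃ u ∈ flowInputs f, l = (u.2 : ℕ) + 1} ≤ muLow A B := by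
    refine csSup_le ⟨_, u₀, hu₀, rfl⟩ ?_
    rintro l ⟨u, hu, rfl⟩
    exact hlow u hu
  have hge : ∀ u ∈ flowInputs f,
      (u.2 : ℕ) + 1 ≤ sSup {l : ℕ | ∃ u ∈ flowInputs f, l = (u.2 : ℕ) + 1} :=
    fun u hu => le_csSup hbdd ⟨u, hu, rfl⟩
  refine le_antisymm (hleast ⟨⟨?_, hle.trans hmu.2⟩, le_antisymm
    (maxLinking_mono hn (hle.trans hmu.2)) ?_⟩) hle
  · have := hge u₀ hu₀
    omega
  · rw [← hcard, ← Finset.card_map inputVertex]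
    refine hlink.card_le_maxLinking hn fun u hu => ?_
    obtain ⟨v, hv, rfl⟩ := Finset.mem_map.1 hu
    exact hge v hv

end Flow


/-! ### A language of bounded loops and its compilation -/

section Compiler

theorem size_mul_le (a b : ℕ) : (a * b).size ≤ a.size + b.size := by
  rw [Nat.size_le, pow_add]
  exact Nat.mul_lt_mul'' (Nat.lt_size_self a) (Nat.lt_size_self b)

theorem size_add_le (a b : ℕ) : (a + b).size ≤ a.size + b.size + 1 := by
  rw [Nat.size_le, pow_succ, mul_two]
  have h1 : 2 ^ a.size ≤ 2 ^ (a.size + b.size) := Nat.pow_le_pow_right two_pos (by omega)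
  have h2 : 2 ^ b.size ≤ 2 ^ (a.size + b.size) := Nat.pow_le_pow_right two_pos (by omega)
  have := Nat.lt_size_self a
  have := Nat.lt_size_self b
  omega

theorem size_eval_le (o : ArithOp) (a b : ℕ) : (o.eval a b).size ≤ a.size + b.size + 1 := by
  cases o
  · exact size_add_le a b
  · exact (Nat.size_le_size (Nat.sub_le a b)).trans (by omega)
  · exact (size_mul_le a b).trans (by omega)
  · exact (Nat.size_le_size (Nat.div_le_self a b)).trans (by omega)
  · exact (Nat.size_le_size (Nat.mod_le a b)).trans (by omega)

theorem arithCost_le (o : ArithOp) (a b : ℕ) : o.cost a b ≤ (1 + a.size) * (1 + b.size) := by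
  cases o <;> simp only [ArithOp.cost] <;> nlinarith

/-- An expression is evaluated at a cost that is quadratic in the bit length of the memory. -/
theorem RamExpr.exists_cost_le (e : RamExpr) : ∃ κ : ℕ, ∀ (σ : ℕ → ℕ) (w : ℕ), 1 ≤ w →
    (∀ x, (σ x).size ≤ w) → e.cost σ ≤ κ * w ^ 2 ∧ (e.eval σ).size ≤ κ * w := by
  induction e with
  | lit c =>
    refine ⟨1 + c.size, fun σ w hw _ => ⟨?_, ?_⟩⟩
    · exact Nat.le_mul_of_pos_right _ (by positivity)
    · simp only [RamExpr.eval]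
      nlinarith
  | mem e ih =>
    obtain ⟨κ, h⟩ := ih
    refine ⟨2 * κ + 2, fun σ w hw hσ => ⟨?_, ?_⟩⟩
    · obtain ⟨h1, h2⟩ := h σ w hw hσ
      have h3 := hσ (e.eval σ)
      have h4 : w ≤ w ^ 2 := Nat.le_self_pow two_ne_zero w
      have h5 : κ * w ≤ κ * w ^ 2 := Nat.mul_le_mul_left _ h4
      simp only [RamExpr.cost]
      linarith
    · simp only [RamExpr.eval]
      exact (hσ _).trans (by nlinarith)
  | bin o e f ihe ihf =>
    obtain ⟨κ, h⟩ := ihe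
    obtain ⟨μ, h'⟩ := ihf
    refine ⟨κ + μ + 1 + (1 + κ) * (1 + μ), fun σ w hw hσ => ⟨?_, ?_⟩⟩
    · obtain ⟨h1, h2⟩ := h σ w hw hσ
      obtain ⟨h3, h4⟩ := h' σ w hw hσ
      have h5 : (1 + (e.eval σ).size) * (1 + (f.eval σ).size) ≤
          ((1 + κ) * w) * ((1 + μ) * w) :=
        Nat.mul_le_mul (by linarith) (by linarith)
      have h6 := arithCost_le o (e.eval σ) (f.eval σ)
      have h7 : 0 ≤ w ^ 2 := Nat.zero_le _
      simp only [RamExpr.cost]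
      linarith
    · obtain ⟨-, h2⟩ := h σ w hw hσ
      obtain ⟨-, h4⟩ := h' σ w hw hσ
      have h5 := size_eval_le o (e.eval σ) (f.eval σ)
      simp only [RamExpr.eval]
      have h6 : 0 ≤ (1 + κ) * (1 + μ) * w := Nat.zero_le _
      linarith

/-- Expressions over the dimensions, the input and arrays with names in `ι`: `entry e` is the cell
with address `e` of the input. -/
inductive Expr (ι : Type) where
  | lit (c : ℕ)
  | rows
  | cols
  | entry (e : Expr ι)
  | arr (a : ι) (e : Expr ι)
  | bin (o : ArithOp) (e f : Expr ι)

/-- The contents of the arrays. -/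
abbrev Store (ι : Type) : Type := ι → ℕ → ℕ

/-- The length of the input in memory. -/
def inputLength (n m : ℕ) : ℕ := 2 + n * n + n * m

section Language

variable {ι : Type}

namespace Expr

/-- The value of an expression. Addresses beyond the end of the input are reduced. -/
def eval {n m : ℕ} (A : Matrix (Fin n) (Fin n) Bool) (B : Matrix (Fin n) (Fin m) Bool)
    (s : Store ι) : Expr ι → ℕ
  | lit c => c
  | rows => n
  | cols => m
  | entry e => initMemory A B (e.eval A B s % inputLength n m)
  | arr a e => s a (e.eval A B s)
  | bin o e f => o.eval (e.eval A B s) (f.eval A B s)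

instance : Add (Expr ι) := ⟨bin .add⟩
instance : Sub (Expr ι) := ⟨bin .sub⟩
instance : Mul (Expr ι) := ⟨bin .mul⟩
instance : Div (Expr ι) := ⟨bin .div⟩
instance : Mod (Expr ι) := ⟨bin .mod⟩
instance (c : ℕ) : OfNat (Expr ι) c := ⟨lit c⟩

/-- The array `a` used as a scalar variable. -/
abbrev var (a : ι) : Expr ι := arr a 0

section Eval

variable {n m : ℕ} (A : Matrix (Fin n) (Fin n) Bool) (B : Matrix (Fin n) (Fin m) Bool)
  (s : Store ι)

@[simp] theorem eval_add (e f : Expr ι) : (e + f).eval A B s = e.eval A B s + f.eval A B s := rfl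
@[simp] theorem eval_sub (e f : Expr ι) : (e - f).eval A B s = e.eval A B s - f.eval A B s := rfl
@[simp] theorem eval_mul (e f : Expr ι) : (e * f).eval A B s = e.eval A B s * f.eval A B s := rfl
@[simp] theorem eval_div (e f : Expr ι) : (e / f).eval A B s = e.eval A B s / f.eval A B s := rfl
@[simp] theorem eval_mod (e f : Expr ι) : (e % f).eval A B s = e.eval A B s % f.eval A B s := rfl
@[simp] theorem eval_ofNat (c : ℕ) : (no_index (OfNat.ofNat c : Expr ι)).eval A B s = c := rfl
@[simp] theorem eval_rows : (rows : Expr ι).eval A B s = n := rfl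
@[simp] theorem eval_cols : (cols : Expr ι).eval A B s = m := rfl
@[simp] theorem eval_arr (a : ι) (e : Expr ι) : (arr a e).eval A B s = s a (e.eval A B s) := rfl
@[simp] theorem eval_entry (e : Expr ι) :
    (entry e).eval A B s = initMemory A B (e.eval A B s % inputLength n m) := rfl

end Eval

end Expr

/-- The bounds of loops: polynomials in the dimensions. -/
inductive Bound where
  | lit (c : ℕ)
  | rows
  | cols
  | add (e f : Bound)
  | mul (e f : Bound)

/-- The value of a bound. -/
def Bound.val (n m : ℕ) : Bound → ℕ
  | lit c => c
  | rows => n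
  | cols => m
  | add e f => e.val n m + f.val n m
  | mul e f => e.val n m * f.val n m

/-- A bound as an expression. -/
def Bound.toExpr : Bound → Expr ι
  | lit c => .lit c
  | rows => .rows
  | cols => .cols
  | add e f => .bin .add e.toExpr f.toExpr
  | mul e f => .bin .mul e.toExpr f.toExpr

theorem Bound.eval_toExpr {n m : ℕ} (A : Matrix (Fin n) (Fin n) Bool)
    (B : Matrix (Fin n) (Fin m) Bool) (s : Store ι) (N : Bound) :
    (N.toExpr : Expr ι).eval A B s = N.val n m := by
  induction N with
  | lit | rows | cols => rfl
  | add e f he hf => exact congrArg₂ _ he hf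
  | mul e f he hf => exact congrArg₂ _ he hf

/-- Programs with bounded loops. `set a e v` writes `v` into the place `e` of the array `a`, and
`loop a N P` runs `P` for the values `0, …, N - 1` of the variable `a`. -/
inductive Stmt (ι : Type) where
  | set (a : ι) (e v : Expr ι)
  | seq (P Q : Stmt ι)
  | ite (test : Expr ι) (P Q : Stmt ι)
  | loop (a : ι) (N : Bound) (P : Stmt ι)

/-- The store after writing `v` into the place `x` of the array `a`. -/
def Store.write [DecidableEq ι] (s : Store ι) (a : ι) (x v : ℕ) : Store ι :=
  Function.update s a (Function.update (s a) x v)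

/-- Run `f 0, …, f (k - 1)` one after the other. -/
def runUpTo {α : Type*} (f : ℕ → α → α) (s : α) : ℕ → α
  | 0 => s
  | k + 1 => f k (runUpTo f s k)

/-- The invariant rule for loops. -/
theorem runUpTo_induction {α : Type*} {f : ℕ → α → α} {s : α} (I : ℕ → α → Prop) (h0 : I 0 s)
    (k : ℕ) (hstep : ∀ i < k, ∀ t, I i t → I (i + 1) (f i t)) : I k (runUpTo f s k) := by
  induction k with
  | zero => exact h0
  | succ k ih => exact hstep k (Nat.lt_succ_self k) _ (ih fun i hi => hstep i (by omega))

namespace Stmt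

/-- The effect of a program. -/
def run [DecidableEq ι] {n m : ℕ} (A : Matrix (Fin n) (Fin n) Bool)
    (B : Matrix (Fin n) (Fin m) Bool) : Stmt ι → Store ι → Store ι
  | set a e v, s => s.write a (e.eval A B s) (v.eval A B s)
  | seq P Q, s => Q.run A B (P.run A B s)
  | ite b P Q, s => if b.eval A B s ≠ 0 then P.run A B s else Q.run A B s
  | loop a N P, s =>
    (runUpTo (fun i t => P.run A B (t.write a 0 i)) s (N.val n m)).write a 0 (N.val n m)

theorem run_seq [DecidableEq ι] {n m : ℕ} (A : Matrix (Fin n) (Fin n) Bool)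
    (B : Matrix (Fin n) (Fin m) Bool) (P Q : Stmt ι) (s : Store ι) :
    (seq P Q).run A B s = Q.run A B (P.run A B s) := rfl

theorem run_loop [DecidableEq ι] {n m : ℕ} (A : Matrix (Fin n) (Fin n) Bool)
    (B : Matrix (Fin n) (Fin m) Bool) (a : ι) (N : Bound) (P : Stmt ι) (s : Store ι) :
    (loop a N P).run A B s =
      (runUpTo (fun i t => P.run A B (t.write a 0 i)) s (N.val n m)).write a 0 (N.val n m) := rfl

/-- A bound of the number of steps. -/
def time (n m : ℕ) : Stmt ι → ℕ
  | set _ _ _ => 1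
  | seq P Q => P.time n m + Q.time n m
  | ite _ P Q => 1 + P.time n m + Q.time n m
  | loop _ N P => 2 + N.val n m * (P.time n m + 1)

/-- The program does not write into the array `a`. -/
def Avoids (a : ι) : Stmt ι → Prop
  | set b _ _ => a ≠ b
  | seq P Q => P.Avoids a ∧ Q.Avoids a
  | ite _ P Q => P.Avoids a ∧ Q.Avoids a
  | loop b _ P => a ≠ b ∧ P.Avoids a

theorem run_of_avoids [DecidableEq ι] {n m : ℕ} (A : Matrix (Fin n) (Fin n) Bool)
    (B : Matrix (Fin n) (Fin m) Bool) {a : ι} (P : Stmt ι) (h : P.Avoids a) (s : Store ι) :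
    P.run A B s a = s a := by
  induction P generalizing s with
  | set b e v => exact Function.update_of_ne h _ _
  | seq P Q hP hQ => exact (hQ h.2 _).trans (hP h.1 _)
  | ite b P Q hP hQ =>
    rw [run]
    split_ifs
    · exact hP h.1 s
    · exact hQ h.2 s
  | loop b N P hP =>
    rw [run, Store.write, Function.update_of_ne h.1]
    refine runUpTo_induction (fun _ (t : Store ι) => t a = s a) rfl _ fun i _ t ht => ?_
    rw [hP h.2, Store.write, Function.update_of_ne h.1, ht]

end Stmt

theorem Store.write_self [DecidableEq ι] (s : Store ι) (a : ι) (x v : ℕ) :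
    s.write a x v a x = v := by
  simp [Store.write]

section Encode

variable [Fintype ι]

/-- The memory of the machine: the input is followed by the arrays, which are interleaved. -/
noncomputable def encode {n m : ℕ} (A : Matrix (Fin n) (Fin n) Bool)
    (B : Matrix (Fin n) (Fin m) Bool) (s : Store ι) (x : ℕ) : ℕ :=
  if h : inputLength n m ≤ x ∧ 0 < Fintype.card ι then
    s ((Fintype.equivFin ι).symm ⟨(x - inputLength n m) % Fintype.card ι, Nat.mod_lt _ h.2⟩)
      ((x - inputLength n m) / Fintype.card ι)
  else initMemory A B x

/-- The address of the place `x` of the array `a`. -/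
noncomputable def address (n m : ℕ) (a : ι) (x : ℕ) : ℕ :=
  inputLength n m + (Fintype.card ι * x + Fintype.equivFin ι a)

variable {n m : ℕ} (A : Matrix (Fin n) (Fin n) Bool) (B : Matrix (Fin n) (Fin m) Bool)

theorem length_initMemory : ([n, m] ++ List.ofFn (fun q : Fin (n * n) =>
    (A q.divNat q.modNat).toNat) ++ List.ofFn (fun q : Fin (n * m) =>
      (B q.divNat q.modNat).toNat)).length = inputLength n m := by
  simp [inputLength]
  omega

theorem initMemory_of_le {x : ℕ} (h : inputLength n m ≤ x) : initMemory A B x = 0 :=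
  List.getD_eq_default _ _ ((length_initMemory A B).trans_le h)

theorem initMemory_le (x : ℕ) : initMemory A B x ≤ (n + m + 1) ^ 2 := by
  by_cases h : x < ([n, m] ++ List.ofFn (fun q : Fin (n * n) => (A q.divNat q.modNat).toNat) ++
      List.ofFn (fun q : Fin (n * m) => (B q.divNat q.modNat).toNat)).length
  · rw [initMemory, List.getD_eq_getElem _ _ h]
    have hb : ∀ b : Bool, b.toNat ≤ (n + m + 1) ^ 2 := fun b =>
      (Bool.toNat_le b).trans (Nat.one_le_pow _ _ (by omega))
    have hall : ∀ y ∈ [n, m] ++ List.ofFn (fun q : Fin (n * n) => (A q.divNat q.modNat).toNat) ++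
        List.ofFn (fun q : Fin (n * m) => (B q.divNat q.modNat).toNat), y ≤ (n + m + 1) ^ 2 := by
      intro y hy
      simp only [List.mem_append, List.mem_cons, List.not_mem_nil, or_false, List.mem_ofFn] at hy
      rcases hy with ((h | h) | ⟨q, rfl⟩) | ⟨q, rfl⟩
      · have := Nat.le_self_pow two_ne_zero (n + m + 1)
        omega
      · have := Nat.le_self_pow two_ne_zero (n + m + 1)
        omega
      · exact hb _
      · exact hb _
    exact hall _ (List.getElem_mem h)
  · rw [initMemory, List.getD_eq_default _ _ (not_lt.1 h)]
    exact Nat.zero_le _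

theorem encode_zero : encode A B (fun (_ : ι) _ => 0) = initMemory A B := by
  funext x
  rw [encode]
  split_ifs with h
  · exact (initMemory_of_le A B h.1).symm
  · rfl

theorem encode_of_lt (s : Store ι) {x : ℕ} (h : x < inputLength n m) :
    encode A B s x = initMemory A B x :=
  dif_neg fun h' => absurd h'.1 (not_le.2 h)

theorem encode_address (s : Store ι) (a : ι) (x : ℕ) :
    encode A B s (address n m a x) = s a x := by
  have hpos : 0 < Fintype.card ι := Fintype.card_pos_iff.2 ⟨a⟩
  have hlt := (Fintype.equivFin ι a).2
  rw [encode, dif_pos ⟨Nat.le_add_right _ _, hpos⟩]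
  simp only [address, Nat.add_sub_cancel_left, Nat.mul_add_mod, Nat.mod_eq_of_lt hlt, Fin.eta,
    Equiv.symm_apply_apply, Nat.mul_add_div hpos, Nat.div_eq_of_lt hlt, add_zero]

theorem exists_address {x : ℕ} (h : inputLength n m ≤ x) (hpos : 0 < Fintype.card ι) :
    ∃ (a : ι) (y : ℕ), x = address n m a y := by
  refine ⟨(Fintype.equivFin ι).symm ⟨(x - inputLength n m) % Fintype.card ι,
    Nat.mod_lt _ hpos⟩, (x - inputLength n m) / Fintype.card ι, ?_⟩
  rw [address, Equiv.apply_symm_apply]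
  simp only [Nat.div_add_mod]
  omega

theorem encode_le {s : Store ι} {M : ℕ} (hs : ∀ a x, s a x ≤ M) (hM : (n + m + 1) ^ 2 ≤ M)
    (x : ℕ) : encode A B s x ≤ M := by
  rw [encode]
  split_ifs
  · exact hs _ _
  · exact (initMemory_le A B x).trans hM

theorem address_inj {a b : ι} {x y : ℕ} (h : address n m a x = address n m b y) :
    a = b ∧ x = y := by
  classical
  -- a store with a single mark tells the places apart
  have h1 := encode_address (0 : Matrix (Fin n) (Fin n) Bool) (0 : Matrix (Fin n) (Fin m) Bool)
    (fun c z => if c = a ∧ z = x then 1 else 0) a x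
  rw [h, encode_address] at h1
  simp only [and_self, if_true] at h1
  split_ifs at h1 with h2
  · exact ⟨h2.1.symm, h2.2.symm⟩

theorem encode_write [DecidableEq ι] (s : Store ι) (a : ι) (x v : ℕ) :
    encode A B (s.write a x v) = Function.update (encode A B s) (address n m a x) v := by
  have hpos : 0 < Fintype.card ι := Fintype.card_pos_iff.2 ⟨a⟩
  funext z
  rcases lt_or_ge z (inputLength n m) with h | h
  · rw [encode_of_lt A B _ h, Function.update_of_ne, encode_of_lt A B _ h]
    unfold address
    omega
  · obtain ⟨b, y, rfl⟩ := exists_address h hpos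
    rw [encode_address, Store.write]
    by_cases hab : b = a
    · subst hab
      rw [Function.update_self]
      by_cases hxy : y = x
      · subst hxy
        rw [Function.update_self, Function.update_self]
      · rw [Function.update_of_ne hxy, Function.update_of_ne, encode_address]
        exact fun h' => hxy (address_inj h').2
    · rw [Function.update_of_ne hab, Function.update_of_ne, encode_address]
      exact fun h' => hab (address_inj h').1

/-- The length of the input, computed from the dimensions in the cells `0` and `1`. -/
def ramInputLength : RamExpr :=
  .bin .add (.bin .add (.lit 2) (.bin .mul (.mem (.lit 0)) (.mem (.lit 0))))
    (.bin .mul (.mem (.lit 0)) (.mem (.lit 1)))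

/-- The address of a place of an array, computed by the machine. -/
noncomputable def ramAddress (a : ι) (e : RamExpr) : RamExpr :=
  .bin .add ramInputLength
    (.bin .add (.bin .mul (.lit (Fintype.card ι)) e) (.lit (Fintype.equivFin ι a)))

/-- The compilation of expressions. -/
noncomputable def Expr.toRam : Expr ι → RamExpr
  | lit c => .lit c
  | rows => .mem (.lit 0)
  | cols => .mem (.lit 1)
  | entry e => .mem (.bin .mod e.toRam ramInputLength)
  | arr a e => .mem (ramAddress a e.toRam)
  | bin o e f => .bin o e.toRam f.toRam

theorem encode_dims (s : Store ι) : encode A B s 0 = n ∧ encode A B s 1 = m := by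
  constructor
  · rw [encode_of_lt A B s (by unfold inputLength; omega)]
    rfl
  · rw [encode_of_lt A B s (by unfold inputLength; omega)]
    rfl

theorem eval_ramInputLength (s : Store ι) :
    ramInputLength.eval (encode A B s) = inputLength n m := by
  obtain ⟨h0, h1⟩ := encode_dims A B s
  simp only [ramInputLength, RamExpr.eval, ArithOp.eval, h0, h1, inputLength]

theorem eval_ramAddress (s : Store ι) (a : ι) (e : RamExpr) :
    (ramAddress a e).eval (encode A B s) = address n m a (e.eval (encode A B s)) := by
  have := eval_ramInputLength A B s
  simp only [ramAddress, RamExpr.eval, ArithOp.eval, this, address]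

theorem Expr.eval_toRam (s : Store ι) (e : Expr ι) :
    e.toRam.eval (encode A B s) = e.eval A B s := by
  induction e with
  | lit c => rfl
  | rows => exact (encode_dims A B s).1
  | cols => exact (encode_dims A B s).2
  | entry e ih =>
    simp only [Expr.toRam, RamExpr.eval, ArithOp.eval, ih, eval_ramInputLength, Expr.eval]
    exact encode_of_lt A B s (Nat.mod_lt _ (by unfold inputLength; omega))
  | arr a e ih =>
    rw [Expr.toRam, RamExpr.eval, eval_ramAddress, ih, encode_address, Expr.eval]
  | bin o e f ihe ihf => rw [Expr.toRam, RamExpr.eval, ihe, ihf, Expr.eval]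

/-- The value of `v` exceeds the values in memory by at most `1`. This keeps the numbers short. -/
def Expr.Tame (v : Expr ι) : Prop :=
  ∀ {n m : ℕ} (A : Matrix (Fin n) (Fin n) Bool) (B : Matrix (Fin n) (Fin m) Bool) (s : Store ι)
    (M : ℕ), (∀ x, encode A B s x ≤ M) → (n + m + 1) ^ 2 ≤ M → v.eval A B s ≤ M + 1

/-- Only tame values are written, and the bodies of loops do not write into the loop variable. -/
def Stmt.Valid : Stmt ι → Prop
  | set _ _ v => v.Tame
  | seq P Q => P.Valid ∧ Q.Valid
  | ite _ P Q => P.Valid ∧ Q.Valid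
  | loop a _ P => P.Valid ∧ P.Avoids a

/-- Every valid program is executed by the machine. The cost is the number of steps times the square
of the bit length of the numbers, and each step increases the numbers by at most `1`. -/
theorem Stmt.exists_ramProg [DecidableEq ι] (P : Stmt ι) (hP : P.Valid) :
    ∃ (Q : RamProg) (κ : ℕ), ∀ {n m : ℕ} (A : Matrix (Fin n) (Fin n) Bool)
      (B : Matrix (Fin n) (Fin m) Bool) (s : Store ι) (M w : ℕ), (∀ x, encode A B s x ≤ M) →
      (n + m + 1) ^ 2 ≤ M → (M + P.time n m).size ≤ w →
      (∃ t ≤ κ * P.time n m * w ^ 2, RunsIn Q (encode A B s) t (encode A B (P.run A B s))) ∧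
        ∀ x, encode A B (P.run A B s) x ≤ M + P.time n m := by
  have hsize : ∀ {n m T M w : ℕ}, (n + m + 1) ^ 2 ≤ M → (M + T).size ≤ w → 1 ≤ w := by
    intro n m T M w h1 h2
    refine le_trans (Nat.size_pos.2 ?_) h2
    have : 1 ≤ (n + m + 1) ^ 2 := Nat.one_le_pow _ _ (by omega)
    omega
  have hupd : ∀ (σ : ℕ → ℕ) (M x v : ℕ), (∀ x, σ x ≤ M) → v ≤ M + 1 →
      ∀ y, Function.update σ x v y ≤ M + 1 := by
    intro σ M x v hσ hv y
    rcases eq_or_ne y x with rfl | h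
    · rwa [Function.update_self]
    · rw [Function.update_of_ne h]
      exact (hσ y).trans (Nat.le_succ M)
  induction P with
  | set a e v =>
    obtain ⟨κ, hκ⟩ := (ramAddress a e.toRam).exists_cost_le
    obtain ⟨μ, hμ⟩ := v.toRam.exists_cost_le
    refine ⟨.store (ramAddress a e.toRam) v.toRam, 2 * κ + 2 * μ + 1, ?_⟩
    intro n m A B s M w hs hM hw
    have hw1 := hsize hM hw
    have hsw : ∀ x, (encode A B s x).size ≤ w := fun x =>
      (Nat.size_le_size ((hs x).trans (Nat.le_add_right _ _))).trans hw
    obtain ⟨h1, h2⟩ := hκ _ w hw1 hsw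
    obtain ⟨h3, h4⟩ := hμ _ w hw1 hsw
    have hrun : encode A B ((Stmt.set a e v).run A B s) = Function.update (encode A B s)
        ((ramAddress a e.toRam).eval (encode A B s)) (v.toRam.eval (encode A B s)) := by
      rw [run, encode_write, eval_ramAddress, Expr.eval_toRam, Expr.eval_toRam]
    rw [hrun]
    refine ⟨⟨_, ?_, .store _ _ _⟩, hupd _ _ _ _ hs ?_⟩
    · have h5 : w ≤ w ^ 2 := Nat.le_self_pow two_ne_zero w
      have h6 : κ * w ≤ κ * w ^ 2 := Nat.mul_le_mul_left _ h5
      have h7 : μ * w ≤ μ * w ^ 2 := Nat.mul_le_mul_left _ h5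
      simp only [time]
      linarith
    · rw [Expr.eval_toRam]
      exact hP A B s M hs hM
  | seq P Q ihP ihQ =>
    obtain ⟨P', κ, hκ⟩ := ihP hP.1
    obtain ⟨Q', μ, hμ⟩ := ihQ hP.2
    refine ⟨.seq P' Q', κ + μ, ?_⟩
    intro n m A B s M w hs hM hw
    simp only [time] at hw ⊢
    obtain ⟨⟨t, ht, h1⟩, h2⟩ := hκ A B s M w hs hM
      ((Nat.size_le_size (by omega)).trans hw)
    obtain ⟨⟨t', ht', h3⟩, h4⟩ := hμ A B (P.run A B s) (M + P.time n m) w h2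
      (hM.trans (Nat.le_add_right _ _)) ((Nat.size_le_size (by omega)).trans hw)
    refine ⟨⟨t + t', ?_, .seq h1 h3⟩, fun x => (h4 x).trans (by omega)⟩
    have h5 : κ * P.time n m * w ^ 2 ≤ κ * (P.time n m + Q.time n m) * w ^ 2 := by gcongr; omega
    have h6 : μ * Q.time n m * w ^ 2 ≤ μ * (P.time n m + Q.time n m) * w ^ 2 := by gcongr; omega
    calc t + t' ≤ _ := Nat.add_le_add (ht.trans h5) (ht'.trans h6)
      _ = _ := by ring
  | ite b P Q ihP ihQ =>
    obtain ⟨P', κ, hκ⟩ := ihP hP.1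
    obtain ⟨Q', μ, hμ⟩ := ihQ hP.2
    obtain ⟨ν, hν⟩ := b.toRam.exists_cost_le
    refine ⟨.ite b.toRam P' Q', κ + μ + ν + 1, ?_⟩
    intro n m A B s M w hs hM hw
    simp only [time] at hw ⊢
    have hw1 := hsize hM hw
    have hsw : ∀ x, (encode A B s x).size ≤ w := fun x =>
      (Nat.size_le_size ((hs x).trans (Nat.le_add_right _ _))).trans hw
    obtain ⟨h0, -⟩ := hν _ w hw1 hsw
    have hw2 : 1 ≤ w ^ 2 := Nat.one_le_pow _ _ hw1
    have hcost : ∀ {t ρ T}, t ≤ ρ * T * w ^ 2 → ρ ≤ κ + μ → T ≤ P.time n m + Q.time n m →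
        b.toRam.cost (encode A B s) + 1 + t ≤
          (κ + μ + ν + 1) * (1 + P.time n m + Q.time n m) * w ^ 2 := by
      intro t ρ T ht hρ hT
      have h1 : ρ * T ≤ (κ + μ) * (P.time n m + Q.time n m) := Nat.mul_le_mul hρ hT
      have h2 := Nat.mul_le_mul_right (w ^ 2) h1
      have h3 : ν * w ^ 2 + 1 + (κ + μ) * (P.time n m + Q.time n m) * w ^ 2 ≤
          (κ + μ + ν + 1) * (1 + P.time n m + Q.time n m) * w ^ 2 := by
        have h4 : (κ + μ + ν + 1) * (1 + P.time n m + Q.time n m) * w ^ 2 =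
            ν * w ^ 2 + w ^ 2 + (κ + μ) * (P.time n m + Q.time n m) * w ^ 2 +
            ((κ + μ) + (ν + 1) * (P.time n m + Q.time n m)) * w ^ 2 := by ring
        rw [h4]
        have : 0 ≤ ((κ + μ) + (ν + 1) * (P.time n m + Q.time n m)) * w ^ 2 := Nat.zero_le _
        omega
      omega
    rw [run]
    by_cases hb : b.eval A B s ≠ 0
    · rw [if_pos hb]
      obtain ⟨⟨t, ht, h1⟩, h2⟩ := hκ A B s M w hs hM ((Nat.size_le_size (by omega)).trans hw)
      refine ⟨⟨_, hcost ht (by omega) (by omega), .ite_true ?_ h1⟩,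
        fun x => (h2 x).trans (by omega)⟩
      rwa [Expr.eval_toRam]
    · rw [if_neg hb]
      obtain ⟨⟨t, ht, h1⟩, h2⟩ := hμ A B s M w hs hM ((Nat.size_le_size (by omega)).trans hw)
      refine ⟨⟨_, hcost ht (by omega) (by omega), .ite_false ?_ h1⟩,
        fun x => (h2 x).trans (by omega)⟩
      rw [Expr.eval_toRam]
      exact not_not.1 hb
  | loop a N P ih =>
    obtain ⟨P', κ, hκ⟩ := ih hP.1
    obtain ⟨α, hα⟩ := (ramAddress a (.lit 0)).exists_cost_le
    let test : Expr ι := .bin .sub N.toExpr (.arr a (.lit 0))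
    let next : Expr ι := .bin .add (.arr a (.lit 0)) (.lit 1)
    obtain ⟨β, hβ⟩ := test.toRam.exists_cost_le
    obtain ⟨γ, hγ⟩ := next.toRam.exists_cost_le
    refine ⟨.seq (.store (ramAddress a (.lit 0)) (.lit 0))
      (.loop test.toRam (.seq P' (.store (ramAddress a (.lit 0)) next.toRam))),
      κ + 2 * α + β + 2 * γ + 5, ?_⟩
    intro n m A B s M w hs hM hw
    simp only [time] at hw ⊢
    set T := P.time n m with hT
    set L := N.val n m with hL
    have hw1 := hsize hM hw
    have hw2 : w ≤ w ^ 2 := Nat.le_self_pow two_ne_zero w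
    have hw3 : 1 ≤ w ^ 2 := Nat.one_le_pow _ _ hw1
    have hstore : ∀ (σ : Store ι) (v : Expr ι) (ν : ℕ),
        (v.toRam.cost (encode A B σ) ≤ ν * w ^ 2 ∧
          (v.toRam.eval (encode A B σ)).size ≤ ν * w) → (∀ x, (encode A B σ x).size ≤ w) →
        ∃ t ≤ (2 * α + 2 * ν + 1) * w ^ 2, RunsIn (.store (ramAddress a (.lit 0)) v.toRam)
          (encode A B σ) t (encode A B (σ.write a 0 (v.eval A B σ))) := by
      intro σ v ν hv hσ
      obtain ⟨h1, h2⟩ := hα _ w hw1 hσ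
      have h3 : ν * w ≤ ν * w ^ 2 := Nat.mul_le_mul_left _ hw2
      have h4 : α * w ≤ α * w ^ 2 := Nat.mul_le_mul_left _ hw2
      have hrun := RunsIn.store (ramAddress a (.lit 0)) v.toRam (encode A B σ)
      have hE : encode A B (σ.write a 0 (v.eval A B σ)) = Function.update (encode A B σ)
          ((ramAddress a (.lit 0)).eval (encode A B σ)) (v.toRam.eval (encode A B σ)) := by
        rw [encode_write, Expr.eval_toRam, eval_ramAddress]
        rfl
      rw [hE]
      refine ⟨_, ?_, hrun⟩
      linarith [hv.1, hv.2]
    let it : ℕ → Store ι := fun i =>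
      runUpTo (fun i t => P.run A B (t.write a 0 i)) s i
    -- the memory after `i` rounds
    have hmem : ∀ i ≤ L, ∀ x, encode A B ((it i).write a 0 i) x ≤ M + 1 + i * (T + 1) := by
      intro i
      induction i with
      | zero =>
        intro _ x
        rw [encode_write, Nat.zero_mul]
        exact hupd _ _ _ _ hs (Nat.zero_le _) x
      | succ i hi =>
        intro hiL x
        have hle : (i + 1) * (T + 1) ≤ L * (T + 1) := Nat.mul_le_mul_right _ hiL
        have hexp : (i + 1) * (T + 1) = i * (T + 1) + (T + 1) := by ring
        obtain ⟨-, h2⟩ := hκ A B ((it i).write a 0 i) _ w (hi (by omega)) (by omega)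
          ((Nat.size_le_size (by omega)).trans hw)
        change ∀ x, encode A B (it (i + 1)) x ≤ _ at h2
        rw [encode_write, hexp, ← Nat.add_assoc, ← Nat.add_assoc]
        refine hupd _ _ _ _ (fun x => (h2 x).trans (by omega)) ?_ x
        have : i * 1 ≤ i * (T + 1) := Nat.mul_le_mul_left _ (by omega)
        omega
    have hmemw : ∀ i ≤ L, ∀ x, (encode A B ((it i).write a 0 i) x).size ≤ w := by
      intro i hi x
      have hle : i * (T + 1) ≤ L * (T + 1) := Nat.mul_le_mul_right _ hi
      exact (Nat.size_le_size ((hmem i hi x).trans (by omega))).trans hw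
    have hcnt : ∀ i, ((it (i + 1)) a 0) = i := by
      intro i
      change P.run A B ((it i).write a 0 i) a 0 = i
      rw [run_of_avoids A B P hP.2, Store.write_self]
    have htest : ∀ i, test.eval A B ((it i).write a 0 i) = L - i := by
      intro i
      change N.toExpr.eval A B _ - (it i).write a 0 i a 0 = _
      rw [Bound.eval_toExpr, Store.write_self]
    have hloop : ∀ r i, i + r = L → ∃ t ≤
        (r * ((κ + 2 * α + β + 2 * γ + 2) * (T + 1)) + β + 1) * w ^ 2,
        RunsIn (.loop test.toRam (.seq P' (.store (ramAddress a (.lit 0)) next.toRam)))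
          (encode A B ((it i).write a 0 i)) t (encode A B ((it L).write a 0 L)) := by
      intro r
      induction r with
      | zero =>
        intro i hi
        rw [Nat.add_zero] at hi
        subst hi
        refine ⟨_, ?_, .loop_done ?_⟩
        · have := (hβ _ w hw1 (hmemw _ le_rfl)).1
          linarith
        · rw [Expr.eval_toRam, htest, Nat.sub_self]
      | succ r ihr =>
        intro i hi
        have hiL : i + 1 ≤ L := by omega
        have hle : (i + 1) * (T + 1) ≤ L * (T + 1) := Nat.mul_le_mul_right _ hiL
        have hexp : (i + 1) * (T + 1) = i * (T + 1) + (T + 1) := by ring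
        obtain ⟨⟨t₁, ht₁, h1⟩, h2⟩ := hκ A B ((it i).write a 0 i) _ w (hmem i (by omega))
          (by omega) ((Nat.size_le_size (by omega)).trans hw)
        change RunsIn P' _ t₁ (encode A B (it (i + 1))) at h1
        change ∀ x, encode A B (it (i + 1)) x ≤ _ at h2
        have hsz : ∀ x, (encode A B (it (i + 1)) x).size ≤ w := fun x =>
          (Nat.size_le_size ((h2 x).trans (by omega))).trans hw
        obtain ⟨t₂, ht₂, h3⟩ := hstore (it (i + 1)) next γ (hγ _ w hw1 hsz) hsz
        have hnext : next.eval A B (it (i + 1)) = i + 1 := by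
          change it (i + 1) a 0 + 1 = i + 1
          rw [hcnt]
        rw [hnext] at h3
        obtain ⟨t₃, ht₃, h4⟩ := ihr (i + 1) (by omega)
        refine ⟨_, ?_, .loop_step ?_ (.seq h1 h3) h4⟩
        · have h5 := (hβ _ w hw1 (hmemw i (by omega))).1
          have h6 : (r + 1) * ((κ + 2 * α + β + 2 * γ + 2) * (T + 1)) + β + 1 =
              κ * T + (2 * α + 2 * γ + 1) + β + 1 +
              (r * ((κ + 2 * α + β + 2 * γ + 2) * (T + 1)) + β + 1) +
              (κ + (2 * α + β + 2 * γ + 2) * T) := by ring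
          rw [h6]
          have h7 : 0 ≤ (κ + (2 * α + β + 2 * γ + 2) * T) * w ^ 2 := Nat.zero_le _
          linarith
        · rw [Expr.eval_toRam, htest]
          omega
    have hs0 : ∀ x, (encode A B s x).size ≤ w := fun x =>
      (Nat.size_le_size ((hs x).trans (by omega))).trans hw
    obtain ⟨t₁, ht₁, h1⟩ := hstore s (.lit 0) 1 (by
      refine ⟨?_, ?_⟩
      · change 1 + Nat.size 0 ≤ _
        rw [Nat.size_zero]
        omega
      · change Nat.size 0 ≤ _
        rw [Nat.size_zero]
        exact Nat.zero_le _) hs0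
    obtain ⟨t₂, ht₂, h2⟩ := hloop L 0 (Nat.zero_add L)
    refine ⟨⟨t₁ + t₂, ?_, .seq h1 h2⟩, fun x => (hmem L le_rfl x).trans (by omega)⟩
    have h3 : (κ + 2 * α + β + 2 * γ + 5) * (2 + L * (T + 1)) =
        (2 * α + 2 * 1 + 1) + (L * ((κ + 2 * α + β + 2 * γ + 2) * (T + 1)) + β + 1) +
        (2 * κ + 2 * α + β + 4 * γ + 6 + 3 * (L * (T + 1))) := by ring
    rw [h3]
    have h4 : 0 ≤ (2 * κ + 2 * α + β + 4 * γ + 6 + 3 * (L * (T + 1))) * w ^ 2 := Nat.zero_le _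
    linarith

end Encode

end Language

end Compiler


/-! ### Augmenting paths -/

section Augment

variable {N : ℕ → Finset ℕ} {R root : ℕ} {S : Set ℕ}

/-- The array `mate` is a matching of the left vertices in `S` into the right vertices below `R`:
`mate w = v + 1` when `w` is matched to `v`, and `mate w = 0` when `w` is free. -/
structure IsMatchingOf (N : ℕ → Finset ℕ) (R : ℕ) (S : Set ℕ) (mate : ℕ → ℕ) : Prop where
  valid : ∀ w < R, mate w ≠ 0 → mate w - 1 ∈ S ∧ w ∈ N (mate w - 1)
  inj : ∀ w < R, ∀ w' < R, mate w ≠ 0 → mate w = mate w' → w = w'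
  cover : ∀ c ∈ S, ∃ w < R, mate w = c + 1

theorem IsMatchingOf.matchable {mate : ℕ → ℕ} (h : IsMatchingOf N R S mate) :
    Matchable N S := by
  choose! φ hφ hmate using h.cover
  refine ⟨φ, fun a ha b hb hab => ?_, fun a ha => ?_⟩
  · have := hmate a ha
    rw [hab, hmate b hb] at this
    omega
  · have := (h.valid (φ a) (hφ a ha) (by rw [hmate a ha]; omega)).2
    rwa [hmate a ha, Nat.add_sub_cancel] at this

/-- Rematch a left vertex from `w'` to the free vertex `w`. -/
theorem IsMatchingOf.rematch {mate : ℕ → ℕ} {w w' v : ℕ}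
    (h : IsMatchingOf N R S (Function.update mate w 0)) (hw : w < R) (hw' : w' < R)
    (hne : w' ≠ w) (hv : mate w' = v + 1) (hadj : w ∈ N v) :
    IsMatchingOf N R S (Function.update (Function.update mate w (v + 1)) w' 0) := by
  have hval : ∀ z, z ≠ w → z ≠ w' →
      Function.update (Function.update mate w (v + 1)) w' 0 z = Function.update mate w 0 z := by
    intro z h1 h2
    simp [h1, h2]
  have hvalw : Function.update (Function.update mate w (v + 1)) w' 0 w = v + 1 := by
    simp [hne.symm]
  have hvalw' : Function.update (Function.update mate w (v + 1)) w' 0 w' = 0 := by simp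
  have hold : Function.update mate w 0 w' = v + 1 := by simp [hne, hv]
  have key : ∀ z < R, z ≠ w → z ≠ w' → Function.update mate w 0 z ≠ v + 1 := by
    intro z hz h1 h2 h3
    exact h2 (h.inj z hz w' hw' (by omega) (h3.trans hold.symm))
  refine ⟨?_, ?_, ?_⟩
  · intro z hz hz0
    by_cases h2 : z = w'
    · rw [h2] at hz0
      exact absurd hvalw' hz0
    by_cases h1 : z = w
    · rw [h1, hvalw, Nat.add_sub_cancel]
      have := (h.valid w' hw' (by rw [hold]; omega)).1
      rw [hold, Nat.add_sub_cancel] at this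
      exact ⟨this, hadj⟩
    · rw [hval z h1 h2] at hz0 ⊢
      exact h.valid z hz hz0
  · intro z hz z' hz' hz0 heq
    by_cases h2 : z = w'
    · rw [h2] at hz0
      exact absurd hvalw' hz0
    by_cases h2' : z' = w'
    · rw [heq, h2'] at hz0
      exact absurd hvalw' hz0
    by_cases h1 : z = w <;> by_cases h1' : z' = w
    · rw [h1, h1']
    · rw [h1, hvalw, hval z' h1' h2'] at heq
      exact absurd heq.symm (key z' hz' h1' h2')
    · rw [h1', hvalw, hval z h1 h2] at heq
      exact absurd heq (key z hz h1 h2)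
    · rw [hval z h1 h2] at hz0 heq
      rw [hval z' h1' h2'] at heq
      exact h.inj z hz z' hz' hz0 heq
  · intro c hc
    obtain ⟨z, hz, hzc⟩ := h.cover c hc
    have h1 : z ≠ w := by
      rintro rfl
      simp at hzc
    by_cases h2 : z = w'
    · refine ⟨w, hw, ?_⟩
      rw [hvalw, ← hzc, h2, hold]
    · exact ⟨z, hz, by rw [hval z h1 h2, hzc]⟩

theorem IsMatchingOf.insert {mate : ℕ → ℕ} {w : ℕ}
    (h : IsMatchingOf N R S (Function.update mate w 0)) (hw : w < R) (hroot : root ∉ S)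
    (hadj : w ∈ N root) : IsMatchingOf N R (insert root S) (Function.update mate w (root + 1)) := by
  have hval : ∀ z, z ≠ w →
      Function.update mate w (root + 1) z = Function.update mate w 0 z := by
    intro z h1
    simp [h1]
  have key : ∀ z < R, Function.update mate w 0 z ≠ root + 1 := by
    intro z hz h3
    have := (h.valid z hz (by omega)).1
    rw [h3, Nat.add_sub_cancel] at this
    exact hroot this
  refine ⟨?_, ?_, ?_⟩
  · intro z hz hz0
    by_cases h1 : z = w
    · rw [h1, Function.update_self, Nat.add_sub_cancel]
      exact ⟨Set.mem_insert _ _, hadj⟩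
    · rw [hval z h1] at hz0 ⊢
      exact ⟨Set.mem_insert_of_mem _ (h.valid z hz hz0).1, (h.valid z hz hz0).2⟩
  · intro z hz z' hz' hz0 heq
    by_cases h1 : z = w <;> by_cases h1' : z' = w
    · rw [h1, h1']
    · rw [h1, Function.update_self, hval z' h1'] at heq
      exact absurd heq.symm (key z' hz')
    · rw [h1', Function.update_self, hval z h1] at heq
      exact absurd heq (key z hz)
    · rw [hval z h1] at hz0 heq
      rw [hval z' h1'] at heq
      exact h.inj z hz z' hz' hz0 heq
  · rintro c (rfl | hc)
    · exact ⟨w, hw, Function.update_self _ _ _⟩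
    · obtain ⟨z, hz, hzc⟩ := h.cover c hc
      have h1 : z ≠ w := by
        rintro rfl
        simp at hzc
      exact ⟨z, hz, by rw [hval z h1, hzc]⟩

/-- The state of a breadth first search for an augmenting path. The entries `x < tail` of the queue
are left vertices, increased by `1`: the root for `x = 0`, and otherwise the vertex matched to the
right vertex `src x`. A right vertex `w` with `vis w ≠ 0` was reached from the entry `par w` of
the queue. If a free right vertex `w` was reached, then `found = w + 1` for one of them. -/
structure SearchState (N : ℕ → Finset ℕ) (R root : ℕ) (mate vis par queue src : ℕ → ℕ)
    (tail found : ℕ) : Prop where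
  tail_pos : 0 < tail
  queue_zero : queue 0 = root + 1
  src_lt : ∀ x, 0 < x → x < tail → src x < R
  src_vis : ∀ x, 0 < x → x < tail → vis (src x) ≠ 0
  queue_eq : ∀ x, 0 < x → x < tail → queue x = mate (src x)
  mate_ne : ∀ x, 0 < x → x < tail → mate (src x) ≠ 0
  src_inj : ∀ x, 0 < x → x < tail → ∀ y, 0 < y → y < tail → src x = src y → x = y
  par_src : ∀ x, 0 < x → x < tail → par (src x) < x
  par_lt : ∀ w < R, vis w ≠ 0 → par w < tail
  par_adj : ∀ w < R, vis w ≠ 0 → w ∈ N (queue (par w) - 1)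
  vis_src : ∀ w < R, vis w ≠ 0 → mate w ≠ 0 → ∃ x, 0 < x ∧ x < tail ∧ src x = w
  vis_free : ∀ w < R, vis w ≠ 0 → mate w = 0 → found ≠ 0
  found_spec : found ≠ 0 → found - 1 < R ∧ vis (found - 1) ≠ 0 ∧ mate (found - 1) = 0

namespace SearchState

variable {mate vis par queue src : ℕ → ℕ} {tail found : ℕ}

theorem start (hvis : ∀ w < R, vis w = 0) (hq : queue 0 = root + 1) :
    SearchState N R root mate vis par queue src 1 0 where
  tail_pos := one_pos
  queue_zero := hq
  src_lt := by intro x h1 h2; omega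
  src_vis := by intro x h1 h2; omega
  queue_eq := by intro x h1 h2; omega
  mate_ne := by intro x h1 h2; omega
  src_inj := by intro x h1 h2; omega
  par_src := by intro x h1 h2; omega
  par_lt := fun w hw h => absurd (hvis w hw) h
  par_adj := fun w hw h => absurd (hvis w hw) h
  vis_src := fun w hw h => absurd (hvis w hw) h
  vis_free := fun w hw h => absurd (hvis w hw) h
  found_spec := fun h => absurd rfl h

/-- Visit a matched right vertex and append its mate to the queue. -/
theorem visit_matched (h : SearchState N R root mate vis par queue src tail found) {w x : ℕ}
    (hw : w < R) (hvis : vis w = 0) (hx : x < tail) (hadj : w ∈ N (queue x - 1))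
    (hmate : mate w ≠ 0) :
    SearchState N R root mate (Function.update vis w 1) (Function.update par w x)
      (Function.update queue tail (mate w)) (Function.update src tail w) (tail + 1) found := by
  have hsrc : ∀ y, 0 < y → y < tail → src y ≠ w := by
    intro y h1 h2 h3
    exact h.src_vis y h1 h2 (h3 ▸ hvis)
  have hS : ∀ y, y < tail → Function.update src tail w y = src y := fun y hy =>
    Function.update_of_ne hy.ne _ _
  have hQ : ∀ y, y < tail → Function.update queue tail (mate w) y = queue y := fun y hy =>
    Function.update_of_ne hy.ne _ _
  have hV : ∀ z, z ≠ w → Function.update vis w 1 z = vis z := fun z hz =>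
    Function.update_of_ne hz _ _
  have hP : ∀ z, z ≠ w → Function.update par w x z = par z := fun z hz =>
    Function.update_of_ne hz _ _
  have hcase : ∀ y, y < tail + 1 → y < tail ∨ y = tail := by intro y hy; omega
  refine ⟨Nat.succ_pos _, ?_, ?_, ?_, ?_, ?_, ?_, ?_, ?_, ?_, ?_, ?_, ?_⟩
  · rw [hQ 0 h.tail_pos, h.queue_zero]
  · intro y h1 h2
    rcases hcase y h2 with h2 | rfl
    · rw [hS y h2]
      exact h.src_lt y h1 h2
    · rwa [Function.update_self]
  · intro y h1 h2
    rcases hcase y h2 with h2 | rfl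
    · rw [hS y h2, hV _ (hsrc y h1 h2)]
      exact h.src_vis y h1 h2
    · rw [Function.update_self, Function.update_self]
      exact one_ne_zero
  · intro y h1 h2
    rcases hcase y h2 with h2 | rfl
    · rw [hS y h2, hQ y h2]
      exact h.queue_eq y h1 h2
    · rw [Function.update_self, Function.update_self]
  · intro y h1 h2
    rcases hcase y h2 with h2 | rfl
    · rw [hS y h2]
      exact h.mate_ne y h1 h2
    · rwa [Function.update_self]
  · intro y h1 h2 z h3 h4 heq
    rcases hcase y h2 with h2 | rfl <;> rcases hcase z h4 with h4 | rfl
    · rw [hS y h2, hS z h4] at heq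
      exact h.src_inj y h1 h2 z h3 h4 heq
    · rw [hS y h2, Function.update_self] at heq
      exact absurd heq (hsrc y h1 h2)
    · rw [hS z h4, Function.update_self] at heq
      exact absurd heq.symm (hsrc z h3 h4)
    · rfl
  · intro y h1 h2
    rcases hcase y h2 with h2 | rfl
    · rw [hS y h2, hP _ (hsrc y h1 h2)]
      exact h.par_src y h1 h2
    · rwa [Function.update_self, Function.update_self]
  · intro z hz hz0
    by_cases hzw : z = w
    · rw [hzw, Function.update_self]
      omega
    · rw [hV z hzw] at hz0
      rw [hP z hzw]
      exact (h.par_lt z hz hz0).trans (Nat.lt_succ_self _)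
  · intro z hz hz0
    by_cases hzw : z = w
    · rw [hzw, Function.update_self, hQ x hx]
      exact hadj
    · rw [hV z hzw] at hz0
      rw [hP z hzw, hQ _ (h.par_lt z hz hz0)]
      exact h.par_adj z hz hz0
  · intro z hz hz0 hz1
    by_cases hzw : z = w
    · exact ⟨tail, h.tail_pos, Nat.lt_succ_self _, by rw [Function.update_self, hzw]⟩
    · rw [hV z hzw] at hz0
      obtain ⟨y, h1, h2, h3⟩ := h.vis_src z hz hz0 hz1
      exact ⟨y, h1, by omega, by rw [hS y h2, h3]⟩
  · intro z hz hz0 hz1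
    have hzw : z ≠ w := by
      rintro rfl
      exact hmate hz1
    rw [hV z hzw] at hz0
    exact h.vis_free z hz hz0 hz1
  · intro hf
    obtain ⟨h1, h2, h3⟩ := h.found_spec hf
    refine ⟨h1, ?_, h3⟩
    rw [hV]
    · exact h2
    · intro h4
      exact h2 (h4 ▸ hvis)

/-- Visit a free right vertex. -/
theorem visit_free (h : SearchState N R root mate vis par queue src tail found) {w x : ℕ}
    (hw : w < R) (hvis : vis w = 0) (hx : x < tail) (hadj : w ∈ N (queue x - 1))
    (hmate : mate w = 0) :
    SearchState N R root mate (Function.update vis w 1) (Function.update par w x)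
      queue src tail (w + 1) := by
  have hsrc : ∀ y, 0 < y → y < tail → src y ≠ w := by
    intro y h1 h2 h3
    exact h.src_vis y h1 h2 (h3 ▸ hvis)
  have hV : ∀ z, z ≠ w → Function.update vis w 1 z = vis z := fun z hz =>
    Function.update_of_ne hz _ _
  have hP : ∀ z, z ≠ w → Function.update par w x z = par z := fun z hz =>
    Function.update_of_ne hz _ _
  refine ⟨h.tail_pos, h.queue_zero, h.src_lt, ?_, h.queue_eq, h.mate_ne, h.src_inj,
    ?_, ?_, ?_, ?_, fun _ _ _ _ => Nat.succ_ne_zero w, ?_⟩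
  · intro y h1 h2
    rw [hV _ (hsrc y h1 h2)]
    exact h.src_vis y h1 h2
  · intro y h1 h2
    rw [hP _ (hsrc y h1 h2)]
    exact h.par_src y h1 h2
  · intro z hz hz0
    by_cases hzw : z = w
    · rwa [hzw, Function.update_self]
    · rw [hV z hzw] at hz0
      rw [hP z hzw]
      exact h.par_lt z hz hz0
  · intro z hz hz0
    by_cases hzw : z = w
    · rwa [hzw, Function.update_self]
    · rw [hV z hzw] at hz0
      rw [hP z hzw]
      exact h.par_adj z hz hz0
  · intro z hz hz0 hz1
    have hzw : z ≠ w := by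
      rintro rfl
      exact hz1 hmate
    rw [hV z hzw] at hz0
    exact h.vis_src z hz hz0 hz1
  · intro _
    rw [Nat.add_sub_cancel, Function.update_self]
    exact ⟨hw, one_ne_zero, hmate⟩

theorem tail_le (h : SearchState N R root mate vis par queue src tail found) : tail ≤ R + 1 := by
  have : (Finset.Ico 1 tail).card ≤ (Finset.range R).card := by
    refine Finset.card_le_card_of_injOn src (fun x hx => ?_) fun x hx y hy hxy => ?_
    · rw [Finset.coe_Ico, Set.mem_Ico] at hx
      exact Finset.mem_coe.2 (Finset.mem_range.2 (h.src_lt x hx.1 hx.2))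
    · rw [Finset.coe_Ico, Set.mem_Ico] at hx hy
      exact h.src_inj x hx.1 hx.2 y hy.1 hy.2 hxy
  rw [Nat.card_Ico, Finset.card_range] at this
  omega

theorem queue_mem (h : SearchState N R root mate vis par queue src tail found)
    (hM : IsMatchingOf N R S mate) {x : ℕ} (hx : x < tail) :
    queue x - 1 ∈ insert root S ∧ queue x = queue x - 1 + 1 := by
  rcases Nat.eq_zero_or_pos x with rfl | hx0
  · rw [h.queue_zero, Nat.add_sub_cancel]
    exact ⟨Set.mem_insert _ _, rfl⟩
  · rw [h.queue_eq x hx0 hx]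
    have := h.mate_ne x hx0 hx
    exact ⟨Set.mem_insert_of_mem _ (hM.valid _ (h.src_lt x hx0 hx) this).1, by omega⟩

/-- When the search ends without a free right vertex, the left vertices in the queue have fewer
neighbours than their number, by one. -/
theorem not_matchable (h : SearchState N R root mate vis par queue src tail 0)
    (hM : IsMatchingOf N R S mate) (hroot : root ∉ S)
    (hdone : ∀ x < tail, ∀ w ∈ N (queue x - 1), w < R ∧ vis w ≠ 0) :
    ¬ Matchable N (insert root S) := by
  rintro ⟨φ, hinj, hφ⟩
  have hq : ∀ x < tail, ∀ y < tail, queue x - 1 = queue y - 1 → x = y := by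
    have hwlog : ∀ y, 0 < y → y < tail → queue 0 - 1 ≠ queue y - 1 := by
      intro y hy0 hy heq
      have h1 := (hM.valid _ (h.src_lt y hy0 hy) (h.mate_ne y hy0 hy)).1
      rw [← h.queue_eq y hy0 hy, ← heq, h.queue_zero, Nat.add_sub_cancel] at h1
      exact hroot h1
    intro x hx y hy heq
    rcases Nat.eq_zero_or_pos x with rfl | hx0 <;> rcases Nat.eq_zero_or_pos y with rfl | hy0
    · rfl
    · exact absurd heq (hwlog y hy0 hy)
    · exact absurd heq.symm (hwlog x hx0 hx)
    · have h1 : queue x = queue y := by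
        rw [(h.queue_mem hM hx).2, heq, ← (h.queue_mem hM hy).2]
      rw [h.queue_eq x hx0 hx, h.queue_eq y hy0 hy] at h1
      exact h.src_inj x hx0 hx y hy0 hy
        (hM.inj _ (h.src_lt x hx0 hx) _ (h.src_lt y hy0 hy) (h.mate_ne x hx0 hx) h1)
  have hsub : (Finset.range tail).image (fun x => φ (queue x - 1)) ⊆
      (Finset.Ico 1 tail).image src := by
    intro w hw
    obtain ⟨x, hx, rfl⟩ := Finset.mem_image.1 hw
    have hx := Finset.mem_range.1 hx
    obtain ⟨h1, h2⟩ := hdone x hx _ (hφ _ (h.queue_mem hM hx).1)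
    have h3 : mate (φ (queue x - 1)) ≠ 0 := fun h4 => h.vis_free _ h1 h2 h4 rfl
    obtain ⟨y, hy0, hy, hyw⟩ := h.vis_src _ h1 h2 h3
    exact Finset.mem_image.2 ⟨y, Finset.mem_Ico.2 ⟨hy0, hy⟩, hyw⟩
  have hcard := (Finset.card_le_card hsub).trans Finset.card_image_le
  rw [Finset.card_image_of_injOn, Finset.card_range, Nat.card_Ico] at hcard
  · have := h.tail_pos
    omega
  · intro x hx y hy hxy
    have hx := Finset.mem_range.1 (Finset.mem_coe.1 hx)
    have hy := Finset.mem_range.1 (Finset.mem_coe.1 hy)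
    exact hq x hx y hy (hinj (h.queue_mem hM hx).1 (h.queue_mem hM hy).1 hxy)

end SearchState

/-- The state of the augmentation along the path that was found: `mate` is a matching except that
the right vertex `cur` is to be rematched, and the part of the path below the entry `x` of the queue
has not been changed yet. -/
structure AugmentState (N : ℕ → Finset ℕ) (R : ℕ) (S : Set ℕ) (par queue src mate : ℕ → ℕ)
    (cur x : ℕ) : Prop where
  matching : IsMatchingOf N R S (Function.update mate cur 0)
  cur_lt : cur < R
  par_lt : par cur < x
  adj : cur ∈ N (queue (par cur) - 1)
  ne : ∀ y, 0 < y → y < x → src y ≠ cur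
  eq : ∀ y, 0 < y → y < x → mate (src y) = queue y

section

variable {mate vis par queue src : ℕ → ℕ} {tail found : ℕ}

theorem SearchState.augmentState (h : SearchState N R root mate vis par queue src tail found)
    (hM : IsMatchingOf N R S mate) (hf : found ≠ 0) :
    AugmentState N R S par queue src mate (found - 1) tail := by
  obtain ⟨h1, h2, h3⟩ := h.found_spec hf
  refine ⟨?_, h1, h.par_lt _ h1 h2, h.par_adj _ h1 h2, ?_, ?_⟩
  · rwa [← h3, Function.update_eq_self]
  · intro y hy0 hy heq
    exact h.mate_ne y hy0 hy (heq ▸ h3)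
  · exact fun y hy0 hy => (h.queue_eq y hy0 hy).symm

theorem AugmentState.step (h : SearchState N R root mate vis par queue src tail found)
    {mate' : ℕ → ℕ} {cur x : ℕ} (ha : AugmentState N R S par queue src mate' cur x)
    (hx : x ≤ tail) (hpar : par cur ≠ 0) :
    AugmentState N R S par queue src (Function.update mate' cur (queue (par cur)))
      (src (par cur)) (par cur) := by
  have hpos := Nat.pos_of_ne_zero hpar
  have hlt := ha.par_lt.trans_le hx
  have hs := h.src_lt _ hpos hlt
  have hv := h.src_vis _ hpos hlt
  have hq : queue (par cur) = queue (par cur) - 1 + 1 := by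
    have := h.mate_ne _ hpos hlt
    rw [← h.queue_eq _ hpos hlt] at this
    omega
  refine ⟨?_, hs, h.par_src _ hpos hlt, h.par_adj _ hs hv, ?_, ?_⟩
  · rw [hq]
    exact ha.matching.rematch ha.cur_lt hs (ha.ne _ hpos ha.par_lt)
      ((ha.eq _ hpos ha.par_lt).trans hq) ha.adj
  · intro y hy0 hy heq
    have := h.src_inj y hy0 (hy.trans hlt) _ hpos hlt heq
    omega
  · intro y hy0 hy
    rw [Function.update_of_ne (ha.ne y hy0 (hy.trans ha.par_lt)),
      ha.eq y hy0 (hy.trans ha.par_lt)]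

theorem AugmentState.finish (h : SearchState N R root mate vis par queue src tail found)
    {mate' : ℕ → ℕ} {cur x : ℕ} (ha : AugmentState N R S par queue src mate' cur x)
    (hroot : root ∉ S) (hpar : par cur = 0) :
    IsMatchingOf N R (insert root S) (Function.update mate' cur (queue (par cur))) := by
  have hadj := ha.adj
  rw [hpar, h.queue_zero, Nat.add_sub_cancel] at hadj
  rw [hpar, h.queue_zero]
  exact ha.matching.insert ha.cur_lt hroot hadj

end

end Augment

/-! ### The greedy choice of input vertices -/

section Greedy

variable {n m : ℕ} {A : Matrix (Fin n) (Fin n) Bool} {B : Matrix (Fin n) (Fin m) Bool}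

/-- If the input vertices are taken greedily in the order of the layers, then the chosen ones of the
first `k` layers form a maximum linkable set, for each `k`. -/
theorem card_filter_eq_maxLinking (hn : 1 ≤ n) {I : Finset (Fin m × ℕ)} (hI : Linkable A B I)
    (hrej : ∀ u : Fin m × ℕ, u.2 < n → u ∉ I →
      ¬ Linkable A B (insert u (I.filter fun v => v.2 ≤ u.2))) {k : ℕ} (hk : k ≤ n) :
    (I.filter fun v => v.2 < k).card = maxLinking A B k := by
  have hsub : Linkable A B (I.filter fun v => v.2 < k) := hI.mono (Finset.filter_subset _ _)
  refine le_antisymm (hsub.card_le_maxLinking hn fun u hu => (Finset.mem_filter.1 hu).2) ?_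
  by_contra! hlt
  obtain ⟨J, hJ, hJk, hJc⟩ := exists_linkable_card_eq_maxLinking (A := A) (B := B) hn k
  obtain ⟨u, hu, huI, hins⟩ := hsub.augment hn hJ (by omega)
  have huk := hJk u hu
  refine hrej u (by omega) (fun h => huI (Finset.mem_filter.2 ⟨h, huk⟩)) (hins.mono ?_)
  refine Finset.insert_subset_insert _ fun v hv => ?_
  obtain ⟨h1, h2⟩ := Finset.mem_filter.1 hv
  exact Finset.mem_filter.2 ⟨h1, by omega⟩

theorem eq_muLow_of_greedy (hn : 1 ≤ n) {I : Finset (Fin m × ℕ)} (hI : Linkable A B I)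
    (hrej : ∀ u : Fin m × ℕ, u.2 < n → u ∉ I →
      ¬ Linkable A B (insert u (I.filter fun v => v.2 ≤ u.2)))
    {r : ℕ} (hr : 1 ≤ r ∧ r ≤ n) (hlt : ∀ u ∈ I, u.2 < r)
    (hmax : r = 1 ∨ ∃ u ∈ I, u.2 + 1 = r) : r = muLow A B := by
  obtain ⟨⟨⟨h1, h2⟩, h3⟩, hleast⟩ := isLeast_muLow A B hn
  have hall : ∀ k, r ≤ k → I.filter (fun v => v.2 < k) = I := fun k hk =>
    Finset.filter_true_of_mem fun u hu => (hlt u hu).trans_le hk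
  have hcard : I.card = maxLinking A B n := by
    rw [← card_filter_eq_maxLinking hn hI hrej le_rfl, hall n hr.2]
  refine le_antisymm ?_ (hleast ⟨hr, ?_⟩)
  · by_contra! hlt'
    obtain ⟨u, hu, hur⟩ : ∃ u ∈ I, u.2 + 1 = r := hmax.resolve_left (by omega)
    rw [← card_filter_eq_maxLinking hn hI hrej h2, ← hcard] at h3
    have := Finset.filter_card_eq h3 u hu
    omega
  · rw [← card_filter_eq_maxLinking hn hI hrej hr.2, hall r le_rfl, hcard]

end Greedy


/-! ### Numbering of the layered bipartite graph -/

section Codes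

variable {n m : ℕ} (A : Matrix (Fin n) (Fin n) Bool) (B : Matrix (Fin n) (Fin m) Bool)

theorem mul_add_lt_mul {a b p q : ℕ} (ha : a < p) (hb : b < q) : a * q + b < p * q := by
  calc a * q + b < a * q + q := by omega
    _ = (a + 1) * q := by ring
    _ ≤ p * q := Nat.mul_le_mul_right _ ha

theorem initMemory_state (i t : Fin n) :
    initMemory A B (2 + (i * n + t)) = (A i t).toNat := by
  have hlt : (i : ℕ) * n + t < n * n := mul_add_lt_mul i.2 t.2
  rw [initMemory, List.getD_append _ _ _ _ (by simp; omega),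
    List.getD_append_right _ _ _ _ (by simp), List.getD_eq_getElem _ _ (by simp; omega),
    List.getElem_ofFn]
  have h1 : Fin.divNat (m := n) (n := n) ⟨2 + (i * n + t) - [n, m].length, by simp; omega⟩ = i := by
    refine Fin.ext ?_
    rw [Fin.coe_divNat]
    simp only [List.length_cons, List.length_nil, Nat.zero_add, Nat.reduceAdd,
      Nat.add_sub_cancel_left]
    rw [Nat.mul_comm, Nat.mul_add_div (Fin.pos i), Nat.div_eq_of_lt t.2, Nat.add_zero]
  have h2 : Fin.modNat (m := n) (n := n) ⟨2 + (i * n + t) - [n, m].length, by simp; omega⟩ = t := by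
    refine Fin.ext ?_
    rw [Fin.coe_modNat]
    simp only [List.length_cons, List.length_nil, Nat.zero_add, Nat.reduceAdd,
      Nat.add_sub_cancel_left]
    rw [Nat.mul_comm, Nat.mul_add_mod, Nat.mod_eq_of_lt t.2]
  rw [h1, h2]

theorem initMemory_input (i : Fin n) (j : Fin m) :
    initMemory A B (2 + n * n + (i * m + j)) = (B i j).toNat := by
  have hlt : (i : ℕ) * m + j < n * m := mul_add_lt_mul i.2 j.2
  rw [initMemory, List.getD_append_right _ _ _ _ (by simp; omega),
    List.getD_eq_getElem _ _ (by simp; omega), List.getElem_ofFn]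
  have hval : 2 + n * n + (i * m + j) - ([n, m] ++ List.ofFn (fun q : Fin (n * n) =>
      (A q.divNat q.modNat).toNat)).length = i * m + j := by
    simp
    omega
  have h1 : ∀ h, Fin.divNat (m := n) (n := m) ⟨2 + n * n + (i * m + j) - ([n, m] ++
      List.ofFn (fun q : Fin (n * n) => (A q.divNat q.modNat).toNat)).length, h⟩ = i := by
    intro h
    refine Fin.ext ?_
    rw [Fin.coe_divNat]
    simp only [hval]
    rw [Nat.mul_comm, Nat.mul_add_div (Fin.pos j), Nat.div_eq_of_lt j.2, Nat.add_zero]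
  have h2 : ∀ h, Fin.modNat (m := n) (n := m) ⟨2 + n * n + (i * m + j) - ([n, m] ++
      List.ofFn (fun q : Fin (n * n) => (A q.divNat q.modNat).toNat)).length, h⟩ = j := by
    intro h
    refine Fin.ext ?_
    rw [Fin.coe_modNat]
    simp only [hval]
    rw [Nat.mul_comm, Nat.mul_add_mod, Nat.mod_eq_of_lt j.2]
  rw [h1, h2]

/-- The number of a tail. -/
def tailCode (v : LNode n m) : ℕ :=
  v.2 * (n + m) + Sum.elim (fun t : Fin n => (t : ℕ)) (fun j : Fin m => n + j) v.1

/-- The number of a head. -/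
def headCode (r : RNode n) : ℕ := r.2 * n + r.1

theorem tailCode_offset_lt (v : LNode n m) :
    Sum.elim (fun t : Fin n => (t : ℕ)) (fun j : Fin m => n + j) v.1 < n + m := by
  rcases v with ⟨t | j, k⟩
  · simp only [Sum.elim_inl]
    omega
  · simp only [Sum.elim_inr]
    omega

theorem tailCode_mod (v : LNode n m) : tailCode v % (n + m) =
    Sum.elim (fun t : Fin n => (t : ℕ)) (fun j : Fin m => n + j) v.1 := by
  rw [tailCode, Nat.mul_comm, Nat.mul_add_mod, Nat.mod_eq_of_lt (tailCode_offset_lt v)]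

theorem tailCode_div (v : LNode n m) : tailCode v / (n + m) = v.2 := by
  have h := tailCode_offset_lt v
  rw [tailCode, Nat.mul_comm, Nat.mul_add_div (by omega), Nat.div_eq_of_lt h, Nat.add_zero]

theorem tailCode_injective : Function.Injective (tailCode : LNode n m → ℕ) := by
  intro v w h
  have h1 : v.2 = w.2 := by rw [← tailCode_div v, h, tailCode_div]
  have h2 : Sum.elim (fun t : Fin n => (t : ℕ)) (fun j : Fin m => n + j) v.1 =
      Sum.elim (fun t : Fin n => (t : ℕ)) (fun j : Fin m => n + j) w.1 := by
    rw [← tailCode_mod v, h, tailCode_mod]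
  rcases v with ⟨t | j, k⟩ <;> rcases w with ⟨t' | j', k'⟩ <;>
    simp only [Sum.elim_inl, Sum.elim_inr] at h1 h2
  · rw [h1, Fin.ext h2]
  · omega
  · omega
  · rw [h1, Fin.ext (Nat.add_left_cancel h2)]

theorem headCode_injective : Function.Injective (headCode : RNode n → ℕ) := by
  rintro ⟨i, k⟩ ⟨i', k'⟩ h
  simp only [headCode] at h
  have hn : 0 < n := Fin.pos i
  have h1 : k = k' := by
    have h2 : (k * n + i) / n = (k' * n + i') / n := by rw [h]
    rwa [Nat.mul_comm, Nat.mul_add_div hn, Nat.div_eq_of_lt i.2, Nat.mul_comm k',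
      Nat.mul_add_div hn, Nat.div_eq_of_lt i'.2] at h2
  subst h1
  rw [Fin.ext (Nat.add_left_cancel h)]

/-- `1` if the tail with number `c` is joined to the head with the number `c / (n + m) * n + i`,
and `0` otherwise. For `i < n` this is the state `i` in the layer of the tail, and otherwise the
state `i - n` in the next layer. -/
def joined (c i : ℕ) : ℕ :=
  if c % (n + m) < n then
    if i < n then initMemory A B (2 + (i * n + c % (n + m)))
    else 1 - ((i - (n + c % (n + m))) + (n + c % (n + m) - i))
  else if i < n then initMemory A B (2 + n * n + (i * m + (c % (n + m) - n))) else 0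

/-- The numbers of the neighbours of the tail with number `c`. -/
def headCodes (c : ℕ) : Finset ℕ :=
  ((Finset.range (2 * n)).filter fun i => joined A B c i ≠ 0).image fun i => c / (n + m) * n + i

theorem mem_headCodes {c w : ℕ} : w ∈ headCodes A B c ↔
    ∃ i < 2 * n, joined A B c i ≠ 0 ∧ c / (n + m) * n + i = w := by
  simp [headCodes, and_assoc]

theorem headCodes_tailCode (v : LNode n m) :
    headCodes A B (tailCode v) = (heads A B v).image headCode := by
  ext w
  rw [mem_headCodes, Finset.mem_image]
  simp only [mem_heads, joined, tailCode_mod, tailCode_div]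
  have hA : ∀ (i t : Fin n), initMemory A B (2 + (i * n + t)) ≠ 0 ↔ A i t = true := by
    intro i t
    rw [initMemory_state]
    cases A i t <;> simp
  have hB : ∀ (i : Fin n) (j : Fin m),
      initMemory A B (2 + n * n + (i * m + j)) ≠ 0 ↔ B i j = true := by
    intro i j
    rw [initMemory_input]
    cases B i j <;> simp
  rcases v with ⟨t | j, k⟩
  · have ht := t.2
    simp only [Sum.elim_inl, ht, if_true, edge]
    constructor
    · rintro ⟨i, hi, hne, rfl⟩
      split_ifs at hne with h
      · exact ⟨(⟨i, h⟩, k), Or.inl ⟨rfl, (hA ⟨i, h⟩ t).1 hne⟩, rfl⟩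
      · refine ⟨(t, k + 1), Or.inr ⟨rfl, rfl⟩, ?_⟩
        have : i = n + t := by omega
        rw [headCode, this]
        ring
    · rintro ⟨⟨i, k'⟩, (⟨h1, h2⟩ | ⟨h1, h2⟩), rfl⟩
      · simp only at h1 h2
        subst h1
        refine ⟨i, by omega, ?_, rfl⟩
        rw [if_pos i.2]
        exact (hA i t).2 h2
      · simp only [Sum.inl.injEq] at h1 h2
        subst h1 h2
        refine ⟨n + t, by omega, ?_, ?_⟩
        · rw [if_neg (by omega)]
          simp
        · rw [headCode]
          ring
  · have hj : ¬ n + (j : ℕ) < n := by omega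
    simp only [Sum.elim_inr, hj, if_false, edge, Nat.add_sub_cancel_left, reduceCtorEq, and_false,
      or_false]
    constructor
    · rintro ⟨i, hi, hne, rfl⟩
      split_ifs at hne with h
      · exact ⟨(⟨i, h⟩, k), ⟨rfl, (hB ⟨i, h⟩ j).1 hne⟩, rfl⟩
      · exact absurd rfl hne
    · rintro ⟨⟨i, k'⟩, ⟨h1, h2⟩, rfl⟩
      simp only at h1 h2
      subst h1
      refine ⟨i, by omega, ?_, rfl⟩
      rw [if_pos i.2]
      exact (hB i j).2 h2

/-- The numbers of the states of the layers `1, …, n - 1` and of the input vertices in `I`. -/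
def tailCodes (n : ℕ) {m : ℕ} (I : Finset (Fin m × ℕ)) : Set ℕ :=
  {c | ∃ (t : Fin n) (k : ℕ), k + 1 < n ∧ c = tailCode ((.inl t, k) : LNode n m)} ∪
    {c | ∃ u ∈ I, c = tailCode (n := n) (inputTail u)}

theorem tailCodes_insert (I : Finset (Fin m × ℕ)) (u : Fin m × ℕ) :
    tailCodes n (insert u I) = insert (tailCode (n := n) (inputTail u)) (tailCodes n I) := by
  ext c
  simp only [tailCodes, Set.mem_union, Set.mem_ofPred_eq, Finset.mem_insert, Set.mem_insert_iff,
    exists_eq_or_imp]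
  exact or_left_comm

theorem notMem_tailCodes {I : Finset (Fin m × ℕ)} {u : Fin m × ℕ} (hu : u ∉ I) :
    tailCode (n := n) (inputTail u) ∉ tailCodes n I := by
  rintro (⟨t, k, -, h⟩ | ⟨v, hv, h⟩)
  · have := tailCode_injective h
    simp [inputTail] at this
  · exact hu (inputTail_injective (tailCode_injective h) ▸ hv)

variable {A B} in
theorem lt_of_mem_headCodes {I : Finset (Fin m × ℕ)} (hI : ∀ u ∈ I, u.2 < n) {c : ℕ}
    (hc : c ∈ tailCodes n I) {w : ℕ} (hw : w ∈ headCodes A B c) : w < n * n := by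
  rcases hc with ⟨t, k, hk, rfl⟩ | ⟨u, hu, rfl⟩
  · rw [headCodes_tailCode] at hw
    obtain ⟨r, hr, rfl⟩ := Finset.mem_image.1 hw
    refine mul_add_lt_mul ?_ r.1.2
    rcases (mem_heads A B).1 hr with h | h <;> have := h.1 <;> simp only at this <;> omega
  · rw [headCodes_tailCode] at hw
    obtain ⟨r, hr, rfl⟩ := Finset.mem_image.1 hw
    refine mul_add_lt_mul ?_ r.1.2
    have := hI u hu
    rcases (mem_heads A B).1 hr with h | h
    · have := h.1
      simp only [inputTail] at this
      omega
    · simp [inputTail] at h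

variable {A B} in
theorem Linkable.matchable_codes {I : Finset (Fin m × ℕ)} (h : Linkable A B I) :
    Matchable (headCodes A B) (tailCodes n I) := by
  obtain ⟨φ, hinj, hφ⟩ := h
  have hex : ∀ c ∈ tailCodes n I, ∃ v ∈ stateTails n m ∪
      (I.image inputTail : Finset (LNode n m)), tailCode v = c := by
    rintro c (⟨t, k, -, rfl⟩ | ⟨u, hu, rfl⟩)
    · exact ⟨_, Or.inl ⟨t, k, rfl⟩, rfl⟩
    · exact ⟨_, Or.inr (Finset.mem_coe.2 (Finset.mem_image_of_mem _ hu)), rfl⟩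
  have hex' : ∀ c, ∃ w, c ∈ tailCodes n I → ∃ v ∈ stateTails n m ∪
      (I.image inputTail : Finset (LNode n m)), tailCode v = c ∧ w = headCode (φ v) := by
    intro c
    by_cases hc : c ∈ tailCodes n I
    · obtain ⟨v, hv, h⟩ := hex c hc
      exact ⟨_, fun _ => ⟨v, hv, h, rfl⟩⟩
    · exact ⟨0, fun h => absurd h hc⟩
  choose ψ hψ using hex'
  refine ⟨ψ, fun c hc d hd hcd => ?_, fun c hc => ?_⟩
  · obtain ⟨v, hv, rfl, h1⟩ := hψ c hc
    obtain ⟨w, hw, rfl, h2⟩ := hψ d hd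
    rw [h1, h2] at hcd
    rw [hinj hv hw (headCode_injective hcd)]
  · obtain ⟨v, hv, rfl, h1⟩ := hψ c hc
    rw [h1, headCodes_tailCode]
    exact Finset.mem_image_of_mem _ (hφ v hv)

variable {A B} in
/-- The states that lie beyond the first `n` layers can be matched to themselves. -/
theorem linkable_of_matchable_codes (hn : 0 < n) {I : Finset (Fin m × ℕ)} (hI : ∀ u ∈ I, u.2 < n)
    (h : Matchable (headCodes A B) (tailCodes n I)) : Linkable A B I := by
  obtain ⟨φ, hinj, hφ⟩ := h
  have hex : ∀ v ∈ stateTails n m ∪ (I.image inputTail : Finset (LNode n m)), ∃ r ∈ heads A B v,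
      (tailCode v ∈ tailCodes n I ∧ headCode r = φ (tailCode v) ∧ r.2 < n) ∨
        (n ≤ r.2 ∧ v = (.inl r.1, r.2 - 1)) := by
    have hin : ∀ v : LNode n m, tailCode v ∈ tailCodes n I → ∃ r ∈ heads A B v,
        (tailCode v ∈ tailCodes n I ∧ headCode r = φ (tailCode v) ∧ r.2 < n) ∨
          (n ≤ r.2 ∧ v = (.inl r.1, r.2 - 1)) := by
      intro v hv
      have h1 := hφ _ hv
      have h2 := lt_of_mem_headCodes hI hv h1
      rw [headCodes_tailCode] at h1
      obtain ⟨r, hr, h3⟩ := Finset.mem_image.1 h1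
      refine ⟨r, hr, Or.inl ⟨hv, h3, ?_⟩⟩
      rw [← h3, headCode] at h2
      by_contra! h4
      have := Nat.mul_le_mul_right n h4
      omega
    rintro v (⟨t, k, rfl⟩ | hv)
    · by_cases hk : k + 1 < n
      · exact hin _ (Or.inl ⟨t, k, hk, rfl⟩)
      · refine ⟨(t, k + 1), (mem_heads A B).2 (Or.inr ⟨rfl, rfl⟩), Or.inr ⟨?_, rfl⟩⟩
        simp only
        omega
    · obtain ⟨u, hu, rfl⟩ := Finset.mem_image.1 (Finset.mem_coe.1 hv)
      exact hin _ (Or.inr ⟨u, hu, rfl⟩)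
  have : Nonempty (RNode n) := ⟨(⟨0, hn⟩, 0)⟩
  choose! ψ hmem hψ using hex
  refine ⟨ψ, fun v hv w hw hvw => ?_, hmem⟩
  rcases hψ v hv with ⟨h1, h2, h3⟩ | ⟨h1, h2⟩ <;> rcases hψ w hw with ⟨h4, h5, h6⟩ | ⟨h4, h5⟩
  · rw [hvw, h5] at h2
    exact (tailCode_injective (hinj h4 h1 h2)).symm
  · rw [hvw] at h3
    omega
  · rw [hvw] at h1
    omega
  · rw [h2, h5, hvw]

end Codes


/-! ### The program for the least number of layers -/

section Program

theorem Store.write_same {ι : Type} [DecidableEq ι] (s : Store ι) (a : ι) (x v : ℕ) :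
    s.write a x v a = Function.update (s a) x v :=
  Function.update_self _ _ _

theorem Store.write_ne {ι : Type} [DecidableEq ι] (s : Store ι) {a b : ι} (h : b ≠ a) (x v : ℕ) :
    s.write a x v b = s b :=
  Function.update_of_ne h _ _

/-- The arrays and variables of the program. `mate`, `vis`, `par`, `queue`, `src`, `tail`, `found`
hold the state of a search as in `SearchState`, and `cur` is the current vertex of an augmentation
as in `AugmentState`. The variables `layer` and `inp` run through the input vertices, `head` through
the queue, `nb` through the neighbours and `cell` through other indices. `code` is the number of a
tail, `tgt` the number of a head, `bit` tells whether they are joined, `act` whether the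
augmentation is still going on, and `res` is the result. -/
inductive Reg where
  | mate | vis | par | queue | src | tail | found | cur | act | res | bit | tgt | code
  | layer | inp | head | nb | cell
  deriving DecidableEq

instance : Fintype Reg where
  elems := {.mate, .vis, .par, .queue, .src, .tail, .found, .cur, .act, .res, .bit, .tgt, .code,
    .layer, .inp, .head, .nb, .cell}
  complete := by rintro ⟨⟩ <;> simp

open StructCtrl.Expr StructCtrl.Stmt StructCtrl.Reg

infixr:60 " ;; " => Stmt.seq

/-- An upper bound of all numbers that occur. -/
def capExpr : Expr Reg := (rows + cols + 1) * (rows + cols + 1)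

/-- A statement without consequences. -/
def idleStmt : Stmt Reg := set act 0 0

/-- Compute `joined`. -/
def edgeStmt : Stmt Reg :=
  ite (rows - var code % (rows + cols))
    (ite (rows - var nb)
      (set bit 0 (entry (2 + (var nb * rows + var code % (rows + cols)))))
      (set bit 0 (1 - ((var nb - (rows + var code % (rows + cols))) +
        (rows + var code % (rows + cols) - var nb)))))
    (ite (rows - var nb)
      (set bit 0 (entry (2 + rows * rows + (var nb * cols + (var code % (rows + cols) - rows)))))
      (set bit 0 0))

/-- Visit a neighbour of the current tail, unless it was visited before. -/
def visitStmt : Stmt Reg :=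
  set tgt 0 ((var code / (rows + cols) * rows + var nb) % capExpr) ;;
  edgeStmt ;;
  ite (var bit * (1 - arr vis (var tgt)))
    (set vis (var tgt) 1 ;;
      set par (var tgt) (var head) ;;
      ite (arr mate (var tgt))
        (set queue (var tail) (arr mate (var tgt)) ;;
          set src (var tail) (var tgt) ;;
          set tail 0 (var tail + 1))
        (set found 0 (var tgt + 1)))
    idleStmt

/-- Visit all the neighbours of the tail at the head of the queue. -/
def scanStmt : Stmt Reg :=
  set code 0 (arr queue (var head) - 1) ;;
  loop nb (.add .rows .rows) visitStmt

/-- Search for an augmenting path that starts at the input `inp` of the layer `layer`. -/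
def searchStmt : Stmt Reg :=
  loop cell (.mul .rows .rows) (set vis (var cell) 0) ;;
  set queue 0 ((var layer * (rows + cols) + (rows + var inp)) % capExpr + 1) ;;
  set tail 0 1 ;;
  set found 0 0 ;;
  loop head (.add (.mul .rows .rows) (.lit 1)) (ite (var tail - var head) scanStmt idleStmt)

/-- Augment along the path that was found. -/
def augmentStmt : Stmt Reg :=
  set cur 0 (var found - 1) ;;
  set act 0 1 ;;
  loop cell (.add (.mul .rows .rows) (.lit 1))
    (ite (var act)
      (set head 0 (arr par (var cur)) ;;
        set mate (var cur) (arr queue (var head)) ;;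
        ite (var head) (set cur 0 (arr src (var head))) (set act 0 0))
      idleStmt)

/-- Match all the states to themselves. -/
def initStmt : Stmt Reg :=
  set res 0 1 ;;
  loop layer .rows (loop nb .rows
    (set mate ((var layer + 1) * rows + var nb)
      ((var layer * (rows + cols) + var nb) % capExpr + 1)))

/-- Try the input vertices one after the other, in the order of the layers. -/
def greedyStmt : Stmt Reg :=
  loop layer .rows (loop inp .cols
    (searchStmt ;; ite (var found) (augmentStmt ;; set res 0 (var layer + 1)) idleStmt))

variable {n m : ℕ} (A : Matrix (Fin n) (Fin n) Bool) (B : Matrix (Fin n) (Fin m) Bool)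

theorem eval_capExpr (s : Store Reg) :
    capExpr.eval A B s = (n + m + 1) * (n + m + 1) := rfl

theorem run_edgeStmt (hn : 0 < n) (s : Store Reg) :
    edgeStmt.run A B s = s.write bit 0 (joined A B (s code 0) (s nb 0)) := by
  have hlt : s code 0 % (n + m) < n + m := Nat.mod_lt _ (by omega)
  simp only [edgeStmt, Stmt.run, eval_sub, eval_rows, eval_mod, eval_arr, eval_ofNat, eval_add,
    eval_cols, eval_entry, eval_mul, ne_eq, Nat.sub_eq_zero_iff_le, not_le, joined]
  split_ifs with h1 h2 h2
  · have := mul_add_lt_mul h2 h1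
    rw [Nat.mod_eq_of_lt]
    unfold inputLength
    omega
  · rfl
  · have : s nb 0 * m + (s code 0 % (n + m) - n) < n * m := mul_add_lt_mul h2 (by omega)
    rw [Nat.mod_eq_of_lt]
    unfold inputLength
    omega
  · rfl

/-- The arrays hold the state of a search from the tail with number `root`. -/
def Searching (root : ℕ) (s : Store Reg) : Prop :=
  SearchState (headCodes A B) (n * n) root (s mate) (s vis) (s par) (s queue) (s src)
    (s tail 0) (s found 0)

/-- The search has made progress. -/
structure Extends (s s' : Store Reg) : Prop where
  vis_ne : ∀ w, s vis w ≠ 0 → s' vis w ≠ 0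
  tail_le : s tail 0 ≤ s' tail 0
  queue_eq : ∀ x < s tail 0, s' queue x = s queue x

theorem Extends.trans {s s' s'' : Store Reg} (h : Extends s s') (h' : Extends s' s'') :
    Extends s s'' :=
  ⟨fun w hw => h'.vis_ne w (h.vis_ne w hw), h.tail_le.trans h'.tail_le,
    fun x hx => (h'.queue_eq x (hx.trans_le h.tail_le)).trans (h.queue_eq x hx)⟩

variable {A B}

theorem run_visitStmt (hn : 0 < n) {root : ℕ} {s : Store Reg} (hs : Searching A B root s)
    (hhead : s head 0 < s tail 0) (hcode : s code 0 = s queue (s head 0) - 1)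
    (hnb : s nb 0 < 2 * n) (hlayer : s code 0 / (n + m) < n)
    (hsmall : ∀ w ∈ headCodes A B (s code 0), w < n * n) :
    Searching A B root (visitStmt.run A B s) ∧ Extends s (visitStmt.run A B s) ∧
      (joined A B (s code 0) (s nb 0) ≠ 0 →
        visitStmt.run A B s vis (s code 0 / (n + m) * n + s nb 0) ≠ 0) := by
  set w := s code 0 / (n + m) * n + s nb 0 with hw
  have hcap : w < (n + m + 1) * (n + m + 1) := by
    have h1 : (s code 0 / (n + m) + 1) * n ≤ n * n := Nat.mul_le_mul_right _ hlayer
    have h2 : (s code 0 / (n + m) + 1) * n = s code 0 / (n + m) * n + n := by ring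
    have h3 : (n + 1) * (n + 1) ≤ (n + m + 1) * (n + m + 1) :=
      Nat.mul_le_mul (by omega) (by omega)
    have h4 : (n + 1) * (n + 1) = n * n + 2 * n + 1 := by ring
    omega
  have htgt : (set tgt 0 ((var code / (rows + cols) * rows + var nb) % capExpr)).run A B s =
      s.write tgt 0 w := by
    simp only [Stmt.run, eval_ofNat, eval_mod, eval_add, eval_mul, eval_div, eval_arr, eval_rows,
      eval_cols, eval_capExpr, ← hw, Nat.mod_eq_of_lt hcap]
  rw [visitStmt, Stmt.run, htgt, Stmt.run, run_edgeStmt A B hn]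
  simp only [Store.write_ne _ (show code ≠ tgt by decide), Store.write_ne _ (show nb ≠ tgt by decide)]
  generalize hjoin : joined A B (s code 0) (s nb 0) = e
  rw [Stmt.run]
  simp only [eval_mul, eval_arr, eval_ofNat, eval_sub, Store.write_same, Function.update_self,
    Store.write_ne _ (show tgt ≠ bit by decide), Store.write_ne _ (show vis ≠ bit by decide),
    Store.write_ne _ (show vis ≠ tgt by decide)]
  by_cases hvisit : e ≠ 0 ∧ s vis w = 0
  · obtain ⟨he, hvis⟩ := hvisit
    rw [if_pos (by rw [hvis]; simpa using he)]
    have hadj : w ∈ headCodes A B (s queue (s head 0) - 1) := by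
      rw [← hcode, mem_headCodes]
      exact ⟨s nb 0, hnb, by rwa [hjoin], rfl⟩
    have hwlt : w < n * n := hsmall w (by rw [hcode]; exact hadj)
    by_cases hmate : s mate w = 0
    · have key := hs.visit_free hwlt hvis hhead hadj hmate
      simp [Stmt.run, Store.write_same, Store.write_ne, hmate, Searching] at key ⊢
      refine ⟨key, ⟨?_, ?_, ?_⟩⟩
      · intro z hz
        simp only [Store.write_same, Store.write_ne, ne_eq, reduceCtorEq, not_false_eq_true]
        rcases eq_or_ne z w with rfl | h
        · simp
        · rwa [Function.update_of_ne h]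
      · simp [Store.write_ne]
      · simp [Store.write_ne]
    · have key := hs.visit_matched hwlt hvis hhead hadj hmate
      simp [Stmt.run, Store.write_same, Store.write_ne, hmate, Searching] at key ⊢
      refine ⟨key, ⟨?_, ?_, ?_⟩⟩
      · intro z hz
        simp only [Store.write_same, Store.write_ne, ne_eq, reduceCtorEq, not_false_eq_true]
        rcases eq_or_ne z w with rfl | h
        · simp
        · rwa [Function.update_of_ne h]
      · simp [Store.write_same, Store.write_ne]
      · intro x hx
        simp [Store.write_same, Store.write_ne, hx.ne]
  · rw [if_neg]
    · simp [idleStmt, Stmt.run, Store.write_ne, Searching] at hs ⊢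
      refine ⟨hs, ⟨?_, ?_, ?_⟩, fun he h => hvisit ⟨he, h⟩⟩
      · intro z hz
        simpa [Store.write_ne] using hz
      · simp [Store.write_ne]
      · simp [Store.write_ne]
    · intro h
      refine hvisit ⟨left_ne_zero_of_mul h, ?_⟩
      have := right_ne_zero_of_mul h
      omega

end Program


/-! ### Correctness of the program -/

section ProgramCorrect

open StructCtrl.Expr StructCtrl.Stmt StructCtrl.Reg

variable {n m : ℕ} {A : Matrix (Fin n) (Fin n) Bool} {B : Matrix (Fin n) (Fin m) Bool}

/-- Writing into other variables does not affect a search. -/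
theorem Searching.congr {root : ℕ} {s s' : Store Reg} (hs : Searching A B root s)
    (h : ∀ a ∈ [mate, vis, par, queue, src, tail, found], s' a = s a) :
    Searching A B root s' := by
  simp only [List.mem_cons, List.not_mem_nil, or_false, forall_eq_or_imp, forall_eq] at h
  obtain ⟨h1, h2, h3, h4, h5, h6, h7⟩ := h
  unfold Searching
  rw [h1, h2, h3, h4, h5, h6, h7]
  exact hs

theorem avoids_visitStmt {a : Reg}
    (h : a ∉ [vis, par, queue, src, tail, found, bit, tgt, act]) : visitStmt.Avoids a := by
  simp only [List.mem_cons, List.not_mem_nil, or_false, not_or] at h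
  simp [visitStmt, edgeStmt, idleStmt, Avoids, h]

theorem avoids_scanStmt {a : Reg}
    (h : a ∉ [vis, par, queue, src, tail, found, bit, tgt, act, code, nb]) :
    scanStmt.Avoids a := by
  have := avoids_visitStmt (a := a) (by
    simp only [List.mem_cons, List.not_mem_nil, or_false, not_or] at h ⊢; simp [h])
  simp only [List.mem_cons, List.not_mem_nil, or_false, not_or] at h
  simp [scanStmt, Avoids, h, this]

theorem avoids_searchStmt {a : Reg}
    (h : a ∉ [vis, par, queue, src, tail, found, bit, tgt, act, code, nb, head, cell]) :
    searchStmt.Avoids a := by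
  have := avoids_scanStmt (a := a) (by
    simp only [List.mem_cons, List.not_mem_nil, or_false, not_or] at h ⊢; simp [h])
  simp only [List.mem_cons, List.not_mem_nil, or_false, not_or] at h
  simp [searchStmt, idleStmt, Avoids, h, this]

theorem avoids_augmentStmt {a : Reg} (h : a ∉ [mate, cur, act, head, cell]) :
    augmentStmt.Avoids a := by
  simp only [List.mem_cons, List.not_mem_nil, or_false, not_or] at h
  simp [augmentStmt, idleStmt, Avoids, h]

/-- Scanning the head of the queue visits all its neighbours. -/
theorem run_scanStmt (hn : 0 < n) {root : ℕ} {s : Store Reg} (hs : Searching A B root s)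
    (hhead : s head 0 < s tail 0) (hlayer : (s queue (s head 0) - 1) / (n + m) < n)
    (hsmall : ∀ w ∈ headCodes A B (s queue (s head 0) - 1), w < n * n) :
    Searching A B root (scanStmt.run A B s) ∧ Extends s (scanStmt.run A B s) ∧
      ∀ w ∈ headCodes A B (s queue (s head 0) - 1), scanStmt.run A B s vis w ≠ 0 := by
  set c := s queue (s head 0) - 1 with hc
  have hset : (set code 0 (arr queue (var head) - 1)).run A B s = s.write code 0 c := by
    simp only [Stmt.run, eval_ofNat, eval_sub, eval_arr, hc]
  rw [scanStmt, run_seq, hset, run_loop]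
  have hval : Bound.val n m (.add .rows .rows) = 2 * n := by
    simp only [Bound.val]
    ring
  rw [hval]
  have key := runUpTo_induction (f := fun i t => visitStmt.run A B (t.write nb 0 i))
    (s := s.write code 0 c)
    (fun i (t : Store Reg) => Searching A B root t ∧ Extends s t ∧ t head = s head ∧
      t code 0 = c ∧ ∀ i' < i, joined A B c i' ≠ 0 → t vis (c / (n + m) * n + i') ≠ 0) (by
        refine ⟨hs.congr (by simp [Store.write_ne]), ⟨?_, ?_, ?_⟩, ?_, ?_, by omega⟩ <;>
          simp [Store.write_ne, Store.write_same])
    (2 * n) (by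
      rintro i hi t ⟨h1, h2, h3, h4, h5⟩
      have hS : Searching A B root (t.write nb 0 i) := h1.congr (by simp [Store.write_ne])
      have e1 : t.write nb 0 i head = s head := by simpa [Store.write_ne] using h3
      have e2 : t.write nb 0 i code 0 = c := by simpa [Store.write_ne] using h4
      have e3 : t.write nb 0 i tail = t tail := Store.write_ne _ (by decide) _ _
      have e4 : t.write nb 0 i queue = t queue := Store.write_ne _ (by decide) _ _
      have e5 : t.write nb 0 i vis = t vis := Store.write_ne _ (by decide) _ _
      have e6 : t.write nb 0 i nb 0 = i := by simp [Store.write_same]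
      obtain ⟨k1, k2, k3⟩ := run_visitStmt hn hS (by
          rw [e1, e3]
          exact hhead.trans_le h2.tail_le) (by
          rw [e2, e1, e4, h2.queue_eq _ hhead, hc]) (by rwa [e6]) (by rwa [e2]) (by rwa [e2])
      rw [e2, e6] at k3
      refine ⟨k1, h2.trans (Extends.trans ⟨?_, ?_, ?_⟩ k2), ?_, ?_, ?_⟩
      · intro w hw
        rwa [e5]
      · rw [e3]
      · intro x _
        rw [e4]
      · rw [run_of_avoids A B _ (avoids_visitStmt (by decide)), e1]
      · rw [run_of_avoids A B _ (avoids_visitStmt (by decide)), e2]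
      · intro i' hi' hj
        rcases Nat.lt_succ_iff_lt_or_eq.1 hi' with hlt | rfl
        · refine k2.vis_ne _ ?_
          rw [e5]
          exact h5 i' hlt hj
        · exact k3 hj)
  obtain ⟨h1, h2, -, -, h5⟩ := key
  generalize runUpTo (fun i t => visitStmt.run A B (t.write nb 0 i)) (s.write code 0 c) (2 * n) = t
    at *
  have e3 : t.write nb 0 (2 * n) tail = t tail := Store.write_ne _ (by decide) _ _
  have e4 : t.write nb 0 (2 * n) queue = t queue := Store.write_ne _ (by decide) _ _
  have e5 : t.write nb 0 (2 * n) vis = t vis := Store.write_ne _ (by decide) _ _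
  refine ⟨h1.congr (by simp [Store.write_ne]), h2.trans ⟨?_, ?_, ?_⟩, ?_⟩
  · intro w hw
    rwa [e5]
  · rw [e3]
  · intro x _
    rw [e4]
  · intro w hw
    obtain ⟨i, hi, hj, rfl⟩ := (mem_headCodes A B).1 hw
    rw [e5]
    exact h5 i hi hj

/-- The search from the input vertex with the index `inp` in the layer `layer` visits all the heads
that alternating paths can reach. -/
theorem run_searchStmt (hn : 0 < n) {s : Store Reg} {S : Set ℕ} {root : ℕ}
    (hroot : root = s layer 0 * (n + m) + (n + s inp 0)) (hl : s layer 0 < n) (hi : s inp 0 < m)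
    (hM : IsMatchingOf (headCodes A B) (n * n) S (s mate))
    (hS : ∀ c ∈ insert root S, c / (n + m) < n ∧ ∀ w ∈ headCodes A B c, w < n * n) :
    Searching A B root (searchStmt.run A B s) ∧
      ∀ x < searchStmt.run A B s tail 0,
        ∀ w ∈ headCodes A B (searchStmt.run A B s queue x - 1),
          w < n * n ∧ searchStmt.run A B s vis w ≠ 0 := by
  have hcap : root < (n + m + 1) * (n + m + 1) := by
    have h1 : root < n * (n + m) := hroot ▸ mul_add_lt_mul hl (by omega)
    have h2 : n * (n + m) ≤ (n + m + 1) * (n + m + 1) := Nat.mul_le_mul (by omega) (by omega)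
    omega
  have hmate : searchStmt.run A B s mate = s mate :=
    run_of_avoids A B _ (avoids_searchStmt (by decide)) s
  rw [searchStmt, run_seq]
  set s₁ := (loop cell (.mul .rows .rows) (set vis (var cell) 0)).run A B s with hs₁
  have hvis₁ : ∀ w < n * n, s₁ vis w = 0 := by
    have key := runUpTo_induction
      (f := fun i t => (set vis (var cell) 0 : Stmt Reg).run A B (t.write cell 0 i)) (s := s)
      (fun i (t : Store Reg) => ∀ w < i, t vis w = 0) (by omega) (n * n) (by
        intro i _ t ht w hw
        simp only [Stmt.run, eval_arr, eval_ofNat, Store.write_same, Function.update_self,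
          Store.write_ne _ (show vis ≠ cell by decide)]
        rcases Nat.lt_succ_iff_lt_or_eq.1 hw with hlt | rfl
        · rw [Function.update_of_ne hlt.ne, ht w hlt]
        · rw [Function.update_self])
    intro w hw
    rw [hs₁, run_loop, Store.write_ne _ (show vis ≠ cell by decide)]
    exact key w hw
  have hfr₁ : ∀ a, a ≠ vis → a ≠ cell → s₁ a = s a := fun a h1 h2 =>
    run_of_avoids A B (loop cell (.mul .rows .rows) (set vis (var cell) 0)) ⟨h2, h1⟩ s
  rw [run_seq]
  set s₂ := (set queue 0 ((var layer * (rows + cols) + (rows + var inp)) % capExpr + 1)).run A B s₁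
    with hs₂
  have hq₂ : s₂ = s₁.write queue 0 (root + 1) := by
    rw [hs₂]
    simp only [Stmt.run, eval_ofNat, eval_add, eval_mod, eval_mul, eval_arr, eval_rows, eval_cols,
      eval_capExpr]
    rw [hfr₁ layer (by decide) (by decide), hfr₁ inp (by decide) (by decide), ← hroot,
      Nat.mod_eq_of_lt hcap]
  rw [run_seq, run_seq]
  set s₃ := (set found 0 0).run A B ((set tail 0 1).run A B s₂) with hs₃
  have hs₃' : s₃ = (s₂.write tail 0 1).write found 0 0 := rfl
  have hst : Searching A B root s₃ := by
    have h : SearchState (headCodes A B) (n * n) root (s₃ mate) (s₃ vis) (s₃ par) (s₃ queue)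
        (s₃ src) 1 0 := by
      refine .start (fun w hw => ?_) ?_
      · rw [hs₃', hq₂]
        simpa [Store.write_ne] using hvis₁ w hw
      · rw [hs₃', hq₂]
        simp [Store.write_ne, Store.write_same]
    have h1 : s₃ tail 0 = 1 := by rw [hs₃']; simp [Store.write_ne, Store.write_same]
    have h2 : s₃ found 0 = 0 := by rw [hs₃']; simp [Store.write_same]
    rw [Searching, h1, h2]
    exact h
  have hm₃ : s₃ mate = s mate := by
    rw [hs₃', hq₂, ← hfr₁ mate (by decide) (by decide)]
    simp [Store.write_ne]
  have key := runUpTo_induction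
    (f := fun i t => (ite (var tail - var head) scanStmt idleStmt).run A B (t.write head 0 i))
    (s := s₃) (fun h (t : Store Reg) => Searching A B root t ∧ t mate = s mate ∧
      ∀ x < h, x < t tail 0 → ∀ w ∈ headCodes A B (t queue x - 1), t vis w ≠ 0)
    ⟨hst, hm₃, by omega⟩ (n * n + 1) (by
      rintro h - t ⟨h1, h2, h3⟩
      have e1 : t.write head 0 h head 0 = h := by simp [Store.write_same]
      have e3 : t.write head 0 h tail = t tail := Store.write_ne _ (by decide) _ _
      have e4 : t.write head 0 h queue = t queue := Store.write_ne _ (by decide) _ _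
      have e5 : t.write head 0 h vis = t vis := Store.write_ne _ (by decide) _ _
      have e6 : t.write head 0 h mate = t mate := Store.write_ne _ (by decide) _ _
      have hS' : Searching A B root (t.write head 0 h) := h1.congr (by simp [Store.write_ne])
      simp only [Stmt.run, eval_sub, eval_arr, eval_ofNat, e1, e3]
      by_cases hlt : h < t tail 0
      · rw [if_pos (by omega)]
        have hmem := (h1.queue_mem (h2 ▸ hM) hlt).1
        obtain ⟨k1, k2, k3⟩ := run_scanStmt hn hS' (by rwa [e1, e3])
          (by rw [e1, e4]; exact (hS _ hmem).1) (by rw [e1, e4]; exact (hS _ hmem).2)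
        rw [e1, e4] at k3
        have hq : ∀ x < t tail 0,
            scanStmt.run A B (t.write head 0 h) queue x = t queue x := by
          intro x hx
          rw [k2.queue_eq x (by rwa [e3]), e4]
        refine ⟨k1, ?_, ?_⟩
        · rw [run_of_avoids A B _ (avoids_scanStmt (by decide)), e6, h2]
        · intro x hx _ w hw
          rcases Nat.lt_succ_iff_lt_or_eq.1 hx with hxh | rfl
          · rw [hq x (hxh.trans hlt)] at hw
            refine k2.vis_ne w ?_
            rw [e5]
            exact h3 x hxh (hxh.trans hlt) w hw
          · rw [hq x hlt] at hw
            exact k3 w hw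
      · rw [if_neg (by omega)]
        refine ⟨hS'.congr (by simp [idleStmt, Stmt.run, Store.write_ne]), ?_, ?_⟩
        · rw [← h2, ← e6]
          simp [idleStmt, Stmt.run, Store.write_ne]
        · intro x hx hxt w hw
          simp only [idleStmt, Stmt.run, Store.write_ne _ (show tail ≠ act by decide),
            Store.write_ne _ (show queue ≠ act by decide),
            Store.write_ne _ (show vis ≠ act by decide), e3, e4, e5] at hxt hw ⊢
          exact h3 x (by omega) hxt w hw)
  obtain ⟨h1, h2, h3⟩ := key
  rw [run_loop]
  have hval : Bound.val n m (.add (.mul .rows .rows) (.lit 1)) = n * n + 1 := rfl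
  rw [hval]
  generalize runUpTo (fun i t => (ite (var tail - var head) scanStmt idleStmt).run A B
    (t.write head 0 i)) s₃ (n * n + 1) = t at *
  refine ⟨h1.congr (by simp [Store.write_ne]), ?_⟩
  simp only [Store.write_ne _ (show tail ≠ head by decide),
    Store.write_ne _ (show queue ≠ head by decide), Store.write_ne _ (show vis ≠ head by decide)]
  intro x hx w hw
  have := SearchState.tail_le h1
  exact ⟨(hS _ (h1.queue_mem (h2 ▸ hM) hx).1).2 w hw, h3 x (by omega) hx w hw⟩

/-- The augmentation produces a matching of one more tail. -/
theorem run_augmentStmt {s : Store Reg} {S : Set ℕ} {root : ℕ} (hs : Searching A B root s)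
    (hM : IsMatchingOf (headCodes A B) (n * n) S (s mate)) (hroot : root ∉ S)
    (hf : s found 0 ≠ 0) :
    IsMatchingOf (headCodes A B) (n * n) (insert root S) (augmentStmt.run A B s mate) := by
  rw [augmentStmt, run_seq, run_seq]
  set s₁ := (set act 0 1).run A B ((set cur 0 (var found - 1)).run A B s) with hs₁
  have hs₁' : s₁ = (s.write cur 0 (s found 0 - 1)).write act 0 1 := rfl
  have hle := SearchState.tail_le hs
  have key := runUpTo_induction
    (f := fun i t => (ite (var act)
      (set head 0 (arr par (var cur)) ;;
        set mate (var cur) (arr queue (var head)) ;;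
        ite (var head) (set cur 0 (arr src (var head))) (set act 0 0))
      idleStmt).run A B (t.write cell 0 i))
    (s := s₁) (fun i (t : Store Reg) => t par = s par ∧ t queue = s queue ∧ t src = s src ∧
      ((t act 0 = 0 ∧ IsMatchingOf (headCodes A B) (n * n) (insert root S) (t mate)) ∨
        (t act 0 = 1 ∧ ∃ x, x + i ≤ n * n + 1 ∧ x ≤ s tail 0 ∧
          AugmentState (headCodes A B) (n * n) S (s par) (s queue) (s src) (t mate) (t cur 0) x)))
    (by
      rw [hs₁']
      refine ⟨by simp [Store.write_ne], by simp [Store.write_ne], by simp [Store.write_ne],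
        Or.inr ⟨by simp [Store.write_same], s tail 0, hle, le_rfl, ?_⟩⟩
      have := hs.augmentState hM hf
      simpa [Store.write_ne, Store.write_same] using this)
    (n * n + 1) (by
      rintro i - t ⟨h1, h2, h3, h4⟩
      rcases h4 with ⟨h4, h5⟩ | ⟨h4, x, h5, h6, h7⟩
      · simp [Stmt.run, idleStmt, Store.write_ne, Store.write_same, h1, h2, h3, h4, h5]
      · have hpar := h7.par_lt
        by_cases h8 : s par (t cur 0) = 0
        · have := h7.finish hs hroot h8
          rw [h8] at this
          simpa [Stmt.run, Store.write_ne, Store.write_same, h1, h2, h3, h4, h8] using this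
        · have := h7.step hs h6 h8
          have h9 : ¬ t act 0 = 0 := by omega
          simp [Stmt.run, Store.write_ne, Store.write_same, h1, h2, h3, h9, h8]
          exact ⟨h4, s par (t cur 0), by omega, by omega, this⟩)
  obtain ⟨-, -, -, h⟩ := key
  rw [run_loop, Store.write_ne _ (show mate ≠ cell by decide)]
  rcases h with ⟨-, h⟩ | ⟨-, x, h1, -, h2⟩
  · exact h
  · have := h2.par_lt
    omega

end ProgramCorrect


section Greedy

open StructCtrl.Expr StructCtrl.Stmt StructCtrl.Reg

variable {n m : ℕ} {A : Matrix (Fin n) (Fin n) Bool} {B : Matrix (Fin n) (Fin m) Bool}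

/-- Matching every state to itself. -/
theorem isMatchingOf_init {M : ℕ → ℕ} (hfree : ∀ w < n, M w = 0)
    (hM : ∀ k i, k < n → i < n → M ((k + 1) * n + i) = k * (n + m) + i + 1) :
    IsMatchingOf (headCodes A B) (n * n) (tailCodes n (∅ : Finset (Fin m × ℕ))) M := by
  have hform : ∀ w < n * n, M w ≠ 0 → ∃ (t : Fin n) (k : ℕ), k + 1 < n ∧ w = (k + 1) * n + t ∧
      M w = tailCode ((.inl t, k) : LNode n m) + 1 := by
    intro w hw h0
    have hn : 0 < n := by
      rcases Nat.eq_zero_or_pos n with rfl | h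
      · simp at hw
      · exact h
    have hge : 1 ≤ w / n := by
      by_contra! h
      refine h0 (hfree w ?_)
      rw [Nat.div_lt_iff_lt_mul hn] at h
      omega
    have hlt : w / n < n := (Nat.div_lt_iff_lt_mul hn).2 hw
    have hwform : w = (w / n - 1 + 1) * n + w % n := by
      rw [Nat.sub_add_cancel hge, Nat.mul_comm, Nat.div_add_mod]
    refine ⟨⟨w % n, Nat.mod_lt _ hn⟩, w / n - 1, by omega, hwform, ?_⟩
    have := hM (w / n - 1) (w % n) (by omega) (Nat.mod_lt _ hn)
    rw [← hwform] at this
    exact this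
  refine ⟨?_, ?_, ?_⟩
  · intro w hw h0
    obtain ⟨t, k, hk, rfl, h⟩ := hform w hw h0
    rw [h, Nat.add_sub_cancel]
    refine ⟨Or.inl ⟨t, k, hk, rfl⟩, ?_⟩
    rw [headCodes_tailCode]
    exact Finset.mem_image.2 ⟨(t, k + 1), (mem_heads A B).2 (Or.inr ⟨rfl, rfl⟩), rfl⟩
  · intro w hw w' hw' h0 heq
    obtain ⟨t, k, hk, h1, h2⟩ := hform w hw h0
    obtain ⟨t', k', hk', h1', h2'⟩ := hform w' hw' (heq ▸ h0)
    rw [h2, h2', Nat.add_right_cancel_iff] at heq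
    have := tailCode_injective heq
    simp only [Prod.mk.injEq, Sum.inl.injEq] at this
    rw [h1, h1', this.1, this.2]
  · rintro c (⟨t, k, hk, rfl⟩ | ⟨u, hu, -⟩)
    · exact ⟨(k + 1) * n + t, mul_add_lt_mul hk t.2, hM k t (by omega) t.2⟩
    · simp at hu

theorem run_initStmt (s : Store Reg) (hs : ∀ w < n, s mate w = 0) :
    IsMatchingOf (headCodes A B) (n * n) (tailCodes n (∅ : Finset (Fin m × ℕ)))
      (initStmt.run A B s mate) ∧ initStmt.run A B s res 0 = 1 := by
  constructor
  · rw [initStmt, run_seq, run_loop, Store.write_ne _ (show mate ≠ layer by decide)]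
    have hval : ∀ k i, k < n → i < n → (k * (n + m) + i) % ((n + m + 1) * (n + m + 1)) =
        k * (n + m) + i := by
      intro k i hk hi
      refine Nat.mod_eq_of_lt ?_
      have h1 : k * (n + m) + i < n * (n + m) := mul_add_lt_mul hk (by omega)
      have h2 : n * (n + m) ≤ (n + m + 1) * (n + m + 1) := Nat.mul_le_mul (by omega) (by omega)
      omega
    have key := runUpTo_induction
      (f := fun l t => (loop nb .rows (set mate ((var layer + 1) * rows + var nb)
        ((var layer * (rows + cols) + var nb) % capExpr + 1))).run A B (t.write layer 0 l))
      (s := (set res 0 1).run A B s)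
      (fun l (t : Store Reg) => (∀ w < n, t mate w = 0) ∧
        ∀ k i, k < l → i < n → t mate ((k + 1) * n + i) = k * (n + m) + i + 1)
      ⟨fun w hw => by simpa [Stmt.run, Store.write_ne] using hs w hw, by omega⟩ n (by
        rintro l hl t ⟨h1, h2⟩
        have key := runUpTo_induction
          (f := fun j t => (set mate ((var layer + 1) * rows + var nb)
            ((var layer * (rows + cols) + var nb) % capExpr + 1)).run A B (t.write nb 0 j))
          (s := t.write layer 0 l)
          (fun j (t' : Store Reg) => t' layer 0 = l ∧ (∀ w < n, t' mate w = 0) ∧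
            (∀ k i, k < l → i < n → t' mate ((k + 1) * n + i) = k * (n + m) + i + 1) ∧
            ∀ i < j, t' mate ((l + 1) * n + i) = l * (n + m) + i + 1)
          (by
            refine ⟨by simp [Store.write_same], ?_, ?_, by omega⟩
            · intro w hw
              simpa [Store.write_ne] using h1 w hw
            · intro k i hk hi
              simpa [Store.write_ne] using h2 k i hk hi) n (by
            rintro j hj t' ⟨k1, k2, k3, k4⟩
            have hrun : (set mate ((var layer + 1) * rows + var nb)
                ((var layer * (rows + cols) + var nb) % capExpr + 1)).run A B (t'.write nb 0 j) =
                (t'.write nb 0 j).write mate ((l + 1) * n + j) (l * (n + m) + j + 1) := by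
              simp only [Stmt.run, eval_add, eval_mul, eval_mod, eval_arr, eval_ofNat, eval_rows,
                eval_cols, eval_capExpr, Store.write_ne _ (show layer ≠ nb by decide), k1,
                Store.write_same, Function.update_self, hval l j hl hj]
            rw [hrun, Store.write_same, Store.write_ne _ (show layer ≠ mate by decide),
              Store.write_ne _ (show layer ≠ nb by decide),
              Store.write_ne _ (show mate ≠ nb by decide)]
            refine ⟨k1, ?_, ?_, ?_⟩
            · intro w hw
              rw [Function.update_of_ne, k2 w hw]
              have : 1 * n ≤ (l + 1) * n := Nat.mul_le_mul_right _ (by omega)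
              omega
            · intro k i hk hi
              rw [Function.update_of_ne, k3 k i hk hi]
              have := mul_add_lt_mul (show k + 1 < l + 1 by omega) hi
              omega
            · intro i hi
              rcases Nat.lt_succ_iff_lt_or_eq.1 hi with hlt | rfl
              · rw [Function.update_of_ne (by omega), k4 i hlt]
              · rw [Function.update_self])
        obtain ⟨-, k2, k3, k4⟩ := key
        rw [run_loop, Store.write_ne _ (show mate ≠ nb by decide)]
        refine ⟨k2, fun k i hk hi => ?_⟩
        rcases Nat.lt_succ_iff_lt_or_eq.1 hk with hlt | rfl
        · exact k3 k i hlt hi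
        · exact k4 i hi)
    exact isMatchingOf_init key.1 key.2
  · rw [initStmt, run_seq, run_of_avoids A B (a := res) _ (by simp [Avoids])]
    simp [Stmt.run, Store.write_same]

/-- The input vertex `u` comes before the input vertex with the index `j` in layer `k`. -/
def Before (k j : ℕ) (u : Fin m × ℕ) : Prop := u.2 < k ∨ u.2 = k ∧ (u.1 : ℕ) < j

variable (A B) in
/-- The input vertices before the one with the index `j` in layer `k` were tried, and `I` is the set
of those that were accepted. -/
structure GreedyState (k j : ℕ) (I : Finset (Fin m × ℕ)) (M : ℕ → ℕ) (r : ℕ) : Prop where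
  before : ∀ u ∈ I, Before k j u
  lt : ∀ u ∈ I, u.2 < n
  matching : IsMatchingOf (headCodes A B) (n * n) (tailCodes n I) M
  rejected : ∀ u, Before k j u → u ∉ I →
    ¬ Linkable A B (insert u (I.filter fun v => v.2 ≤ u.2))
  res_mem : 1 ≤ r ∧ r ≤ n
  lt_res : ∀ u ∈ I, u.2 < r
  res_eq : r = 1 ∨ ∃ u ∈ I, u.2 + 1 = r

namespace GreedyState

variable {k j r : ℕ} {I : Finset (Fin m × ℕ)} {M : ℕ → ℕ}

theorem filter_eq (h : GreedyState A B k j I M r) : (I.filter fun v => v.2 ≤ k) = I :=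
  Finset.filter_true_of_mem fun u hu => by
    rcases h.before u hu with h | h <;> omega

theorem before_succ {hj : j < m} {u : Fin m × ℕ} (hu : Before k (j + 1) u) :
    Before k j u ∨ u = (⟨j, hj⟩, k) := by
  rcases hu with hu | ⟨hu, hlt⟩
  · exact Or.inl (Or.inl hu)
  · rcases Nat.lt_succ_iff_lt_or_eq.1 hlt with h | h
    · exact Or.inl (Or.inr ⟨hu, h⟩)
    · exact Or.inr (Prod.ext (Fin.ext h) hu)

theorem notMem (h : GreedyState A B k j I M r) (hj : j < m) : (⟨j, hj⟩, k) ∉ I := by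
  intro hmem
  rcases h.before _ hmem with h | ⟨-, h⟩
  · exact lt_irrefl _ h
  · exact lt_irrefl _ h

theorem before_mono {u : Fin m × ℕ} (hu : Before k j u) : Before k (j + 1) u :=
  hu.imp_right fun h => ⟨h.1, by omega⟩

theorem accept (h : GreedyState A B k j I M r) (hk : k < n) (hj : j < m) {M' : ℕ → ℕ}
    (hM' : IsMatchingOf (headCodes A B) (n * n)
      (insert (tailCode (n := n) (inputTail (⟨j, hj⟩, k))) (tailCodes n I)) M') :
    GreedyState A B k (j + 1) (insert (⟨j, hj⟩, k) I) M' (k + 1) := by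
  refine ⟨?_, ?_, by rwa [tailCodes_insert], ?_, ⟨by omega, hk⟩, ?_,
    Or.inr ⟨_, Finset.mem_insert_self _ _, rfl⟩⟩
  · intro u hu
    rcases Finset.mem_insert.1 hu with rfl | hu
    · exact Or.inr ⟨rfl, Nat.lt_succ_self j⟩
    · exact before_mono (h.before u hu)
  · intro u hu
    rcases Finset.mem_insert.1 hu with rfl | hu
    · exact hk
    · exact h.lt u hu
  · intro u hu hmem hl
    rw [Finset.mem_insert, not_or] at hmem
    refine h.rejected u ((before_succ hu).resolve_right hmem.1) hmem.2 (hl.mono ?_)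
    exact Finset.insert_subset_insert _
      (Finset.filter_subset_filter _ (Finset.subset_insert _ _))
  · intro u hu
    rcases Finset.mem_insert.1 hu with rfl | hu
    · exact Nat.lt_succ_self k
    · rcases h.before u hu with h | h <;> omega

theorem reject (h : GreedyState A B k j I M r) (hj : j < m)
    (hno : ¬ Matchable (headCodes A B)
      (insert (tailCode (n := n) (inputTail (⟨j, hj⟩, k))) (tailCodes n I))) :
    GreedyState A B k (j + 1) I M r := by
  refine ⟨fun u hu => before_mono (h.before u hu), h.lt, h.matching, ?_, h.res_mem, h.lt_res,
    h.res_eq⟩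
  intro u hu hmem
  rcases before_succ (hj := hj) hu with hu | rfl
  · exact h.rejected u hu hmem
  · rw [h.filter_eq]
    intro hl
    refine hno ?_
    rw [← tailCodes_insert]
    exact hl.matchable_codes

theorem next (h : GreedyState A B k m I M r) : GreedyState A B (k + 1) 0 I M r := by
  refine ⟨?_, h.lt, h.matching, ?_, h.res_mem, h.lt_res, h.res_eq⟩
  · intro u hu
    rcases h.before u hu with h | h <;> exact Or.inl (by omega)
  · intro u hu hmem
    refine h.rejected u ?_ hmem
    rcases hu with hu | ⟨-, hu⟩
    · rcases Nat.lt_succ_iff_lt_or_eq.1 hu with h | h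
      · exact Or.inl h
      · exact Or.inr ⟨h, u.1.2⟩
    · omega

theorem eq_muLow (hn : 1 ≤ n) (h : GreedyState A B n 0 I M r) : r = muLow A B :=
  eq_muLow_of_greedy hn (linkable_of_matchable_codes hn h.lt h.matching.matchable)
    (fun u hu hmem => h.rejected u (Or.inl hu) hmem) h.res_mem h.lt_res h.res_eq

end GreedyState

/-- One round of the main loop. -/
theorem run_round (hn : 0 < n) {s : Store Reg} {I : Finset (Fin m × ℕ)}
    (hl : s layer 0 < n) (hi : s inp 0 < m)
    (h : GreedyState A B (s layer 0) (s inp 0) I (s mate) (s res 0)) :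
    ∃ I', GreedyState A B (s layer 0) (s inp 0 + 1) I'
      ((searchStmt ;; ite (var found) (augmentStmt ;; set res 0 (var layer + 1))
        idleStmt).run A B s mate)
      ((searchStmt ;; ite (var found) (augmentStmt ;; set res 0 (var layer + 1))
        idleStmt).run A B s res 0) := by
  set root := tailCode (n := n) (inputTail ((⟨s inp 0, hi⟩, s layer 0) : Fin m × ℕ)) with hroot
  have hnot := notMem_tailCodes (n := n) (h.notMem hi)
  have hS : ∀ c ∈ insert root (tailCodes n I),
      c / (n + m) < n ∧ ∀ w ∈ headCodes A B c, w < n * n := by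
    rw [hroot, ← tailCodes_insert]
    have hI : ∀ u ∈ insert ((⟨s inp 0, hi⟩, s layer 0) : Fin m × ℕ) I, u.2 < n := by
      intro u hu
      rcases Finset.mem_insert.1 hu with rfl | hu
      · exact hl
      · exact h.lt u hu
    refine fun c hc => ⟨?_, fun w hw => lt_of_mem_headCodes hI hc hw⟩
    rcases hc with ⟨t, k, hk, rfl⟩ | ⟨u, hu, rfl⟩
    · rw [tailCode_div]
      exact (Nat.lt_succ_self k).trans hk
    · rw [tailCode_div]
      exact hI u hu
  obtain ⟨h1, h2⟩ := run_searchStmt (A := A) (B := B) hn (s := s) (root := root) rfl hl hi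
    h.matching hS
  have hfr : ∀ a, a ∉ [vis, par, queue, src, tail, found, bit, tgt, act, code, nb, head, cell] →
      searchStmt.run A B s a = s a := fun a ha =>
    run_of_avoids A B _ (avoids_searchStmt ha) s
  have hmate := hfr mate (by decide)
  have hres := hfr res (by decide)
  have hlayer := hfr layer (by decide)
  rw [run_seq]
  generalize searchStmt.run A B s = t at *
  by_cases hf : t found 0 = 0
  · refine ⟨I, ?_⟩
    have hrun : (ite (var found) (augmentStmt ;; set res 0 (var layer + 1)) idleStmt).run A B t =
        idleStmt.run A B t := if_neg (not_not.2 hf)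
    rw [hrun, run_of_avoids A B (a := mate) _ (by simp [idleStmt, Avoids]),
      run_of_avoids A B (a := res) _ (by simp [idleStmt, Avoids]), hmate, hres]
    refine h.reject hi ?_
    rw [Searching, hf, hmate] at h1
    exact h1.not_matchable h.matching hnot h2
  · refine ⟨insert (⟨s inp 0, hi⟩, s layer 0) I, ?_⟩
    have hrun : (ite (var found) (augmentStmt ;; set res 0 (var layer + 1)) idleStmt).run A B t =
        (set res 0 (var layer + 1)).run A B (augmentStmt.run A B t) := if_pos hf
    have haug := run_augmentStmt h1 (by rw [hmate]; exact h.matching) hnot hf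
    have hlay : augmentStmt.run A B t layer = t layer :=
      run_of_avoids A B _ (avoids_augmentStmt (by decide)) t
    have hres' : (set res 0 (var layer + 1)).run A B (augmentStmt.run A B t) res 0 =
        s layer 0 + 1 := by
      simp only [Stmt.run, eval_ofNat, eval_add, eval_arr, Store.write_same, Function.update_self,
        hlay, hlayer]
    rw [hrun, hres', run_of_avoids A B (a := mate) (set res 0 (var layer + 1))
      (by simp [Avoids])]
    exact h.accept hl hi haug

theorem run_greedyStmt (hn : 1 ≤ n) {s : Store Reg}
    (hM : IsMatchingOf (headCodes A B) (n * n) (tailCodes n (∅ : Finset (Fin m × ℕ))) (s mate))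
    (hres : s res 0 = 1) : greedyStmt.run A B s res 0 = muLow A B := by
  have hav : ∀ a ∈ [layer, inp], (searchStmt ;; ite (var found)
      (augmentStmt ;; set res 0 (var layer + 1)) idleStmt).Avoids a := by
    intro a ha
    have ha' : a = layer ∨ a = inp := by simpa using ha
    rcases ha' with rfl | rfl
    · exact ⟨avoids_searchStmt (by decide), ⟨avoids_augmentStmt (by decide), by simp [Avoids]⟩,
        by simp [idleStmt, Avoids]⟩
    · exact ⟨avoids_searchStmt (by decide), ⟨avoids_augmentStmt (by decide), by simp [Avoids]⟩,
        by simp [idleStmt, Avoids]⟩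
  have hstart : GreedyState A B 0 0 ∅ (s mate) (s res 0) := by
    refine ⟨by simp, by simp, hM, ?_, by omega, by simp, Or.inl hres⟩
    rintro u (hu | ⟨-, hu⟩)
    · omega
    · omega
  have key := runUpTo_induction
    (f := fun k t => (loop inp .cols (searchStmt ;; ite (var found)
      (augmentStmt ;; set res 0 (var layer + 1)) idleStmt)).run A B (t.write layer 0 k))
    (s := s) (fun k (t : Store Reg) => ∃ I, GreedyState A B k 0 I (t mate) (t res 0))
    ⟨∅, hstart⟩ n (by
      rintro k hk t ⟨I, hI⟩
      have key := runUpTo_induction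
        (f := fun j t => (searchStmt ;; ite (var found)
          (augmentStmt ;; set res 0 (var layer + 1)) idleStmt).run A B (t.write inp 0 j))
        (s := t.write layer 0 k)
        (fun j (t' : Store Reg) => t' layer 0 = k ∧
          ∃ I, GreedyState A B k j I (t' mate) (t' res 0))
        ⟨by simp [Store.write_same], I, by simpa [Store.write_ne] using hI⟩ m (by
          rintro j hj t' ⟨h1, I, hI⟩
          have e1 : t'.write inp 0 j layer 0 = k := by simpa [Store.write_ne] using h1
          have e2 : t'.write inp 0 j inp 0 = j := by simp [Store.write_same]
          refine ⟨?_, ?_⟩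
          · rw [run_of_avoids A B _ (hav layer (by simp)), e1]
          · have := run_round (A := A) (B := B) hn (s := t'.write inp 0 j) (I := I)
              (by rwa [e1]) (by rwa [e2]) (by
                rw [e1, e2]
                simpa [Store.write_ne] using hI)
            rwa [e1, e2] at this)
      obtain ⟨-, I', hI'⟩ := key
      refine ⟨I', ?_⟩
      rw [run_loop, Store.write_ne _ (show mate ≠ inp by decide),
        Store.write_ne _ (show res ≠ inp by decide)]
      exact hI'.next)
  obtain ⟨I, hI⟩ := key
  rw [greedyStmt, run_loop, Store.write_ne _ (show res ≠ layer by decide)]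
  exact hI.eq_muLow hn

/-! ### The running time -/

theorem store_le_of_encode_le {s : Store Reg} {M : ℕ} (h : ∀ x, encode A B s x ≤ M) (a : Reg)
    (x : ℕ) : s a x ≤ M := by
  rw [← encode_address A B s a x]
  exact h _

theorem tame_arr (a : Reg) (e : Expr Reg) : (arr a e).Tame := fun A B _ _ h _ =>
  (store_le_of_encode_le (A := A) (B := B) h _ _).trans (Nat.le_succ _)

theorem tame_arr_add_one (a : Reg) (e : Expr Reg) : (arr a e + 1).Tame := fun A B _ _ h _ =>
  Nat.add_le_add_right (store_le_of_encode_le (A := A) (B := B) h _ _) 1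

theorem tame_entry (e : Expr Reg) : (entry e).Tame := fun A B _ _ _ hM =>
  (initMemory_le A B _).trans (hM.trans (Nat.le_succ _))

theorem tame_sub {e : Expr Reg} (he : e.Tame) (f : Expr Reg) : (e - f).Tame :=
  fun A B s M h hM => (Nat.sub_le _ _).trans (he A B s M h hM)

theorem tame_zero : (0 : Expr Reg).Tame := fun _ _ _ _ _ _ => Nat.zero_le _

theorem tame_one : (1 : Expr Reg).Tame := fun _ _ _ _ _ _ => Nat.le_add_left _ _

theorem eval_mod_capExpr_lt (A : Matrix (Fin n) (Fin n) Bool) (B : Matrix (Fin n) (Fin m) Bool)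
    (s : Store Reg) (e : Expr Reg) : (e % capExpr).eval A B s < (n + m + 1) ^ 2 := by
  rw [eval_mod, eval_capExpr, sq]
  exact Nat.mod_lt _ (by positivity)

theorem tame_mod_capExpr (e : Expr Reg) : (e % capExpr).Tame := fun A B s _ _ hM =>
  ((eval_mod_capExpr_lt A B s e).le.trans hM).trans (Nat.le_succ _)

theorem tame_mod_capExpr_add_one (e : Expr Reg) : (e % capExpr + 1).Tame := fun A B s _ _ hM =>
  Nat.add_le_add_right ((eval_mod_capExpr_lt A B s e).le.trans hM) 1

/-- The program for `muLow`. -/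
def muLowStmt : Stmt Reg := initStmt ;; greedyStmt

theorem valid_muLowStmt : muLowStmt.Valid := by
  have h1 : searchStmt.Avoids layer := avoids_searchStmt (by decide)
  have h2 : searchStmt.Avoids inp := avoids_searchStmt (by decide)
  have h3 : augmentStmt.Avoids layer := avoids_augmentStmt (by decide)
  have h4 : augmentStmt.Avoids inp := avoids_augmentStmt (by decide)
  have h5 : scanStmt.Avoids head := avoids_scanStmt (by decide)
  have h6 : visitStmt.Avoids nb := avoids_visitStmt (by decide)
  have hidle : idleStmt.Valid := tame_zero
  have hedge : edgeStmt.Valid :=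
    ⟨⟨tame_entry _, tame_sub tame_one _⟩, tame_entry _, tame_zero⟩
  have hvisit : visitStmt.Valid :=
    ⟨tame_mod_capExpr _, hedge, ⟨tame_one, tame_arr _ _, ⟨tame_arr _ _, tame_arr _ _,
      tame_arr_add_one _ _⟩, tame_arr_add_one _ _⟩, hidle⟩
  have hscan : scanStmt.Valid := ⟨tame_sub (tame_arr _ _) _, hvisit, h6⟩
  have hsearch : searchStmt.Valid :=
    ⟨⟨tame_zero, by simp [Avoids]⟩, tame_mod_capExpr_add_one _, tame_one, tame_zero,
      ⟨hscan, hidle⟩, h5, by simp [idleStmt, Avoids]⟩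
  have haugment : augmentStmt.Valid :=
    ⟨tame_sub (tame_arr _ _) _, tame_one, ⟨⟨tame_arr _ _, tame_arr _ _, tame_arr _ _, tame_zero⟩,
      hidle⟩, by simp [idleStmt, Avoids]⟩
  refine ⟨⟨tame_one, ⟨tame_mod_capExpr_add_one _, by simp [Avoids]⟩, by simp [Avoids]⟩, ?_, ?_⟩
  · exact ⟨⟨hsearch, ⟨haugment, tame_arr_add_one _ _⟩, hidle⟩, h2, ⟨h4, by simp [Avoids]⟩,
      by simp [idleStmt, Avoids]⟩
  · exact ⟨by decide, h1, ⟨h3, by simp [Avoids]⟩, by simp [idleStmt, Avoids]⟩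

theorem run_muLowStmt (hn : 1 ≤ n) : muLowStmt.run A B (fun _ _ => 0) res 0 = muLow A B := by
  obtain ⟨h1, h2⟩ := run_initStmt (A := A) (B := B) (fun _ _ => 0) (fun _ _ => rfl)
  exact run_greedyStmt hn h1 h2

theorem time_muLowStmt_le (n m : ℕ) : muLowStmt.time n m ≤ 200 * (n + m + 1) ^ 5 := by
  simp only [muLowStmt, initStmt, greedyStmt, searchStmt, augmentStmt, scanStmt, visitStmt,
    edgeStmt, idleStmt, time, Bound.val]
  ring_nf
  omega

/-- The least number of layers is computed in time `O(n ^ 5 * log n ^ 2)`. -/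
theorem exists_ramProg_muLow : ∃ P : RamProg, ∀ c : ℕ, ∃ C : ℕ,
    ∀ (n m : ℕ) (A : Matrix (Fin n) (Fin n) Bool) (B : Matrix (Fin n) (Fin m) Bool),
      1 ≤ n → m ≤ c * n →
      ∃ (t : ℕ) (σ : ℕ → ℕ), RunsIn P (initMemory A B) t σ ∧ σ 0 = muLow A B ∧
        t ≤ C * n ^ 5 * (Nat.log 2 n + 1) ^ 2 := by
  obtain ⟨Q, κ, hQ⟩ := muLowStmt.exists_ramProg valid_muLowStmt
  obtain ⟨μ, hμ⟩ := (var res : Expr Reg).toRam.exists_cost_le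
  refine ⟨.seq Q (.store (.lit 0) (var res : Expr Reg).toRam), fun c => ?_⟩
  set D := 201 * (c + 2) ^ 5 with hD
  refine ⟨(κ * (200 * (c + 2) ^ 5) + 2 * μ + 2) * (D.size + 5) ^ 2, ?_⟩
  intro n m A B hn hm
  set T := muLowStmt.time n m with hT
  set w := ((n + m + 1) ^ 2 + T).size with hw
  set l := Nat.log 2 n + 1 with hl
  have hdim : n + m + 1 ≤ (c + 2) * n := by
    have : (c + 2) * n = c * n + n + n := by ring
    omega
  have hTn : T ≤ 200 * (c + 2) ^ 5 * n ^ 5 := by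
    calc T ≤ 200 * (n + m + 1) ^ 5 := time_muLowStmt_le n m
      _ ≤ 200 * ((c + 2) * n) ^ 5 := by gcongr
      _ = _ := by ring
  have hwl : w ≤ (D.size + 5) * l := by
    have h1 : (n + m + 1) ^ 2 ≤ (n + m + 1) ^ 5 := Nat.pow_le_pow_right (by omega) (by omega)
    have h2 : (n + m + 1) ^ 5 ≤ ((c + 2) * n) ^ 5 := by gcongr
    have h3 : ((c + 2) * n) ^ 5 = (c + 2) ^ 5 * n ^ 5 := by ring
    have h4 : (n + m + 1) ^ 2 + T ≤ D * (n * (n * (n * (n * n)))) := by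
      have : D * (n * (n * (n * (n * n)))) =
          (c + 2) ^ 5 * n ^ 5 + 200 * (c + 2) ^ 5 * n ^ 5 := by rw [hD]; ring
      omega
    have hsn : n.size ≤ l := Nat.size_le.2 (Nat.lt_pow_succ_log_self one_lt_two n)
    have h5 := (size_mul_le D (n * (n * (n * (n * n)))))
    have h6 := size_mul_le n (n * (n * (n * n)))
    have h7 := size_mul_le n (n * (n * n))
    have h8 := size_mul_le n (n * n)
    have h9 := size_mul_le n n
    have h10 : D.size * 1 ≤ D.size * l := Nat.mul_le_mul_left _ (by omega)
    have h11 : (D.size + 5) * l = D.size * l + 5 * l := by ring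
    have h12 := Nat.size_le_size h4
    omega
  have hpos : 1 ≤ (n + m + 1) ^ 2 := Nat.one_le_pow _ _ (by omega)
  have hw1 : 1 ≤ w := Nat.size_pos.2 (by omega)
  obtain ⟨⟨t, ht, hrun⟩, hmem⟩ := hQ A B (fun _ _ => 0) _ w
    (encode_le A B (fun _ _ => Nat.zero_le _) le_rfl) le_rfl le_rfl
  rw [encode_zero] at hrun
  obtain ⟨h1, h2⟩ := hμ _ w hw1 fun x => Nat.size_le_size (hmem x)
  refine ⟨_, _, .seq hrun (.store _ _ _), ?_, ?_⟩
  · change Function.update _ 0 _ 0 = _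
    rw [Function.update_self, Expr.eval_toRam]
    exact run_muLowStmt hn
  · have hlit : (RamExpr.lit 0).cost (encode A B (muLowStmt.run A B fun _ _ => 0)) = 1 := by
      simp [RamExpr.cost]
    have hlit' : ((RamExpr.lit 0).eval (encode A B (muLowStmt.run A B fun _ _ => 0))).size = 0 := by
      simp [RamExpr.eval]
    rw [hlit, hlit']
    have h3 : w ≤ w ^ 2 := Nat.le_self_pow two_ne_zero w
    have h4 : μ * w ≤ μ * w ^ 2 := Nat.mul_le_mul_left _ h3
    have h5 : κ * T * w ^ 2 ≤ κ * (200 * (c + 2) ^ 5) * n ^ 5 * w ^ 2 := by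
      rw [mul_assoc κ (200 * (c + 2) ^ 5)]
      gcongr
    have h6 : (2 * μ + 2) * w ^ 2 ≤ (2 * μ + 2) * n ^ 5 * w ^ 2 := by
      rw [mul_assoc (2 * μ + 2)]
      exact Nat.mul_le_mul_left _ (Nat.le_mul_of_pos_left _ (by positivity))
    calc _ ≤ κ * (200 * (c + 2) ^ 5) * n ^ 5 * w ^ 2 + (2 * μ + 2) * n ^ 5 * w ^ 2 := by linarith
      _ = (κ * (200 * (c + 2) ^ 5) + 2 * μ + 2) * n ^ 5 * w ^ 2 := by ring
      _ ≤ (κ * (200 * (c + 2) ^ 5) + 2 * μ + 2) * n ^ 5 * ((D.size + 5) * l) ^ 2 := by gcongr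
      _ = _ := by ring

end Greedy

end StructCtrl

theorem theorem2 :
    -- the lower bound and its characterization by minimum cost maximum flows
    (∀ (n m : ℕ) (A : Matrix (Fin n) (Fin n) Bool) (B : Matrix (Fin n) (Fin m) Bool), 1 ≤ n →
      IsLeast {k : ℕ | k ∈ Set.Icc 1 n ∧ maxLinking A B k = maxLinking A B n} (muLow A B) ∧
      muLow A B ≤ scoi A B ∧
      ((∃ i j, B i j = true) →
        ∀ f : SplitVertex (DynVertex n m n) → SplitVertex (DynVertex n m n) → ℝ,
          (layeredNetwork A B).IsMCMF f → IsIntegralFlow f → muLow A B = gamma f)) ∧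
    -- the running time, where the number `m` of inputs is `O(n)`
    (∃ (P : RamProg) (p : ℕ), ∀ c : ℕ, ∃ C : ℕ,
      ∀ (n m : ℕ) (A : Matrix (Fin n) (Fin n) Bool) (B : Matrix (Fin n) (Fin m) Bool),
        1 ≤ n → m ≤ c * n →
        ∃ (t : ℕ) (σ : ℕ → ℕ), RunsIn P (initMemory A B) t σ ∧ σ 0 = muLow A B ∧
          t ≤ C * n ^ 5 * (Nat.log 2 n + 1) ^ p) := by
  obtain ⟨P, hP⟩ := exists_ramProg_muLow
  exact ⟨fun n m A B hn => ⟨isLeast_muLow A B hn, muLow_le_scoi A B hn, fun hB f hf hi =>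
    muLow_eq_gamma hn hB hf hi⟩, P, 2, hP⟩
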